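/- **Setting.** Let $d\ge 2$, $m>0$, $p\cdot x=p^0x^0-\mathbf p\cdot\mathbf x$ the Minkowski inner product on $\mathbb R^d$, $\omega(\mathbf p)=\sqrt{\mathbf p^2+m^2}$, $d\mu(p)=\omega(\mathbf p)^{-1}\delta(p^0-\omega(\mathbf p))\,dp$, $\mathscr H_1=L^2(\mathbb R^d,d\mu)$, and let $\mathscr H=\bigoplus_{n\ge0}\mathscr H_n$ be the antisymmetric Fock space over $\mathscr H_1$ with vacuum $\Omega$, where $\mathscr H_n$ is the space of totally antisymmetric functions in $L^2((\mathbb R^d)^n,\mu^{\otimes n})$. For $f\in\mathscr S(\mathbb R^d)$ let $f^\pm(p)=\int f(x)e^{\pm ip\cdot x}dx$, an element of $\mathscr H_1$. A *deformation function* is a continuous $R:\mathbb R\to\mathbb C$ with $R(a)^{-1}=\overline{R(a)}$ for all $a$, whose Fourier transform $\widetilde R(t)=\int R(a)e^{-ita}da$ (a tempered distribution) has support in $[0,\infty)$, and whose resulting analytic extension to the upper half plane is continuous on the closed upper half plane. Let $Q$ be a real $d\times d$ matrix that is antisymmetric with respect to the Minkowski inner product and such that, with $W_0=\{x:x_1>|x_0|\}$,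 for proper Lorentz transformations $\Lambda$: $\Lambda Q\Lambda^{-1}=Q$ if $\Lambda W_0=W_0$ and $\Lambda$ is orthochronous, or if $\Lambda W_0=-W_0$ and $\Lambda$ is antichronous; $\Lambda Q\Lambda^{-1}=-Q$ if $\Lambda W_0=W_0$ and $\Lambda$ is antichronous, or if $\Lambda W_0=-W_0$ and $\Lambda$ is orthochronous. For $\varphi\in\mathscr H_1$ let $a^*_{R,Q}(\varphi)$ and $a_{R,Q}(\varphi)$ be the operators in $\mathscr H$, on their maximal domains, given by $$(a^*_{R,Q}(\varphi)\Psi)_n(p_1,\dots,p_n)=\tfrac1{\sqrt n}\sum_{k=1}^n(-1)^{k+1}\varphi(p_k)\prod_{l\ne k}\overline{R(Qp_k\cdot p_l)}\;\Psi_{n-1}(p_1,\dots,\widehat{p_k},\dots,p_n)$$ for $n\geq 1$, $(a^*_{R,Q}(\varphi)\Psi)_0=0$, and $$(a_{R,Q}(\varphi)\Psi)_n(p_1,\dots,p_n)=\sqrt{n+1}\int d\mu(p)\,\overline{\varphi(p)}\prod_{k=1}^nR(Qp\cdot p_k)\;\Psi_{n+1}(p,p_1,\dots,p_n).$$ Put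 $\phi_{R,Q}(f)=a^*_{R,Q}(f^+)+a_{R,Q}(\overline{f^-})$, and let $\phi(f)$ be the undeformed field, given by the same formulas with $R$ replaced by $1$. Let $\mathcal D\subset\mathscr H$ be the subspace of vectors of finite particle number. **Proposition.** For $R$ and $Q$ as above, the following hold. a) $\mathcal D$ is dense in $\mathscr H$, and for every $f\in\mathscr S(\mathbb R^d)$ it is contained in the domain of $\phi_{R,Q}(f)$; moreover $\phi_{R,Q}(f)\mathcal D\subset\mathcal D$ and $\phi_{R,Q}(f)\Omega=\phi(f)\Omega$. b) For every $f\in\mathscr S(\mathbb R^d)$ and $\Psi\in\mathcal D$, $\Psi$ is in the domain of $\phi_{R,Q}(f)^*$ and $\phi_{R,Q}(f)^*\Psi=\phi_{R,Q}(\overline f)\Psi$; and $\phi_{R,Q}(f)$ is essentially selfadjoint on $\mathcal D$ if $f$ is real. c) $\phi_{R,Q}$ is a weak solution of the Klein–Gordon equation: $\phi_{R,Q}((\Box+m^2)f)=0$ for every $f\in\mathscr S(\mathbb R^d)$. d) (Reeh–Schlieder property) For every non-empty open $\mathcal O\subset\mathbb R^d$ the space $$\mathrm{span}\{\phi_{R,Q}(f_1)\cdots\phi_{R,Q}(f_n)\Omega:\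 n\in\mathbb N_0,\ f_1,\dots,f_n\in\mathscr S(\mathbb R^d),\ \mathrm{supp}\,f_i\subset\mathcal O\}$$ is dense in $\mathscr H$. -/

import Mathlib

open MeasureTheory Complex
open scoped ENNReal SchwartzMap FourierTransform LineDeriv ComplexConjugate

noncomputable section

namespace ScalarFermion

/-! ### Minkowski space of dimension `d = s + 1`, with `s` space dimensions -/

/-- `ℝ^d`, `d = s + 1`; the coordinate `0` is time. -/
abbrev Spacetime (s : ℕ) : Type := EuclideanSpace ℝ (Fin (s + 1))

/-- The Minkowski inner product `x · y = x⁰ y⁰ - ∑ᵢ xⁱ yⁱ`. -/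
def mink {s : ℕ} (x y : Spacetime s) : ℝ :=
  x 0 * y 0 - ∑ i : Fin s, x i.succ * y i.succ

/-- The action of a `d × d` matrix on `ℝ^d`. -/
def act {s : ℕ} (A : Matrix (Fin (s + 1)) (Fin (s + 1)) ℝ) (x : Spacetime s) : Spacetime s :=
  Matrix.toEuclideanLin A x

/-- The right wedge `{x : x¹ > |x⁰|}`. -/
def rightWedge (s : ℕ) : Set (Spacetime s) := {x | |x 0| < x 1}

/-- The spacelike complement `-W₀` of the right wedge. -/
def leftWedge (s : ℕ) : Set (Spacetime s) := {x | -x ∈ rightWedge s}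

/-- Proper Lorentz transformations. -/
def IsProperLorentz {s : ℕ} (L : Matrix (Fin (s + 1)) (Fin (s + 1)) ℝ) : Prop :=
  (∀ x y : Spacetime s, mink (act L x) (act L y) = mink x y) ∧ L.det = 1

/-- The proper orthochronous Lorentz group. -/
def properUp (s : ℕ) : Set (Matrix (Fin (s + 1)) (Fin (s + 1)) ℝ) :=
  {L | IsProperLorentz L ∧ 0 < L 0 0}

/-- The proper antichronous Lorentz transformations. -/
def properDown (s : ℕ) : Set (Matrix (Fin (s + 1)) (Fin (s + 1)) ℝ) :=
  {L | IsProperLorentz L ∧ L 0 0 < 0}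

/-- The admissible deformation matrices: antisymmetric with respect to the Minkowski inner
product, and transforming under the Lorentz transformations that map the right wedge onto itself
or onto its spacelike complement in the prescribed way. -/
structure IsAdmissible {s : ℕ} (Q : Matrix (Fin (s + 1)) (Fin (s + 1)) ℝ) : Prop where
  antisymm : ∀ x y : Spacetime s, mink (act Q x) y = -mink x (act Q y)
  up_right : ∀ L ∈ properUp s, act L '' rightWedge s = rightWedge s → L * Q * L⁻¹ = Q
  down_right : ∀ L ∈ properDown s, act L '' rightWedge s = rightWedge s → L * Q * L⁻¹ = -Q
  up_left : ∀ L ∈ properUp s, act L '' rightWedge s = leftWedge s → L * Q * L⁻¹ = -Q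
  down_left : ∀ L ∈ properDown s, act L '' rightWedge s = leftWedge s → L * Q * L⁻¹ = Q

/-! ### Deformation functions -/

/-- Deformation functions: continuous phase factors `R : ℝ → ℂ` whose Fourier transform is a
tempered distribution with support in `[0, ∞)` and which extend to a function that is analytic on
the open and continuous on the closed upper half plane. -/
structure DeformationFunction where
  toFun : ℝ → ℂ
  continuous_toFun : Continuous toFun
  /-- `R(a)⁻¹ = conj R(a)`. -/
  conj_mul_self : ∀ a, conj (toFun a) * toFun a = 1
  fourier_support : ∃ T : 𝓢'(ℝ, ℂ), (∀ g : 𝓢(ℝ, ℂ), T g = ∫ a, toFun a * g a) ∧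
    Distribution.dsupport (𝓕 T : 𝓢'(ℝ, ℂ)) ⊆ Set.Ici 0
  analytic_extension : ∃ F : ℂ → ℂ, DifferentiableOn ℂ F {z | 0 < z.im} ∧
    ContinuousOn F {z | 0 ≤ z.im} ∧ ∀ a : ℝ, F a = toFun a

instance : CoeFun DeformationFunction (fun _ => ℝ → ℂ) := ⟨DeformationFunction.toFun⟩

lemma DeformationFunction.norm_eq_one (R : DeformationFunction) (a : ℝ) : ‖R a‖ = 1 := by
  have h := R.conj_mul_self a
  rw [Complex.conj_mul'] at h
  have h2 : ‖R a‖ ^ 2 = 1 := by exact_mod_cast h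
  nlinarith [norm_nonneg (R a)]

/-! ### The one-particle space -/

/-- `ω(𝐩) = √(𝐩² + m²)`. -/
def energy (m : ℝ) {s : ℕ} (p : EuclideanSpace ℝ (Fin s)) : ℝ := √(‖p‖ ^ 2 + m ^ 2)

/-- The parametrization `𝐩 ↦ (ω(𝐩), 𝐩)` of the positive mass shell. -/
def shellPoint (m : ℝ) {s : ℕ} (p : EuclideanSpace ℝ (Fin s)) : Spacetime s :=
  WithLp.toLp 2 (Fin.cons (energy m p) p.ofLp)

/-- The invariant measure `dμ(p) = ω(𝐩)⁻¹ δ(p⁰ - ω(𝐩)) dp` on `ℝ^d`. -/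
def shellMeasure (s : ℕ) (m : ℝ) : Measure (Spacetime s) :=
  ((volume : Measure (EuclideanSpace ℝ (Fin s))).withDensity
    (fun p => ENNReal.ofReal (energy m p)⁻¹)).map (shellPoint m)

lemma continuous_energy (m : ℝ) {s : ℕ} :
    Continuous (energy m : EuclideanSpace ℝ (Fin s) → ℝ) := by
  unfold energy; fun_prop

lemma continuous_shellPoint (m : ℝ) {s : ℕ} :
    Continuous (shellPoint m : EuclideanSpace ℝ (Fin s) → Spacetime s) := by
  refine (PiLp.continuous_toLp 2 _).comp (continuous_pi fun i => ?_)
  refine Fin.cases ?_ (fun j => ?_) i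
  · simpa using continuous_energy m
  · simp only [Fin.cons_succ]; fun_prop

lemma shellPoint_injective (m : ℝ) {s : ℕ} :
    Function.Injective (shellPoint m : EuclideanSpace ℝ (Fin s) → Spacetime s) := by
  intro p q h
  ext i
  have := congrArg (fun x : Spacetime s => x i.succ) h
  simpa [shellPoint] using this

instance (s : ℕ) (m : ℝ) : SigmaFinite (shellMeasure s m) := by
  have hE := (continuous_shellPoint m (s := s)).measurableEmbedding (shellPoint_injective m)
  have hd : SigmaFinite ((volume : Measure (EuclideanSpace ℝ (Fin s))).withDensity
      (fun p => ENNReal.ofReal (energy m p)⁻¹)) :=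
    SigmaFinite.withDensity_ofReal _
  exact hE.sigmaFinite_map

/-- The one-particle space `ℋ₁ = L²(ℝ^d, dμ)`. -/
abbrev OneParticle (s : ℕ) (m : ℝ) : Type := Lp ℂ 2 (shellMeasure s m)

/-- `f̃(p) = ∫ f(x) e^{i p·x} dx` with the Minkowski inner product `p·x`. -/
def minkFourier {s : ℕ} (f : 𝓢(Spacetime s, ℂ)) (p : Spacetime s) : ℂ :=
  ∫ x, f x * exp (I * (mink p x : ℂ))

/-! ### The antisymmetric Fock space -/

/-- `μ ⊗ ⋯ ⊗ μ` on `(ℝ^d)ⁿ`. -/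
abbrev shellPi (s : ℕ) (m : ℝ) (n : ℕ) : Measure (Fin n → Spacetime s) :=
  Measure.pi fun _ => shellMeasure s m

lemma measurePreserving_perm (s : ℕ) (m : ℝ) {n : ℕ} (σ : Equiv.Perm (Fin n)) :
    MeasurePreserving (fun p : Fin n → Spacetime s => p ∘ σ) (shellPi s m n) (shellPi s m n) := by
  have h := measurePreserving_piCongrLeft (fun _ : Fin n => shellMeasure s m) σ.symm
  convert h using 1
  ext1 p
  ext1 i
  have := (Equiv.piCongrLeft_apply_apply (fun _ : Fin n => Spacetime s) σ.symm p (σ i))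
  simp only [Equiv.symm_apply_apply] at this
  simpa [MeasurableEquiv.coe_piCongrLeft] using this.symm

/-- The action `Ψ(p₁, …, pₙ) ↦ Ψ(p_{σ(1)}, …, p_{σ(n)})` of a permutation on
`L²((ℝ^d)ⁿ, μ ⊗ ⋯ ⊗ μ)`. -/
def permute (s : ℕ) (m : ℝ) {n : ℕ} (σ : Equiv.Perm (Fin n)) :
    Lp ℂ 2 (shellPi s m n) →ₗᵢ[ℂ] Lp ℂ 2 (shellPi s m n) :=
  Lp.compMeasurePreservingₗᵢ ℂ (fun p => p ∘ σ) (measurePreserving_perm s m σ)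

/-- The `n`-particle space `ℋₙ`: the totally antisymmetric elements of
`L²((ℝ^d)ⁿ, μ ⊗ ⋯ ⊗ μ)`. -/
def nParticle (s : ℕ) (m : ℝ) (n : ℕ) : Submodule ℂ (Lp ℂ 2 (shellPi s m n)) where
  carrier := {Ψ | ∀ σ : Equiv.Perm (Fin n),
    permute s m σ Ψ = ((Equiv.Perm.sign σ : ℤ) : ℂ) • Ψ}
  zero_mem' := fun σ => by simp
  add_mem' := fun {a b} ha hb σ => by rw [map_add, ha σ, hb σ, smul_add]
  smul_mem' := fun c a ha σ => by rw [map_smul, ha σ, smul_comm]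

instance (s : ℕ) (m : ℝ) (n : ℕ) : CompleteSpace (nParticle s m n) := by
  refine IsClosed.completeSpace_coe (hs := ?_)
  have : (nParticle s m n : Set (Lp ℂ 2 (shellPi s m n))) = ⋂ σ : Equiv.Perm (Fin n),
      {Ψ | permute s m σ Ψ = ((Equiv.Perm.sign σ : ℤ) : ℂ) • Ψ} := by
    ext Ψ; simp [nParticle]
  rw [this]
  exact isClosed_iInter fun σ =>
    isClosed_eq (permute s m σ).continuous (continuous_const_smul _)

/-- The antisymmetric Fock space `ℋ = ⨁ₙ ℋₙ` (Hilbert space direct sum). -/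
abbrev Fock (s : ℕ) (m : ℝ) : Type := lp (fun n => nParticle s m n) 2

/-- The `n`-particle wave function of a Fock space vector. -/
def wave {s : ℕ} {m : ℝ} (Ψ : Fock s m) (n : ℕ) : (Fin n → Spacetime s) → ℂ :=
  ((Ψ n : nParticle s m n) : Lp ℂ 2 (shellPi s m n))

instance (s : ℕ) (m : ℝ) : IsFiniteMeasure (shellPi s m 0) := by
  rw [shellPi, Measure.pi_of_empty]; infer_instance

/-- The vector in `ℋ₀ = ℂ` given by the constant function `1`. -/
def vacuumZero (s : ℕ) (m : ℝ) : nParticle s m 0 :=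
  ⟨(memLp_const (1 : ℂ)).toLp (fun _ => 1), fun σ => by
    have : σ = 1 := Subsingleton.elim _ _
    subst this
    simp only [Equiv.Perm.sign_one, Units.val_one, Int.cast_one, one_smul]
    exact Lp.compMeasurePreserving_id_apply _⟩

/-- The vacuum vector `Ω`. -/
def vacuum (s : ℕ) (m : ℝ) : Fock s m := lp.single 2 0 (vacuumZero s m)

/-- The subspace `𝒟` of vectors of finite particle number. -/
def finiteParticle (s : ℕ) (m : ℝ) : Submodule ℂ (Fock s m) where
  carrier := {Ψ | ∃ N : ℕ, ∀ n, N < n → Ψ n = 0}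
  zero_mem' := ⟨0, fun _ _ => rfl⟩
  add_mem' := by
    rintro a b ⟨N, hN⟩ ⟨M, hM⟩
    refine ⟨max N M, fun n hn => ?_⟩
    rw [lp.coeFn_add, Pi.add_apply, hN n (lt_of_le_of_lt (le_max_left _ _) hn),
      hM n (lt_of_le_of_lt (le_max_right _ _) hn), add_zero]
  smul_mem' := by
    rintro c a ⟨N, hN⟩
    exact ⟨N, fun n hn => by rw [lp.coeFn_smul, Pi.smul_apply, hN n hn, smul_zero]⟩

/-! ### Creation and annihilation operators

A family `W(p)`, `p ∈ ℝ^d`, of operators on Fock space, each of which multiplies `n`-particle wave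
functions with a function `W n p : (p₁, …, pₙ) ↦ W n p (p₁, …, pₙ)`, gives rise to the
operator-valued distributions `a*(p) W(p)*` and their adjoints `W(p) a(p)`. The smeared versions
`∫ dμ(p) φ(p) a*(p) W(p)*` and `∫ dμ(p) conj(φ(p)) W(p) a(p)` are given by the explicit formulas
`creationFun` and `annihilationFun`. The undeformed operators are those with `W(p) = 1`. -/

/-- Families of multiplication operators that are jointly measurable and bounded by `1`. -/
structure Multiplier (s : ℕ) where
  toFun : (n : ℕ) → Spacetime s → (Fin n → Spacetime s) → ℂ
  measurable_toFun : ∀ n, Measurable fun x : Spacetime s × (Fin n → Spacetime s) =>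
    toFun n x.1 x.2
  norm_le_one : ∀ n p q, ‖toFun n p q‖ ≤ 1

/-- The family `W(p) = 1`. -/
def Multiplier.one (s : ℕ) : Multiplier s where
  toFun := fun _ _ _ => 1
  measurable_toFun := fun _ => measurable_const
  norm_le_one := fun _ _ _ => by simp

lemma measurable_mink_act {s : ℕ} (Q : Matrix (Fin (s + 1)) (Fin (s + 1)) ℝ) :
    Measurable fun x : Spacetime s × Spacetime s => mink (act Q x.1) x.2 := by
  refine Continuous.measurable ?_
  have : Continuous (act Q : Spacetime s → Spacetime s) :=
    LinearMap.continuous_of_finiteDimensional (Matrix.toEuclideanLin Q)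
  unfold mink
  fun_prop

lemma measurable_deformation {s : ℕ} (R : DeformationFunction)
    (Q : Matrix (Fin (s + 1)) (Fin (s + 1)) ℝ) {n : ℕ} (k : Fin n) :
    Measurable fun x : Spacetime s × (Fin n → Spacetime s) =>
      R (mink (act Q x.1) (x.2 k)) := by
  have h : Measurable fun x : Spacetime s × (Fin n → Spacetime s) => (x.1, x.2 k) :=
    measurable_fst.prodMk ((measurable_pi_apply k).comp measurable_snd)
  have h2 := (measurable_mink_act Q).comp h
  exact R.continuous_toFun.measurable.comp h2

/-- The family `W(p) = T_R(Qp)`, where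
`(T_R(x)Ψ)ₙ(p₁, …, pₙ) = ∏ₖ R(x·pₖ) Ψₙ(p₁, …, pₙ)`. -/
def Multiplier.deformation {s : ℕ} (R : DeformationFunction)
    (Q : Matrix (Fin (s + 1)) (Fin (s + 1)) ℝ) : Multiplier s where
  toFun := fun n p q => ∏ k : Fin n, R (mink (act Q p) (q k))
  measurable_toFun := fun _ => Finset.measurable_fun_prod _ fun k _ => measurable_deformation R Q k
  norm_le_one := fun n p q => by simp [R.norm_eq_one]

/-- The `n`-particle wave functions of `∫ dμ(p) φ(p) a*(p) W(p)* Ψ`: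
`n^{-1/2} ∑ₖ (-1)^{k+1} φ(pₖ) conj(W(pₖ))(p₁, …, p̂ₖ, …, pₙ) Ψₙ₋₁(p₁, …, p̂ₖ, …, pₙ)`,
`k = 1, …, n` (the index `k` below starts at `0`). -/
def creationFun {s : ℕ} {m : ℝ} (W : Multiplier s) (φ : OneParticle s m) (Ψ : Fock s m) :
    (n : ℕ) → (Fin n → Spacetime s) → ℂ
  | 0, _ => 0
  | n + 1, p => ((√(n + 1 : ℝ) : ℝ) : ℂ)⁻¹ * ∑ k : Fin (n + 1), (-1) ^ (k : ℕ) * φ (p k) *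
      conj (W.toFun n (p k) (fun l => p (k.succAbove l))) *
      wave Ψ n (fun l => p (k.succAbove l))

/-- The `n`-particle wave functions of `∫ dμ(p) conj(φ(p)) W(p) a(p) Ψ`:
`(n+1)^{1/2} ∫ dμ(p) conj(φ(p)) W(p)(p₁, …, pₙ) Ψₙ₊₁(p, p₁, …, pₙ)`. -/
def annihilationFun {s : ℕ} {m : ℝ} (W : Multiplier s) (φ : OneParticle s m) (Ψ : Fock s m)
    (n : ℕ) (q : Fin n → Spacetime s) : ℂ :=
  ((√(n + 1 : ℝ) : ℝ) : ℂ) *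
    ∫ p, conj (φ p) * W.toFun n p q * wave Ψ (n + 1) (Fin.cons p q) ∂(shellMeasure s m)

lemma wave_add {s : ℕ} {m : ℝ} (Ψ Φ : Fock s m) (n : ℕ) :
    wave (Ψ + Φ) n =ᵐ[shellPi s m n] fun p => wave Ψ n p + wave Φ n p := by
  unfold wave
  rw [lp.coeFn_add, Pi.add_apply, Submodule.coe_add]
  exact Lp.coeFn_add _ _

lemma wave_smul {s : ℕ} {m : ℝ} (c : ℂ) (Ψ : Fock s m) (n : ℕ) :
    wave (c • Ψ) n =ᵐ[shellPi s m n] fun p => c * wave Ψ n p := by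
  unfold wave
  rw [lp.coeFn_smul, Pi.smul_apply, Submodule.coe_smul]
  exact Lp.coeFn_smul _ _

lemma quasiMeasurePreserving_succAbove (s : ℕ) (m : ℝ) {n : ℕ} (k : Fin (n + 1)) :
    Measure.QuasiMeasurePreserving
      (fun (p : Fin (n + 1) → Spacetime s) (l : Fin n) => p (k.succAbove l))
      (shellPi s m (n + 1)) (shellPi s m n) :=
  Measure.quasiMeasurePreserving_snd.comp
    (measurePreserving_piFinSuccAbove (fun _ : Fin (n + 1) => shellMeasure s m)
      k).quasiMeasurePreserving

lemma measurePreserving_cons (s : ℕ) (m : ℝ) (n : ℕ) :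
    MeasurePreserving
      (fun x : (Fin n → Spacetime s) × Spacetime s => (Fin.cons x.2 x.1 : Fin (n + 1) → Spacetime s))
      ((shellPi s m n).prod (shellMeasure s m)) (shellPi s m (n + 1)) := by
  have h := (measurePreserving_piFinSuccAbove (fun _ : Fin (n + 1) => shellMeasure s m) 0).symm
  have h2 := h.comp (Measure.measurePreserving_swap (μ := shellPi s m n) (ν := shellMeasure s m))
  convert h2 using 1
  ext1 x
  simp [MeasurableEquiv.piFinSuccAbove, Fin.insertNthEquiv]

lemma creationFun_add {s : ℕ} {m : ℝ} (W : Multiplier s) (φ : OneParticle s m) (Ψ Φ : Fock s m)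
    (n : ℕ) : creationFun W φ (Ψ + Φ) n =ᵐ[shellPi s m n]
      fun p => creationFun W φ Ψ n p + creationFun W φ Φ n p := by
  cases n with
  | zero => exact Filter.Eventually.of_forall fun _ => by simp [creationFun]
  | succ n =>
    have h := ae_all_iff.2 fun k : Fin (n + 1) =>
      (quasiMeasurePreserving_succAbove s m k).ae (wave_add Ψ Φ n)
    filter_upwards [h] with p hp
    simp only [creationFun, hp, mul_add, Finset.sum_add_distrib]

lemma creationFun_smul {s : ℕ} {m : ℝ} (W : Multiplier s) (φ : OneParticle s m) (c : ℂ)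
    (Ψ : Fock s m) (n : ℕ) : creationFun W φ (c • Ψ) n =ᵐ[shellPi s m n]
      fun p => c * creationFun W φ Ψ n p := by
  cases n with
  | zero => exact Filter.Eventually.of_forall fun _ => by simp [creationFun]
  | succ n =>
    have h := ae_all_iff.2 fun k : Fin (n + 1) =>
      (quasiMeasurePreserving_succAbove s m k).ae (wave_smul c Ψ n)
    filter_upwards [h] with p hp
    simp only [creationFun, hp, Finset.mul_sum]
    exact Finset.sum_congr rfl fun k _ => by ring

lemma integrable_annihilation {s : ℕ} {m : ℝ} (W : Multiplier s) (φ : OneParticle s m)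
    (Ψ : Fock s m) (n : ℕ) : ∀ᵐ q ∂(shellPi s m n),
      Integrable (fun p => conj (φ p) * W.toFun n p q * wave Ψ (n + 1) (Fin.cons p q))
        (shellMeasure s m) := by
  have hΨ : MemLp (wave Ψ (n + 1)) 2 (shellPi s m (n + 1)) := Lp.memLp _
  have hΨ2 := hΨ.comp_measurePreserving (measurePreserving_cons s m n)
  have hi := (hΨ2.integrable_norm_pow (by norm_num)).prod_right_ae
  filter_upwards [hi, hΨ2.1.prodMk_left] with q hq hm
  have h2 : MemLp (fun p => wave Ψ (n + 1) (Fin.cons p q)) 2 (shellMeasure s m) := by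
    refine (memLp_two_iff_integrable_sq_norm hm).2 ?_
    simpa using hq
  have hφ : MemLp (fun p => conj (φ p)) 2 (shellMeasure s m) := (Lp.memLp φ).star
  have hWm : Measurable fun p => W.toFun n p q :=
    (W.measurable_toFun n).comp (measurable_id.prodMk measurable_const)
  have hφW : MemLp (fun p => conj (φ p) * W.toFun n p q) 2 (shellMeasure s m) := by
    refine hφ.mono (hφ.1.mul hWm.aestronglyMeasurable) (Filter.Eventually.of_forall fun p => ?_)
    rw [norm_mul]
    exact mul_le_of_le_one_right (norm_nonneg _) (W.norm_le_one n p q)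
  exact hφW.integrable_mul h2

lemma annihilationFun_add {s : ℕ} {m : ℝ} (W : Multiplier s) (φ : OneParticle s m)
    (Ψ Φ : Fock s m) (n : ℕ) : annihilationFun W φ (Ψ + Φ) n =ᵐ[shellPi s m n]
      fun p => annihilationFun W φ Ψ n p + annihilationFun W φ Φ n p := by
  have h := Measure.ae_ae_of_ae_prod
    ((measurePreserving_cons s m n).quasiMeasurePreserving.ae (wave_add Ψ Φ (n + 1)))
  filter_upwards [h, integrable_annihilation W φ Ψ n, integrable_annihilation W φ Φ n]
    with q hq h1 h2
  simp only [annihilationFun]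
  rw [← mul_add, ← integral_add h1 h2]
  congr 1
  refine integral_congr_ae ?_
  filter_upwards [hq] with p hp
  rw [hp, mul_add]

lemma annihilationFun_smul {s : ℕ} {m : ℝ} (W : Multiplier s) (φ : OneParticle s m) (c : ℂ)
    (Ψ : Fock s m) (n : ℕ) : annihilationFun W φ (c • Ψ) n =ᵐ[shellPi s m n]
      fun p => c * annihilationFun W φ Ψ n p := by
  have h := Measure.ae_ae_of_ae_prod
    ((measurePreserving_cons s m n).quasiMeasurePreserving.ae (wave_smul c Ψ (n + 1)))
  filter_upwards [h] with q hq
  simp only [annihilationFun]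
  rw [mul_left_comm]
  congr 1
  rw [← integral_const_mul c]
  refine integral_congr_ae ?_
  filter_upwards [hq] with p hp
  rw [hp]; ring

lemma wave_ext {s : ℕ} {m : ℝ} {Ψ Φ : Fock s m}
    (h : ∀ n, wave Ψ n =ᵐ[shellPi s m n] wave Φ n) : Ψ = Φ := by
  ext1
  ext1 n
  exact Subtype.ext (Lp.ext (h n))

/-- The maximal domain of `Ψ ↦ F(Ψ)`: those `Ψ ∈ ℋ` for which the sequence of wave functions
`F(Ψ)` is (almost everywhere equal to) an element of `ℋ`. -/
def maximalDomain {s : ℕ} {m : ℝ} (F : Fock s m → (n : ℕ) → (Fin n → Spacetime s) → ℂ)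
    (hadd : ∀ Ψ Φ n, F (Ψ + Φ) n =ᵐ[shellPi s m n] fun p => F Ψ n p + F Φ n p)
    (hsmul : ∀ (c : ℂ) Ψ n, F (c • Ψ) n =ᵐ[shellPi s m n] fun p => c * F Ψ n p) :
    Submodule ℂ (Fock s m) where
  carrier := {Ψ | ∃ X : Fock s m, ∀ n, wave X n =ᵐ[shellPi s m n] F Ψ n}
  zero_mem' := ⟨(0 : ℂ) • 0, fun n => by
    have h := hsmul 0 0 n
    rw [smul_zero] at h
    filter_upwards [h, wave_smul (0 : ℂ) (0 : Fock s m) n] with p h1 h2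
    rw [h1, h2, zero_mul, zero_mul]⟩
  add_mem' := by
    rintro Ψ Φ ⟨X, hX⟩ ⟨Y, hY⟩
    refine ⟨X + Y, fun n => ?_⟩
    filter_upwards [wave_add X Y n, hX n, hY n, hadd Ψ Φ n] with p h1 h2 h3 h4
    rw [h1, h2, h3, h4]
  smul_mem' := by
    rintro c Ψ ⟨X, hX⟩
    refine ⟨c • X, fun n => ?_⟩
    filter_upwards [wave_smul c X n, hX n, hsmul c Ψ n] with p h1 h2 h3
    rw [h1, h2, h3]

/-- The operator `Ψ ↦ F(Ψ)` on its maximal domain. -/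
def maximalOperator {s : ℕ} {m : ℝ} (F : Fock s m → (n : ℕ) → (Fin n → Spacetime s) → ℂ)
    (hadd : ∀ Ψ Φ n, F (Ψ + Φ) n =ᵐ[shellPi s m n] fun p => F Ψ n p + F Φ n p)
    (hsmul : ∀ (c : ℂ) Ψ n, F (c • Ψ) n =ᵐ[shellPi s m n] fun p => c * F Ψ n p) :
    Fock s m →ₗ.[ℂ] Fock s m where
  domain := maximalDomain F hadd hsmul
  toFun :=
    have h : ∀ Ψ : maximalDomain F hadd hsmul,
      ∃ X : Fock s m, ∀ n, wave X n =ᵐ[shellPi s m n] F Ψ n := fun Ψ => Ψ.2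
    { toFun := fun Ψ => Classical.choose (h Ψ)
      map_add' := fun Ψ Φ => wave_ext fun n => by
        have h1 : _ =ᵐ[shellPi s m n] F (Ψ + Φ : Fock s m) n := Classical.choose_spec (h (Ψ + Φ)) n
        have h2 := Classical.choose_spec (h Ψ) n
        have h3 := Classical.choose_spec (h Φ) n
        have h4 := hadd Ψ Φ n
        have h5 := wave_add (Classical.choose (h Ψ)) (Classical.choose (h Φ)) n
        exact h1.trans (h4.trans ((h2.add h3).symm.trans h5.symm))
      map_smul' := fun c Ψ => wave_ext fun n => by
        have h1 : _ =ᵐ[shellPi s m n] F (c • Ψ : Fock s m) n := Classical.choose_spec (h (c • Ψ)) n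
        have h2 := Classical.choose_spec (h Ψ) n
        have h3 := hsmul c Ψ n
        have h4 := wave_smul c (Classical.choose (h Ψ)) n
        refine h1.trans (h3.trans (Filter.EventuallyEq.trans ?_ h4.symm))
        filter_upwards [h2] with p hp
        rw [hp] }

lemma maximalOperator_spec {s : ℕ} {m : ℝ} (F : Fock s m → (n : ℕ) → (Fin n → Spacetime s) → ℂ)
    (hadd : ∀ Ψ Φ n, F (Ψ + Φ) n =ᵐ[shellPi s m n] fun p => F Ψ n p + F Φ n p)
    (hsmul : ∀ (c : ℂ) Ψ n, F (c • Ψ) n =ᵐ[shellPi s m n] fun p => c * F Ψ n p)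
    (Ψ : (maximalOperator F hadd hsmul).domain) (n : ℕ) :
    wave (maximalOperator F hadd hsmul Ψ) n =ᵐ[shellPi s m n] F Ψ n :=
  Classical.choose_spec (p := fun X : Fock s m => ∀ n, wave X n =ᵐ[shellPi s m n] F Ψ n) Ψ.2 n

/-- `∫ dμ(p) φ(p) a*(p) W(p)*`. -/
def creation {s : ℕ} {m : ℝ} (W : Multiplier s) (φ : OneParticle s m) :
    Fock s m →ₗ.[ℂ] Fock s m :=
  maximalOperator (creationFun W φ) (creationFun_add W φ) (creationFun_smul W φ)

/-- `∫ dμ(p) conj(φ(p)) W(p) a(p)`. -/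
def annihilation {s : ℕ} {m : ℝ} (W : Multiplier s) (φ : OneParticle s m) :
    Fock s m →ₗ.[ℂ] Fock s m :=
  maximalOperator (annihilationFun W φ) (annihilationFun_add W φ) (annihilationFun_smul W φ)

/-! ### The fields -/

lemma minkFourier_eq {s : ℕ} (f : 𝓢(Spacetime s, ℂ)) (p : Spacetime s) :
    minkFourier f p = 𝓕 f (WithLp.toLp 2
      (Fin.cons (-(2 * Real.pi)⁻¹ * p 0) (fun i : Fin s => (2 * Real.pi)⁻¹ * p i.succ))) := by
  rw [SchwartzMap.fourier_coe, Real.fourier_eq' , minkFourier]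
  refine integral_congr_ae (Filter.Eventually.of_forall fun x => ?_)
  simp only [smul_eq_mul]
  rw [mul_comm]
  congr 2
  have hpi : (Real.pi : ℂ) ≠ 0 := by exact_mod_cast Real.pi_ne_zero
  simp only [mink, PiLp.inner_apply, Fin.sum_univ_succ, Fin.cons_zero, Fin.cons_succ,
    RCLike.inner_apply, conj_trivial]
  push_cast
  simp only [mul_assoc, ← Finset.mul_sum]
  field_simp
  ring

lemma continuous_minkFourier {s : ℕ} (f : 𝓢(Spacetime s, ℂ)) : Continuous (minkFourier f) := by
  rw [show minkFourier f = fun p => 𝓕 f (WithLp.toLp 2 (Fin.cons (-(2 * Real.pi)⁻¹ * p 0)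
    (fun i : Fin s => (2 * Real.pi)⁻¹ * p i.succ))) from funext (minkFourier_eq f)]
  refine (𝓕 f).continuous.comp ((PiLp.continuous_toLp 2 _).comp (continuous_pi fun i => ?_))
  refine Fin.cases ?_ (fun j => ?_) i
  · simp only [Fin.cons_zero]; fun_prop
  · simp only [Fin.cons_succ]; fun_prop

lemma minkFourier_shell_bound {s : ℕ} (m : ℝ) (f : 𝓢(Spacetime s, ℂ)) (ε : ℝ) (hε : |ε| = 1) :
    ∃ C : ℝ, ∀ p : EuclideanSpace ℝ (Fin s),
      ‖minkFourier f (ε • shellPoint m p)‖ ^ 2 ≤ C * (1 + ‖p‖) ^ (-((2 * (s + 1) : ℕ) : ℝ)) := by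
  obtain ⟨C, hC⟩ : ∃ C : ℝ, ∀ y, (1 + ‖y‖) ^ (s + 1) * ‖𝓕 f y‖ ≤ C := by
    refine ⟨2 ^ (s + 1) * ((Finset.Iic (s + 1, 0)).sup
      fun m => SchwartzMap.seminorm ℝ m.1 m.2) (𝓕 f), fun y => ?_⟩
    simpa using SchwartzMap.one_add_le_sup_seminorm_apply (𝕜 := ℝ) (m := (s + 1, 0))
      le_rfl le_rfl (𝓕 f) y
  refine ⟨((2 * Real.pi) ^ (s + 1) * C) ^ 2, fun p => ?_⟩
  rw [minkFourier_eq]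
  set y : Spacetime s := WithLp.toLp 2 (Fin.cons (-(2 * Real.pi)⁻¹ * (ε • shellPoint m p) 0)
    (fun i : Fin s => (2 * Real.pi)⁻¹ * (ε • shellPoint m p) i.succ)) with hy
  have hpi : 1 ≤ 2 * Real.pi := by linarith [Real.pi_gt_three]
  have hy1 : (2 * Real.pi)⁻¹ * ‖p‖ ≤ ‖y‖ := by
    refine le_of_sq_le_sq ?_ (norm_nonneg _)
    rw [mul_pow, EuclideanSpace.norm_sq_eq, EuclideanSpace.norm_sq_eq, Fin.sum_univ_succ,
      Finset.mul_sum]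
    refine le_add_of_nonneg_of_le (sq_nonneg _) (Finset.sum_le_sum fun i _ => ?_)
    have hε2 : ε ^ 2 = 1 := by rw [← sq_abs, hε, one_pow]
    simp only [hy, Fin.cons_succ, PiLp.smul_apply, shellPoint, smul_eq_mul, Real.norm_eq_abs,
      sq_abs, mul_pow, hε2, one_mul, le_refl]
  have hy2 : 1 + ‖p‖ ≤ 2 * Real.pi * (1 + ‖y‖) := by
    have : ‖p‖ ≤ 2 * Real.pi * ‖y‖ := by
      rwa [inv_mul_le_iff₀ (by positivity)] at hy1
    linarith
  have hb : (1 + ‖p‖) ^ (s + 1) * ‖𝓕 f y‖ ≤ (2 * Real.pi) ^ (s + 1) * C := by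
    calc (1 + ‖p‖) ^ (s + 1) * ‖𝓕 f y‖
        ≤ (2 * Real.pi * (1 + ‖y‖)) ^ (s + 1) * ‖𝓕 f y‖ := by gcongr
      _ = (2 * Real.pi) ^ (s + 1) * ((1 + ‖y‖) ^ (s + 1) * ‖𝓕 f y‖) := by rw [mul_pow]; ring
      _ ≤ _ := by gcongr; exact hC y
  have hp : 0 < 1 + ‖p‖ := by positivity
  rw [Real.rpow_neg hp.le, Real.rpow_natCast, ← div_eq_mul_inv, le_div_iff₀ (by positivity)]
  calc ‖𝓕 f y‖ ^ 2 * (1 + ‖p‖) ^ (2 * (s + 1))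
      = ((1 + ‖p‖) ^ (s + 1) * ‖𝓕 f y‖) ^ 2 := by ring
    _ ≤ _ := by gcongr

lemma memLp_minkFourier {s : ℕ} {m : ℝ} (hm : 0 < m) (f : 𝓢(Spacetime s, ℂ)) (ε : ℝ)
    (hε : |ε| = 1) :
    MemLp (fun p => minkFourier f (ε • p)) 2 (shellMeasure s m) := by
  have hE := (continuous_shellPoint m (s := s)).measurableEmbedding (shellPoint_injective m)
  have hc : Continuous fun p : Spacetime s => minkFourier f (ε • p) :=
    (continuous_minkFourier f).comp (continuous_const_smul ε)
  rw [shellMeasure, hE.memLp_map_measure_iff]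
  have hle : (volume : Measure (EuclideanSpace ℝ (Fin s))).withDensity
      (fun p => ENNReal.ofReal (energy m p)⁻¹) ≤ ENNReal.ofReal m⁻¹ • volume := by
    rw [← withDensity_const]
    refine withDensity_mono (Filter.Eventually.of_forall fun p => ENNReal.ofReal_le_ofReal ?_)
    refine inv_anti₀ hm (Real.le_sqrt_of_sq_le ?_)
    nlinarith [sq_nonneg ‖p‖]
  refine MemLp.mono_measure hle (MemLp.smul_measure ?_ ENNReal.ofReal_ne_top)
  have hc2 := (hc.comp (continuous_shellPoint m)).aestronglyMeasurable
    (μ := (volume : Measure (EuclideanSpace ℝ (Fin s))))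
  refine (memLp_two_iff_integrable_sq_norm hc2).2 ?_
  obtain ⟨C, hC⟩ := minkFourier_shell_bound m f ε hε
  refine Integrable.mono' ((integrable_one_add_norm (E := EuclideanSpace ℝ (Fin s))
    (μ := volume) (r := ((2 * (s + 1) : ℕ) : ℝ)) ?_).const_mul C) (hc2.norm.pow 2) ?_
  · rw [finrank_euclideanSpace_fin]; exact_mod_cast (by omega)
  · refine Filter.Eventually.of_forall fun p => ?_
    rw [Real.norm_of_nonneg (by positivity)]
    exact hC p

/-- `f⁺`, i.e. `p ↦ f̃(p)`, as an element of `ℋ₁`. -/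
def fPlus {s : ℕ} {m : ℝ} (hm : 0 < m) (f : 𝓢(Spacetime s, ℂ)) : OneParticle s m :=
  MemLp.toLp (fun p => minkFourier f p) (by simpa using memLp_minkFourier hm f 1 (by simp))

/-- `f⁻`, i.e. `p ↦ f̃(-p)`, as an element of `ℋ₁`. -/
def fMinus {s : ℕ} {m : ℝ} (hm : 0 < m) (f : 𝓢(Spacetime s, ℂ)) : OneParticle s m :=
  MemLp.toLp (fun p => minkFourier f (-p)) (by simpa using memLp_minkFourier hm f (-1) (by simp))

/-- The undeformed field `φ(f) = a*(f⁺) + a(conj f⁻)`. -/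
def field {s : ℕ} {m : ℝ} (hm : 0 < m) (f : 𝓢(Spacetime s, ℂ)) : Fock s m →ₗ.[ℂ] Fock s m :=
  creation (Multiplier.one s) (fPlus hm f) + annihilation (Multiplier.one s) (star (fMinus hm f))

/-- The deformed field `φ_{R,Q}(f) = a*_{R,Q}(f⁺) + a_{R,Q}(conj f⁻)`, where
`a*_{R,Q}(p) = a*(p) T_R(Qp)*` and `a_{R,Q}(p) = a*_{R,Q}(p)*`; its domain is the intersection of
the domains of the two summands. -/
def deformedField {s : ℕ} {m : ℝ} (hm : 0 < m) (R : DeformationFunction)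
    (Q : Matrix (Fin (s + 1)) (Fin (s + 1)) ℝ) (f : 𝓢(Spacetime s, ℂ)) :
    Fock s m →ₗ.[ℂ] Fock s m :=
  creation (Multiplier.deformation R Q) (fPlus hm f) +
    annihilation (Multiplier.deformation R Q) (star (fMinus hm f))

/-- The complex conjugate test function. -/
def conjTest {s : ℕ} (f : 𝓢(Spacetime s, ℂ)) : 𝓢(Spacetime s, ℂ) :=
  SchwartzMap.postcompCLM (𝕜 := ℝ) (Complex.conjCLE : ℂ →L[ℝ] ℂ) f

/-- `(□ + m²) f = ∂₀² f - ∑ᵢ ∂ᵢ² f + m² f`. -/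
def kleinGordon {s : ℕ} (m : ℝ) (f : 𝓢(Spacetime s, ℂ)) : 𝓢(Spacetime s, ℂ) :=
  ∂_{EuclideanSpace.single (0 : Fin (s + 1)) (1 : ℝ)}
      (∂_{EuclideanSpace.single (0 : Fin (s + 1)) (1 : ℝ)} f) -
    ∑ i : Fin s, ∂_{EuclideanSpace.single i.succ (1 : ℝ)}
      (∂_{EuclideanSpace.single i.succ (1 : ℝ)} f) + (m ^ 2 : ℝ) • f

/-- The vectors `φ_{R,Q}(f₁) ⋯ φ_{R,Q}(fₙ) Ω`, `n ≥ 0`, with test functions `fᵢ` supported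
in `O`. -/
inductive IsFieldMonomial {s : ℕ} {m : ℝ} (hm : 0 < m) (R : DeformationFunction)
    (Q : Matrix (Fin (s + 1)) (Fin (s + 1)) ℝ) (O : Set (Spacetime s)) : Fock s m → Prop
  | vacuum : IsFieldMonomial hm R Q O (vacuum s m)
  | apply (f : 𝓢(Spacetime s, ℂ)) (hf : tsupport f ⊆ O) (Ψ : Fock s m)
      (hΨ : IsFieldMonomial hm R Q O Ψ) (hdom : Ψ ∈ (deformedField hm R Q f).domain) :
      IsFieldMonomial hm R Q O (deformedField hm R Q f ⟨Ψ, hdom⟩)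

/-- `A` is essentially selfadjoint on the subspace `D`: `D` is contained in the domain of `A`, and
the restriction of `A` to `D` is closable with selfadjoint closure. -/
def IsEssentiallySelfAdjointOn {s : ℕ} {m : ℝ} (A : Fock s m →ₗ.[ℂ] Fock s m)
    (D : Submodule ℂ (Fock s m)) : Prop :=
  D ≤ A.domain ∧ (A.domRestrict D).IsClosable ∧ IsSelfAdjoint (A.domRestrict D).closure

end ScalarFermion

end

/-! The deformation enters only through the multiplier `W(p) = T_R(Qp)`, which is bounded by one,
symmetric in the particle variables and nowhere zero. This makes the creation operators bounded maps
`C n : ℋₙ → ℋₙ₊₁` with `‖C n‖ ≤ √(n+1) ‖g‖` (`norm_creL_le`), the annihilation operators being their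
adjoints (`coeFn_annL`). On sequences of particle vectors the field is therefore `raise C + lower
C'`, where `C` belongs to `f⁺` and `C'` to `conj f⁻`.

Part a) follows, since both summands preserve finite sequences and on the vacuum the multiplier is
an empty product. For b), `raise` and `lower` are adjoint to each other under the pairing `bracket`,
and complex conjugation of `f` exchanges `f⁺` with `conj f⁻`. For real `f`, the adjoint of the field
restricted to `𝒟` still acts on sequences as `C + C*`; a vector in its domain is approximated in the
graph norm by cutoffs that are functions of `√n / (j+1)`, whose commutators with the field stay
bounded because `(√(n+1) - √n) √(n+1) ≤ 1` (`mem_closure_graph`). For c), `f⁺` and `f⁻` are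
restrictions of the Fourier transform to the two mass shells, where the symbol `m² - p·p` vanishes.

For d), let `χ` be orthogonal to all local field monomials. Translations act by phases and commute
with the multiplier, hence move each field in a monomial. Energy positivity makes their matrix
elements boundary values of analytic functions, so that vanishing near the origin implies vanishing
everywhere (`bracket_transSeq_eq_zero`). This allows the leftmost field to be translated by any `x`
while the others stay in place (`IsOrthogonal.bracket_translate`). As a function of `x` the result
is a sum of positive frequencies from the creation part and negative ones from the annihilation
part, which can cancel only if each vanishes; and local test functions separate `ℋ₁`
(`eq_zero_of_inner_transOne_add`). Hence `χ` is orthogonal to `a*(g)` applied to any monomial, i.e.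
`a(g)χ` is again orthogonal to all monomials (`IsOrthogonal.lower`). Repeated annihilation leads
down to the vacuum component, and a component killed by all annihilation operators is zero
(`eq_zero_of_annL_eq_zero`). -/

noncomputable section

namespace ScalarFermion

/-! ### Uniqueness of boundary values on the upper half plane -/

/-- A function that is analytic on the open upper half plane, continuous on the closed one and
zero on the bottom edge of a square vanishes at the centre of that square. -/
lemma eq_zero_at_centre {h : ℂ → ℂ} (hd : DifferentiableOn ℂ h {z | 0 < z.im})
    (hc : ContinuousOn h {z | 0 ≤ z.im}) {x r : ℝ} (hr : 0 < r)
    (h0 : ∀ t : ℝ, |t - x| ≤ r → h t = 0) : h (x + r * I) = 0 := by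
  set c : ℂ := x + r * I with hcdef
  have hcre : c.re = x := by simp [hcdef]
  have hcim : c.im = r := by simp [hcdef]
  let U : Set ℂ := Set.Ioo (x - r) (x + r) ×ℂ Set.Ioo 0 (2 * r)
  have hUb : Bornology.IsBounded U := (Metric.isBounded_Ioo _ _).reProdIm (Metric.isBounded_Ioo _ _)
  have hUcl : closure U = Set.Icc (x - r) (x + r) ×ℂ Set.Icc 0 (2 * r) := by
    rw [Complex.closure_reProdIm, closure_Ioo (by linarith), closure_Ioo (by linarith)]
  have hUo : IsOpen U := isOpen_Ioo.reProdIm isOpen_Ioo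
  -- the four rotations about the centre
  have hrot : ∀ w : ℂ, w = 1 ∨ w = I ∨ w = -1 ∨ w = -I →
      Set.MapsTo (fun z => c + w * (z - c)) U U ∧
      Set.MapsTo (fun z => c + w * (z - c)) (closure U) (closure U) := by
    rw [hUcl]
    rintro w (rfl | rfl | rfl | rfl) <;> constructor <;> intro z hz <;>
      simp only [U, Complex.mem_reProdIm, Set.mem_Ioo, Set.mem_Icc] at hz ⊢ <;>
      simp [hcre, hcim] <;> refine ⟨⟨?_, ?_⟩, ?_, ?_⟩ <;> linarith [hz.1.1, hz.1.2, hz.2.1, hz.2.2]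
  have hcomp : ∀ w : ℂ, w = 1 ∨ w = I ∨ w = -1 ∨ w = -I →
      DiffContOnCl ℂ (fun z => h (c + w * (z - c))) U := by
    intro w hw
    refine ⟨?_, ?_⟩
    · refine hd.comp (by fun_prop) fun z hz => ?_
      have := (hrot w hw).1 hz
      exact this.2.1
    · refine hc.comp (by fun_prop) fun z hz => ?_
      have := (hrot w hw).2 hz
      rw [hUcl] at this
      exact this.2.1
  -- Each edge of the square is carried to the bottom edge by one of the four rotations, where `h`
  -- vanishes. Hence the product vanishes on the whole frontier, and by the maximum principle at the
  -- centre, where it equals `h c ^ 4`.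
  let G : ℂ → ℂ := fun z => h (c + 1 * (z - c)) * h (c + I * (z - c)) *
    (h (c + (-1) * (z - c)) * h (c + (-I) * (z - c)))
  have hG : DiffContOnCl ℂ G U :=
    ⟨((hcomp 1 (by simp)).1.mul (hcomp I (by simp)).1).mul
      ((hcomp (-1) (by simp)).1.mul (hcomp (-I) (by simp)).1),
     ((hcomp 1 (by simp)).2.mul (hcomp I (by simp)).2).mul
      ((hcomp (-1) (by simp)).2.mul (hcomp (-I) (by simp)).2)⟩
  have hreal : ∀ z : ℂ, z.im = 0 → |z.re - x| ≤ r → h z = 0 := by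
    intro z hz hz'
    have : z = (z.re : ℂ) := by apply Complex.ext <;> simp [hz]
    rw [this]; exact h0 _ hz'
  have hfr : ∀ z ∈ frontier U, ‖G z‖ ≤ 0 := by
    intro z hz
    rw [frontier, hUo.interior_eq, hUcl] at hz
    obtain ⟨hz1, hz2⟩ := hz
    simp only [U, Complex.mem_reProdIm, Set.mem_Ioo, Set.mem_Icc] at hz1 hz2
    obtain ⟨⟨a1, a2⟩, a3, a4⟩ := hz1
    have key : z.im = 0 ∨ z.im = 2 * r ∨ z.re = x - r ∨ z.re = x + r := by
      by_contra! hcon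
      obtain ⟨b1, b2, b3, b4⟩ := hcon
      exact hz2 ⟨⟨lt_of_le_of_ne a1 (Ne.symm b3), lt_of_le_of_ne a2 b4⟩,
        lt_of_le_of_ne a3 (Ne.symm b1), lt_of_le_of_ne a4 b2⟩
    have : G z = 0 := by
      simp only [G]
      rcases key with e | e | e | e
      · rw [hreal (c + 1 * (z - c)) (by simp [e]) (by
          simp only [one_mul, add_sub_cancel]; rw [abs_le]; constructor <;> linarith)]; simp
      · rw [hreal (c + (-1) * (z - c)) (by simp [e, hcim]; ring) (by
          simp only [add_re, mul_re, sub_re, neg_re, one_re, neg_im, one_im, hcre]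
          rw [abs_le]; constructor <;> linarith)]; simp
      · rw [hreal (c + I * (z - c)) (by simp [e, hcim, hcre]) (by
          simp [hcim, hcre]; rw [abs_le]; constructor <;> linarith)]; simp
      · rw [hreal (c + (-I) * (z - c)) (by simp [e, hcim, hcre]) (by
          simp [hcim, hcre]; rw [abs_le]; constructor <;> linarith)]; simp
    rw [this, norm_zero]
  have hcU : c ∈ closure U := by
    rw [hUcl, Complex.mem_reProdIm, hcre, hcim]
    constructor <;> constructor <;> linarith
  have hGc := Complex.norm_le_of_forall_mem_frontier_norm_le hUb hG hfr hcU
  have hGc0 : G c = 0 := norm_le_zero_iff.1 hGc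
  have : h c * h c * (h c * h c) = 0 := by simpa [G] using hGc0
  simpa using this

/-- A function that is analytic on the open upper half plane, continuous on the closed one and
zero on a real interval vanishes. -/
lemma eq_zero_of_real_interval {h : ℂ → ℂ} (hd : DifferentiableOn ℂ h {z | 0 < z.im})
    (hc : ContinuousOn h {z | 0 ≤ z.im}) {δ : ℝ} (hδ : 0 < δ)
    (h0 : ∀ t : ℝ, |t| < δ → h t = 0) (t : ℝ) : h t = 0 := by
  have hopen : IsOpen {z : ℂ | 0 < z.im} := isOpen_lt continuous_const continuous_im
  have hup : Set.EqOn h 0 {z | 0 < z.im} := by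
    refine (hd.analyticOnNhd hopen).eqOn_zero_of_preconnected_of_eventuallyEq_zero
      (convex_halfSpace_im_gt 0).isPreconnected (z₀ := ((δ / 4 : ℝ) : ℂ) * I) (by simp [hδ]) ?_
    -- For such `z` the square centred at `z` has its bottom edge within distance `δ/4 + δ/2 < δ` of
    -- the origin, so that `h` vanishes on it.
    have hn : ∀ᶠ z : ℂ in nhds (((δ / 4 : ℝ) : ℂ) * I), |z.re| < δ / 4 ∧ 0 < z.im ∧ z.im < δ / 2 := by
      refine IsOpen.mem_nhds ?_ ?_
      · exact (isOpen_lt (continuous_abs.comp continuous_re) continuous_const).inter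
          ((isOpen_lt continuous_const continuous_im).inter
            (isOpen_lt continuous_im continuous_const))
      · simp [hδ]; linarith
    filter_upwards [hn] with z ⟨h1, h2, h3⟩
    have := eq_zero_at_centre hd hc (x := z.re) h2 fun t ht => h0 t ?_
    · rwa [Complex.re_add_im] at this
    · have := abs_sub_abs_le_abs_sub t z.re
      linarith
  have hcl : closure {z : ℂ | 0 < z.im} = {z | 0 ≤ z.im} := Complex.closure_setOfPred_lt_im 0
  have hmem : (t : ℂ) ∈ closure {z : ℂ | 0 < z.im} := by rw [hcl]; simp
  have hE : Set.EqOn h 0 (closure {z : ℂ | 0 < z.im}) :=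
    hup.of_subset_closure (by rw [hcl]; exact hc) continuousOn_const subset_closure subset_rfl
  exact hE hmem

/-- `z ↦ ∫ g e^{izE}` for an integrable function `g` and a nonnegative function `E`. -/
lemma laplace_extension {α : Type*} [MeasurableSpace α] {ν : Measure α} {g : α → ℂ}
    (hg : Integrable g ν) {E : α → ℝ} (hE : Measurable E) (hE0 : ∀ᵐ x ∂ν, 0 ≤ E x) :
    DifferentiableOn ℂ (fun z => ∫ x, g x * exp (I * z * E x) ∂ν) {z | 0 < z.im} ∧
      ContinuousOn (fun z => ∫ x, g x * exp (I * z * E x) ∂ν) {z | 0 ≤ z.im} := by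
  have hmeas : ∀ z : ℂ, AEStronglyMeasurable (fun x => g x * exp (I * z * E x)) ν := fun z =>
    hg.1.mul (by fun_prop : Measurable fun x => exp (I * z * E x)).aestronglyMeasurable
  have hnorm : ∀ (z : ℂ) x, ‖exp (I * z * E x)‖ = Real.exp (-(z.im * E x)) := by
    intro z x
    rw [Complex.norm_exp]
    simp
  have hle : ∀ z : ℂ, 0 ≤ z.im → ∀ᵐ x ∂ν, ‖g x * exp (I * z * E x)‖ ≤ ‖g x‖ := by
    intro z hz
    filter_upwards [hE0] with x hx
    rw [norm_mul, hnorm]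
    refine mul_le_of_le_one_right (norm_nonneg _) (Real.exp_le_one_iff.2 ?_)
    nlinarith [mul_nonneg hz hx]
  refine ⟨fun z hz => ?_, fun z hz => ?_⟩
  · have hz' : 0 < z.im := hz
    refine DifferentiableAt.differentiableWithinAt ?_
    -- The derivative brings down a possibly unbounded factor `E`. On `im w > im z / 2` the decay of
    -- the exponential compensates it: `u e^{-u} ≤ 1` with `u = E · im z / 2` gives the constant `2
    -- / im z`.
    refine (hasDerivAt_integral_of_dominated_loc_of_deriv_le
      (F' := fun z x => g x * (exp (I * z * E x) * (I * E x)))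
      (bound := fun x => ‖g x‖ * (2 / z.im)) (s := {w | z.im / 2 < w.im})
      ((isOpen_lt continuous_const continuous_im).mem_nhds (by simp [hz'])) ?_ ?_ ?_ ?_ ?_ ?_).2.differentiableAt
    · exact Filter.Eventually.of_forall hmeas
    · exact hg.norm.mono' (hmeas z) (hle z hz'.le)
    · exact hg.1.mul (by fun_prop : Measurable fun x => exp (I * z * E x) * (I * E x)).aestronglyMeasurable
    · filter_upwards [hE0] with x hx w hw
      have hw' : z.im / 2 < w.im := hw
      rw [norm_mul, norm_mul, hnorm]
      refine mul_le_mul_of_nonneg_left ?_ (norm_nonneg _)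
      have h1 : ‖I * (E x : ℂ)‖ = E x := by simp [abs_of_nonneg hx]
      rw [h1]
      have h2 : Real.exp (-(w.im * E x)) ≤ Real.exp (-(z.im / 2 * E x)) :=
        Real.exp_le_exp.2 (by nlinarith)
      have h3 : z.im / 2 * E x * Real.exp (-(z.im / 2 * E x)) ≤ 1 := by
        have h4 := Real.add_one_le_exp (z.im / 2 * E x)
        rw [Real.exp_neg, ← div_eq_mul_inv, div_le_one (Real.exp_pos _)]
        linarith
      calc Real.exp (-(w.im * E x)) * E x ≤ Real.exp (-(z.im / 2 * E x)) * E x := by gcongr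
        _ = (z.im / 2 * E x * Real.exp (-(z.im / 2 * E x))) * (2 / z.im) := by field_simp
        _ ≤ 1 * (2 / z.im) := by gcongr
        _ = _ := one_mul _
    · exact hg.norm.mul_const _
    · refine Filter.Eventually.of_forall fun x w _ => ?_
      have h1 : HasDerivAt (fun w : ℂ => I * w * E x) (I * E x) w := by
        simpa using ((hasDerivAt_id w).const_mul I).mul_const (E x : ℂ)
      exact (h1.cexp).const_mul (g x)
  · refine continuousWithinAt_of_dominated (bound := fun x => ‖g x‖) ?_ ?_ hg.norm ?_
    · exact Filter.Eventually.of_forall hmeas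
    · filter_upwards [self_mem_nhdsWithin] with w hw using hle w hw
    · refine Filter.Eventually.of_forall fun x => ?_
      exact (by fun_prop : Continuous fun w : ℂ => g x * exp (I * w * E x)).continuousWithinAt

/-! ### Injectivity of the Fourier transform on `L¹` -/

/-- An integrable function whose Fourier transform vanishes is zero almost everywhere. -/
lemma ae_eq_zero_of_fourier_eq_zero {V : Type*} [NormedAddCommGroup V] [InnerProductSpace ℝ V]
    [FiniteDimensional ℝ V] [MeasurableSpace V] [BorelSpace V] {a : V → ℂ}
    (ha : Integrable a) (h : ∀ w, 𝓕 a w = 0) : a =ᵐ[volume] 0 := by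
  have key : ∀ ψ : 𝓢(V, ℂ), ∫ x, a x * ψ x = 0 := by
    intro ψ
    -- The Fourier transform is moved from `a` to the Schwartz function `𝓕⁻ ψ`, which turns `∫ a ψ`
    -- into `∫ 𝓕a · 𝓕⁻ψ`.
    have h1 := VectorFourier.integral_fourierIntegral_smul_eq_flip (μ := (volume : Measure V))
      (ν := (volume : Measure V)) (e := Real.fourierChar) (L := innerₗ V)
      Real.continuous_fourierChar (by exact continuous_inner) ha (𝓕⁻ ψ).integrable
    have h2 : ∀ w, VectorFourier.fourierIntegral Real.fourierChar volume (innerₗ V) a w = 0 := h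
    have h3 : ∀ x, VectorFourier.fourierIntegral Real.fourierChar volume (innerₗ V).flip
        (𝓕⁻ ψ : 𝓢(V, ℂ)) x = ψ x := by
      intro x
      rw [flip_innerₗ]
      have : 𝓕 (𝓕⁻ ψ : 𝓢(V, ℂ)) = ψ := FourierTransform.fourier_fourierInv_eq ψ
      conv_rhs => rw [← this]
      rfl
    simp only [h2, h3, smul_eq_mul, zero_mul, integral_zero] at h1
    exact h1.symm
  refine ae_eq_zero_of_integral_contDiff_smul_eq_zero ha.locallyIntegrable fun g hg hgc => ?_
  have := key ((hgc.comp_left (g := Complex.ofReal) (by simp)).toSchwartzMap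
    (Complex.ofRealCLM.contDiff.comp hg))
  rw [← this]
  refine integral_congr_ae (Filter.Eventually.of_forall fun x => ?_)
  change g x • a x = a x * ((g x : ℝ) : ℂ)
  rw [mul_comm, real_smul]

end ScalarFermion

end

noncomputable section

namespace ScalarFermion

/-! ### Creation operators between the `n`-particle spaces -/

/-- Multipliers that are symmetric in the particle variables. -/
def Multiplier.IsSymmetric {s : ℕ} (W : Multiplier s) : Prop :=
  ∀ (n : ℕ) (p : Spacetime s) (q : Fin n → Spacetime s) (σ : Equiv.Perm (Fin n)),
    W.toFun n p (q ∘ σ) = W.toFun n p q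

lemma Multiplier.isSymmetric_one (s : ℕ) : (Multiplier.one s).IsSymmetric := fun _ _ _ _ => rfl

lemma Multiplier.isSymmetric_deformation {s : ℕ} (R : DeformationFunction)
    (Q : Matrix (Fin (s + 1)) (Fin (s + 1)) ℝ) : (Multiplier.deformation R Q).IsSymmetric :=
  fun _ p q σ => Equiv.prod_comp σ fun k => R (mink (act Q p) (q k))

lemma measurePreserving_uncons (s : ℕ) (m : ℝ) (n : ℕ) :
    MeasurePreserving (fun p : Fin (n + 1) → Spacetime s => (Fin.tail p, p 0))
      (shellPi s m (n + 1)) ((shellPi s m n).prod (shellMeasure s m)) := by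
  have h := measurePreserving_piFinSuccAbove (fun _ : Fin (n + 1) => shellMeasure s m) 0
  have h2 := (Measure.measurePreserving_swap (μ := shellMeasure s m) (ν := shellPi s m n)).comp h
  exact h2

lemma quasiMeasurePreserving_tail (s : ℕ) (m : ℝ) (n : ℕ) :
    Measure.QuasiMeasurePreserving (fun p : Fin (n + 1) → Spacetime s => Fin.tail p)
      (shellPi s m (n + 1)) (shellPi s m n) :=
  Measure.quasiMeasurePreserving_fst.comp (measurePreserving_uncons s m n).quasiMeasurePreserving

lemma quasiMeasurePreserving_head (s : ℕ) (m : ℝ) (n : ℕ) :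
    Measure.QuasiMeasurePreserving (fun p : Fin (n + 1) → Spacetime s => p 0)
      (shellPi s m (n + 1)) (shellMeasure s m) :=
  Measure.quasiMeasurePreserving_snd.comp (measurePreserving_uncons s m n).quasiMeasurePreserving

/-- `(p, p₁, …, pₙ) ↦ g(p) conj(W(p))(p₁, …, pₙ) Ψ(p₁, …, pₙ)`. -/
def tensorFun {s : ℕ} (W : Multiplier s) {n : ℕ} (g : Spacetime s → ℂ)
    (Ψ : (Fin n → Spacetime s) → ℂ) (p : Fin (n + 1) → Spacetime s) : ℂ :=
  g (p 0) * conj (W.toFun n (p 0) (Fin.tail p)) * Ψ (Fin.tail p)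

/-! ### The twisted tensor product with a one-particle vector -/

section tensor

variable {s : ℕ} {m : ℝ} (W : Multiplier s) {n : ℕ}

lemma measurable_multiplier_tail :
    Measurable fun p : Fin (n + 1) → Spacetime s => W.toFun n (p 0) (Fin.tail p) :=
  (W.measurable_toFun n).comp (g := fun x : Spacetime s × (Fin n → Spacetime s) =>
    W.toFun n x.1 x.2) (f := fun p : Fin (n + 1) → Spacetime s => (p 0, Fin.tail p))
    ((measurable_pi_apply 0).prodMk (measurable_pi_lambda _ fun i : Fin n =>
      measurable_pi_apply (Fin.succ i)))

lemma aestronglyMeasurable_tensorFun {g : Spacetime s → ℂ} {Ψ : (Fin n → Spacetime s) → ℂ}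
    (hg : AEStronglyMeasurable g (shellMeasure s m))
    (hΨ : AEStronglyMeasurable Ψ (shellPi s m n)) :
    AEStronglyMeasurable (tensorFun W g Ψ) (shellPi s m (n + 1)) :=
  ((hg.comp_quasiMeasurePreserving (quasiMeasurePreserving_head s m n)).mul
    (continuous_conj.measurable.comp (measurable_multiplier_tail W)).aestronglyMeasurable).mul
      (hΨ.comp_quasiMeasurePreserving (quasiMeasurePreserving_tail s m n))

/-- The multiplier has modulus at most one, and without it the squared integrand is a product in
separate variables, to which Tonelli applies. -/
lemma eLpNorm_tensorFun_le {g : Spacetime s → ℂ} {Ψ : (Fin n → Spacetime s) → ℂ}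
    (hg : AEStronglyMeasurable g (shellMeasure s m))
    (hΨ : AEStronglyMeasurable Ψ (shellPi s m n)) :
    eLpNorm (tensorFun W g Ψ) 2 (shellPi s m (n + 1)) ≤
      eLpNorm g 2 (shellMeasure s m) * eLpNorm Ψ 2 (shellPi s m n) := by
  simp only [eLpNorm_eq_lintegral_rpow_enorm_toReal two_ne_zero ENNReal.ofNat_ne_top,
    ENNReal.toReal_ofNat]
  rw [← ENNReal.mul_rpow_of_nonneg _ _ (by norm_num)]
  refine ENNReal.rpow_le_rpow ?_ (by norm_num)
  calc ∫⁻ p, ‖tensorFun W g Ψ p‖ₑ ^ (2 : ℝ) ∂(shellPi s m (n + 1))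
      ≤ ∫⁻ p : Fin (n + 1) → Spacetime s, ‖Ψ (Fin.tail p)‖ₑ ^ (2 : ℝ) * ‖g (p 0)‖ₑ ^ (2 : ℝ)
          ∂(shellPi s m (n + 1)) := by
        refine lintegral_mono fun p => ?_
        rw [← ENNReal.mul_rpow_of_nonneg _ _ (by norm_num)]
        refine ENNReal.rpow_le_rpow ?_ (by norm_num)
        rw [tensorFun, enorm_mul, enorm_mul, mul_comm]
        gcongr
        have h1 : ‖conj (W.toFun n (p 0) (Fin.tail p))‖ₑ ≤ 1 := by
          rw [← ofReal_norm, RCLike.norm_conj]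
          exact ENNReal.ofReal_le_one.2 (W.norm_le_one _ _ _)
        calc _ ≤ ‖g (p 0)‖ₑ * 1 := by gcongr
          _ = _ := mul_one _
    _ = ∫⁻ x : (Fin n → Spacetime s) × Spacetime s, ‖Ψ x.1‖ₑ ^ (2 : ℝ) * ‖g x.2‖ₑ ^ (2 : ℝ)
          ∂((shellPi s m n).prod (shellMeasure s m)) := by
        rw [← (measurePreserving_uncons s m n).map_eq,
          lintegral_map' _ (measurePreserving_uncons s m n).measurable.aemeasurable]
        rw [(measurePreserving_uncons s m n).map_eq]
        exact ((hΨ.enorm.pow_const _).comp_quasiMeasurePreserving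
            Measure.quasiMeasurePreserving_fst).mul
          ((hg.enorm.pow_const _).comp_quasiMeasurePreserving Measure.quasiMeasurePreserving_snd)
    _ = _ := by
        rw [lintegral_prod_mul (hΨ.enorm.pow_const _) (hg.enorm.pow_const _), mul_comm]

lemma memLp_tensorFun {g : Spacetime s → ℂ} {Ψ : (Fin n → Spacetime s) → ℂ}
    (hg : MemLp g 2 (shellMeasure s m)) (hΨ : MemLp Ψ 2 (shellPi s m n)) :
    MemLp (tensorFun W g Ψ) 2 (shellPi s m (n + 1)) :=
  ⟨aestronglyMeasurable_tensorFun W hg.1 hΨ.1,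
    (eLpNorm_tensorFun_le W hg.1 hΨ.1).trans_lt (ENNReal.mul_lt_top hg.2 hΨ.2)⟩

lemma tensorFun_congr {g g' : Spacetime s → ℂ} {Ψ Ψ' : (Fin n → Spacetime s) → ℂ}
    (hg : g =ᵐ[shellMeasure s m] g') (hΨ : Ψ =ᵐ[shellPi s m n] Ψ') :
    tensorFun W g Ψ =ᵐ[shellPi s m (n + 1)] tensorFun W g' Ψ' := by
  filter_upwards [(quasiMeasurePreserving_head s m n).ae hg,
    (quasiMeasurePreserving_tail s m n).ae hΨ] with p h1 h2
  simp only [tensorFun, h1, h2]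

/-- The bounded bilinear map `(g, Ψ) ↦ g ⊗ Ψ`, twisted with the multiplier. -/
def tensorL : OneParticle s m →L[ℂ] Lp ℂ 2 (shellPi s m n) →L[ℂ] Lp ℂ 2 (shellPi s m (n + 1)) :=
  LinearMap.mkContinuous₂
    (LinearMap.mk₂ ℂ
      (fun g Ψ => (memLp_tensorFun W (Lp.memLp g) (Lp.memLp Ψ)).toLp (tensorFun W g Ψ))
      (fun g g' Ψ => by
        rw [← MemLp.toLp_add, MemLp.toLp_eq_toLp_iff]
        refine (tensorFun_congr W (Lp.coeFn_add g g') (ae_eq_refl Ψ)).trans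
          (Filter.Eventually.of_forall fun p => ?_)
        simp only [tensorFun, Pi.add_apply]; ring)
      (fun c g Ψ => by
        rw [← MemLp.toLp_const_smul, MemLp.toLp_eq_toLp_iff]
        refine (tensorFun_congr W (Lp.coeFn_smul c g) (ae_eq_refl Ψ)).trans
          (Filter.Eventually.of_forall fun p => ?_)
        simp only [tensorFun, Pi.smul_apply, smul_eq_mul]; ring)
      (fun g Ψ Ψ' => by
        rw [← MemLp.toLp_add, MemLp.toLp_eq_toLp_iff]
        refine (tensorFun_congr W (ae_eq_refl g) (Lp.coeFn_add Ψ Ψ')).trans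
          (Filter.Eventually.of_forall fun p => ?_)
        simp only [tensorFun, Pi.add_apply]; ring)
      (fun c g Ψ => by
        rw [← MemLp.toLp_const_smul, MemLp.toLp_eq_toLp_iff]
        refine (tensorFun_congr W (ae_eq_refl g) (Lp.coeFn_smul c Ψ)).trans
          (Filter.Eventually.of_forall fun p => ?_)
        simp only [tensorFun, Pi.smul_apply, smul_eq_mul]; ring))
    1 (fun g Ψ => by
      rw [one_mul, LinearMap.mk₂_apply, Lp.norm_toLp, Lp.norm_def, Lp.norm_def,
        ← ENNReal.toReal_mul]
      exact ENNReal.toReal_mono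
        (ENNReal.mul_ne_top (Lp.eLpNorm_ne_top g) (Lp.eLpNorm_ne_top Ψ))
        (eLpNorm_tensorFun_le W (Lp.memLp g).1 (Lp.memLp Ψ).1))

lemma coeFn_tensorL (g : OneParticle s m) (Ψ : Lp ℂ 2 (shellPi s m n)) :
    tensorL W g Ψ =ᵐ[shellPi s m (n + 1)] tensorFun W g Ψ :=
  MemLp.coeFn_toLp (memLp_tensorFun W (Lp.memLp g) (Lp.memLp Ψ))

lemma norm_tensorL_apply_le (g : OneParticle s m) (Ψ : Lp ℂ 2 (shellPi s m n)) :
    ‖tensorL W g Ψ‖ ≤ ‖g‖ * ‖Ψ‖ := by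
  have h1 := (tensorL W (n := n) (m := m)).le_opNorm₂ g Ψ
  have h2 : ‖tensorL W (n := n) (m := m)‖ ≤ 1 :=
    LinearMap.mkContinuous₂_norm_le _ zero_le_one _
  calc _ ≤ _ := h1
    _ ≤ 1 * ‖g‖ * ‖Ψ‖ := by gcongr
    _ = _ := by rw [one_mul]

end tensor

/-! ### Permutations of the particle variables and antisymmetrization -/

section permute

variable {s : ℕ} {m : ℝ} {n : ℕ}

lemma coeFn_permute (σ : Equiv.Perm (Fin n)) (Ψ : Lp ℂ 2 (shellPi s m n)) :
    permute s m σ Ψ =ᵐ[shellPi s m n] fun p => Ψ (p ∘ σ) :=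
  Lp.coeFn_compMeasurePreserving Ψ (measurePreserving_perm s m σ)

lemma permute_congr {σ : Equiv.Perm (Fin n)} {Ψ : Lp ℂ 2 (shellPi s m n)}
    {f : (Fin n → Spacetime s) → ℂ} (h : Ψ =ᵐ[shellPi s m n] f) :
    permute s m σ Ψ =ᵐ[shellPi s m n] fun p => f (p ∘ σ) :=
  (coeFn_permute σ Ψ).trans ((measurePreserving_perm s m σ).quasiMeasurePreserving.ae h)

/-- Although functions are composed with `p ↦ p ∘ σ`, no reversal of order occurs: `(p ∘ σ) ∘ τ = p
∘ (σ * τ)`. -/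
lemma permute_permute (σ τ : Equiv.Perm (Fin n)) (Ψ : Lp ℂ 2 (shellPi s m n)) :
    permute s m σ (permute s m τ Ψ) = permute s m (σ * τ) Ψ := by
  refine Lp.ext ((permute_congr (coeFn_permute τ Ψ)).trans (coeFn_permute (σ * τ) Ψ).symm)

lemma permute_one (Ψ : Lp ℂ 2 (shellPi s m n)) : permute s m 1 Ψ = Ψ :=
  Lp.ext (coeFn_permute 1 Ψ)

lemma inner_permute (σ : Equiv.Perm (Fin n)) (Ψ Φ : Lp ℂ 2 (shellPi s m n)) :
    inner ℂ (permute s m σ Ψ) Φ = inner ℂ Ψ (permute s m σ⁻¹ Φ) := by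
  rw [← (permute s m σ).inner_map_map Ψ, permute_permute, mul_inv_cancel, permute_one]

/-- The permutation of `{0, …, n}` that fixes `0` and acts as `τ` on the rest. -/
def liftPerm (τ : Equiv.Perm (Fin n)) : Equiv.Perm (Fin (n + 1)) :=
  Equiv.Perm.decomposeFin.symm (0, τ)

lemma liftPerm_zero (τ : Equiv.Perm (Fin n)) : liftPerm τ 0 = 0 := by simp [liftPerm]

lemma liftPerm_succ (τ : Equiv.Perm (Fin n)) (i : Fin n) : liftPerm τ i.succ = (τ i).succ := by
  simp [liftPerm, Equiv.Perm.decomposeFin_symm_apply_succ]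

lemma sign_liftPerm (τ : Equiv.Perm (Fin n)) : Equiv.Perm.sign (liftPerm τ) = Equiv.Perm.sign τ := by
  simp [liftPerm, Equiv.Perm.decomposeFin.symm_sign]

lemma exists_liftPerm {ρ : Equiv.Perm (Fin (n + 1))} (h : ρ 0 = 0) : ∃ τ, liftPerm τ = ρ := by
  obtain ⟨⟨k, τ⟩, rfl⟩ := Equiv.Perm.decomposeFin.symm.surjective ρ
  rw [Equiv.Perm.decomposeFin_symm_apply_zero] at h
  subst h
  exact ⟨τ, rfl⟩

/-- The vector `g` occupies the variable `0`, which `liftPerm τ` fixes, and the multiplier does not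
notice a permutation of the remaining variables. -/
lemma permute_liftPerm_tensorL {W : Multiplier s} (hW : W.IsSymmetric) (τ : Equiv.Perm (Fin n))
    (g : OneParticle s m) (Ψ : Lp ℂ 2 (shellPi s m n)) :
    permute s m (liftPerm τ) (tensorL W g Ψ) = tensorL W g (permute s m τ Ψ) := by
  refine Lp.ext ((permute_congr (coeFn_tensorL W g Ψ)).trans ?_)
  refine Filter.EventuallyEq.trans (Filter.Eventually.of_forall fun p => ?_)
    ((coeFn_tensorL W g (permute s m τ Ψ)).trans
      (tensorFun_congr W (ae_eq_refl g) (coeFn_permute τ Ψ))).symm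
  have h : Fin.tail (p ∘ liftPerm τ) = Fin.tail p ∘ τ := by
    ext1 i; simp [Fin.tail, liftPerm_succ]
  simp only [tensorFun, h, hW n _ _ τ, Function.comp_apply, liftPerm_zero]

/-- `n^{1/2}` times the antisymmetrization of `g ⊗ Ψ`. -/
def creationSum (W : Multiplier s) (g : OneParticle s m) (Ψ : Lp ℂ 2 (shellPi s m n)) :
    Lp ℂ 2 (shellPi s m (n + 1)) :=
  ((√(n + 1 : ℝ) : ℝ) : ℂ)⁻¹ • ∑ k : Fin (n + 1),
    ((-1 : ℂ) ^ (k : ℕ)) • permute s m k.cycleRange.symm (tensorL W g Ψ)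

lemma sign_cycleRange_symm (k : Fin (n + 1)) :
    ((Equiv.Perm.sign k.cycleRange.symm : ℤ) : ℂ) = (-1) ^ (k : ℕ) := by
  rw [Equiv.Perm.sign_symm, Fin.sign_cycleRange]
  push_cast; rfl

/-- The permutations `k.cycleRange.symm` send `0` to `k`, so they represent the left cosets of the
stabilizer of `0`. Multiplication by `σ` on the left permutes the cosets as `k ↦ σ k`, up to an
element `liftPerm τ` of the stabilizer; that element acts on the antisymmetric `Ψ` by its sign. -/
lemma creationSum_mem {W : Multiplier s} (hW : W.IsSymmetric) (g : OneParticle s m)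
    {Ψ : Lp ℂ 2 (shellPi s m n)} (hΨ : Ψ ∈ nParticle s m n) :
    creationSum W g Ψ ∈ nParticle s m (n + 1) := by
  intro σ
  rw [creationSum, map_smul, smul_comm ((Equiv.Perm.sign σ : ℤ) : ℂ)]
  congr 1
  rw [map_sum, Finset.smul_sum]
  refine Finset.sum_equiv σ (fun k => by simp only [Finset.mem_univ]) fun k _ => ?_
  obtain ⟨τ, hτ⟩ := exists_liftPerm (ρ := (σ k).cycleRange * (σ * k.cycleRange.symm)) (by
    simp [Fin.cycleRange_symm_zero])
  have hperm : σ * k.cycleRange.symm = (σ k).cycleRange.symm * liftPerm τ := by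
    rw [hτ, ← mul_assoc]
    have : (σ k).cycleRange.symm * (σ k).cycleRange = 1 := inv_mul_cancel (σ k).cycleRange
    rw [this, one_mul]
  have hΨτ := hΨ τ
  rw [map_smul, permute_permute, hperm, ← permute_permute, permute_liftPerm_tensorL hW, hΨτ,
    map_smul, map_smul, ← sign_cycleRange_symm, ← sign_cycleRange_symm, smul_smul, smul_smul]
  congr 1
  have h1 := congrArg (fun ρ => ((Equiv.Perm.sign ρ : ℤ) : ℂ)) hperm
  simp only [Equiv.Perm.sign_mul, sign_liftPerm, Units.val_mul, Int.cast_mul] at h1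
  have hsq : ∀ ρ : Equiv.Perm (Fin (n + 1)),
      ((Equiv.Perm.sign ρ : ℤ) : ℂ) * ((Equiv.Perm.sign ρ : ℤ) : ℂ) = 1 := fun ρ => by
    rw [← Int.cast_mul, ← Units.val_mul, Int.units_mul_self]; simp
  set a := ((Equiv.Perm.sign k.cycleRange.symm : ℤ) : ℂ) with ha
  set b := ((Equiv.Perm.sign (σ k).cycleRange.symm : ℤ) : ℂ) with hb
  set t := ((Equiv.Perm.sign τ : ℤ) : ℂ)
  set S := ((Equiv.Perm.sign σ : ℤ) : ℂ)
  -- By `h1`, `S a = t b`. Multiplication by `a b` and `a² = b² = 1` give the required `a t = S b`.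
  linear_combination -(a * b) * h1 + S * b * hsq k.cycleRange.symm -
    a * t * hsq (σ k).cycleRange.symm

end permute

end ScalarFermion

end

noncomputable section

namespace ScalarFermion

/-! ### Boundedness and explicit form of the creation operators -/

section creation

variable {s : ℕ} {m : ℝ} {n : ℕ} {W : Multiplier s}

/-- The sum has `n + 1` terms of norm at most `‖g‖ ‖Ψ‖`, and the prefactor leaves `(n + 1) / √(n +
1) = √(n + 1)`. -/
lemma norm_creationSum_le (W : Multiplier s) (g : OneParticle s m) (Ψ : Lp ℂ 2 (shellPi s m n)) :
    ‖creationSum W g Ψ‖ ≤ √(n + 1 : ℝ) * ‖g‖ * ‖Ψ‖ := by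
  have hn : (0 : ℝ) < √(n + 1 : ℝ) := Real.sqrt_pos.2 (by positivity)
  rw [creationSum, norm_smul, norm_inv, Complex.norm_real, Real.norm_of_nonneg hn.le]
  have h1 : ‖∑ k : Fin (n + 1), ((-1 : ℂ) ^ (k : ℕ)) •
      permute s m k.cycleRange.symm (tensorL W g Ψ)‖ ≤ (n + 1 : ℝ) * (‖g‖ * ‖Ψ‖) := by
    refine (norm_sum_le _ _).trans ?_
    refine (Finset.sum_le_card_nsmul Finset.univ _ (‖g‖ * ‖Ψ‖) fun k _ => ?_).trans (by simp)
    rw [norm_smul, norm_pow, norm_neg, norm_one, one_pow, one_mul, LinearIsometry.norm_map]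
    exact norm_tensorL_apply_le W g Ψ
  calc _ ≤ (√(n + 1 : ℝ))⁻¹ * ((n + 1 : ℝ) * (‖g‖ * ‖Ψ‖)) := by gcongr
    _ = (√(n + 1 : ℝ))⁻¹ * ((√(n + 1 : ℝ) * √(n + 1 : ℝ)) * (‖g‖ * ‖Ψ‖)) := by
        rw [Real.mul_self_sqrt (by positivity)]
    _ = _ := by field_simp

/-- The creation operators `ℋₙ → ℋₙ₊₁`, as a bounded bilinear map. -/
def creL (hW : W.IsSymmetric) (m : ℝ) (n : ℕ) :
    OneParticle s m →L[ℂ] nParticle s m n →L[ℂ] nParticle s m (n + 1) :=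
  LinearMap.mkContinuous₂
    (LinearMap.mk₂ ℂ (fun g (Ψ : nParticle s m n) =>
        (⟨creationSum W g Ψ, creationSum_mem hW g Ψ.2⟩ : nParticle s m (n + 1)))
      (fun g g' Ψ => Subtype.ext (by
        simp [creationSum, smul_add, Finset.sum_add_distrib]))
      (fun c g Ψ => Subtype.ext (by
        simp only [creationSum, map_smul, smul_apply, Submodule.coe_smul,
          Finset.smul_sum, smul_comm c]))
      (fun g Ψ Ψ' => Subtype.ext (by
        simp [creationSum, smul_add, Finset.sum_add_distrib]))
      (fun c g Ψ => Subtype.ext (by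
        simp only [creationSum, map_smul, Submodule.coe_smul, Finset.smul_sum, smul_comm c])))
    (√(n + 1 : ℝ)) (fun g Ψ => by
      rw [LinearMap.mk₂_apply, Submodule.coe_norm, Submodule.coe_norm]
      exact norm_creationSum_le W g (Ψ : Lp ℂ 2 (shellPi s m n)))

lemma coe_creL (hW : W.IsSymmetric) (g : OneParticle s m) (Ψ : nParticle s m n) :
    (creL hW m n g Ψ : Lp ℂ 2 (shellPi s m (n + 1))) = creationSum W g Ψ := rfl

lemma norm_creL_le (hW : W.IsSymmetric) (g : OneParticle s m) :
    ‖creL hW m n g‖ ≤ √(n + 1 : ℝ) * ‖g‖ :=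
  ContinuousLinearMap.opNorm_le_bound _ (by positivity) fun Ψ => by
    rw [Submodule.coe_norm, Submodule.coe_norm, coe_creL]
    exact norm_creationSum_le W g (Ψ : Lp ℂ 2 (shellPi s m n))

lemma coeFn_creL (hW : W.IsSymmetric) (g : OneParticle s m) (Ψ : Fock s m) :
    creationFun W g Ψ (n + 1) =ᵐ[shellPi s m (n + 1)]
      (creL hW m n g (Ψ n) : Lp ℂ 2 (shellPi s m (n + 1))) := by
  rw [coe_creL, creationSum]
  have h := ae_all_iff.2 fun k : Fin (n + 1) => permute_congr (σ := k.cycleRange.symm)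
    (coeFn_tensorL W g (Ψ n : Lp ℂ 2 (shellPi s m n)))
  have h2 := ae_all_iff.2 fun k : Fin (n + 1) => Lp.coeFn_smul ((-1 : ℂ) ^ (k : ℕ))
    (permute s m k.cycleRange.symm (tensorL W g (Ψ n : Lp ℂ 2 (shellPi s m n))))
  filter_upwards [h, h2, Lp.coeFn_smul (((√(n + 1 : ℝ) : ℝ) : ℂ)⁻¹) (∑ k : Fin (n + 1),
    ((-1 : ℂ) ^ (k : ℕ)) • permute s m k.cycleRange.symm
      (tensorL W g (Ψ n : Lp ℂ 2 (shellPi s m n)))),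
    Lp.coeFn_fun_finsetSum Finset.univ (fun k : Fin (n + 1) =>
    ((-1 : ℂ) ^ (k : ℕ)) • permute s m k.cycleRange.symm
      (tensorL W g (Ψ n : Lp ℂ 2 (shellPi s m n))))] with p h1 h2 h3 h4
  rw [h3, Pi.smul_apply, h4]
  simp only [creationFun, smul_eq_mul, h2, Pi.smul_apply, h1, tensorFun, wave]
  congr 1
  refine Finset.sum_congr rfl fun k _ => ?_
  -- The cycle moves `p k` to the front and keeps the other variables in order, which is exactly the
  -- omission of `p k` in the explicit formula.
  have ht : Fin.tail (p ∘ k.cycleRange.symm) = fun l => p (k.succAbove l) := by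
    ext1 l; simp [Fin.tail, Fin.cycleRange_symm_succ]
  rw [ht, Function.comp_apply, Fin.cycleRange_symm_zero]
  ring

end creation

/-! ### Annihilation operators between the `n`-particle spaces -/

section annihilation

variable {s : ℕ} {m : ℝ} {n : ℕ} {W : Multiplier s}

lemma integral_eq_integral_cons {f : (Fin (n + 1) → Spacetime s) → ℂ}
    (hf : AEStronglyMeasurable f (shellPi s m (n + 1))) :
    ∫ p, f p ∂(shellPi s m (n + 1)) =
      ∫ x, f (Fin.cons x.2 x.1) ∂((shellPi s m n).prod (shellMeasure s m)) := by
  have h := (measurePreserving_cons s m n).map_eq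
  rw [← h, integral_map (measurePreserving_cons s m n).measurable.aemeasurable (h ▸ hf)]

/-- The adjoint of `Ψ ↦ g ⊗ Ψ` integrates out the first variable. -/
lemma coeFn_adjoint_tensorL (W : Multiplier s) (g : OneParticle s m)
    (Φ : Lp ℂ 2 (shellPi s m (n + 1))) :
    (tensorL W g).adjoint Φ =ᵐ[shellPi s m n]
      fun q => ∫ p, conj (g p) * W.toFun n p q * Φ (Fin.cons p q) ∂(shellMeasure s m) := by
  -- Both sides are compared through their integrals over sets `S` of finite measure: the pairing of
  -- the adjoint with the indicator of `S` is the inner product of `g ⊗ 1_S` with `Φ`, which Fubini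
  -- evaluates.
  have key : ∀ S : Set (Fin n → Spacetime s), MeasurableSet S → shellPi s m n S < ∞ →
      IntegrableOn (fun q => ∫ p, conj (g p) * W.toFun n p q * Φ (Fin.cons p q)
        ∂(shellMeasure s m)) S (shellPi s m n) ∧
      ∫ q in S, (tensorL W g).adjoint Φ q ∂(shellPi s m n) =
        ∫ q in S, (∫ p, conj (g p) * W.toFun n p q * Φ (Fin.cons p q) ∂(shellMeasure s m))
          ∂(shellPi s m n) := by
    intro S hS hμS
    let χ : Lp ℂ 2 (shellPi s m n) := indicatorConstLp 2 hS hμS.ne (1 : ℂ)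
    have hχ : χ =ᵐ[shellPi s m n] S.indicator fun _ => (1 : ℂ) := indicatorConstLp_coeFn
    have hT : ∀ᵐ x ∂((shellPi s m n).prod (shellMeasure s m)),
        inner ℂ (tensorL W g χ (Fin.cons x.2 x.1 : Fin (n + 1) → Spacetime s))
          (Φ (Fin.cons x.2 x.1 : Fin (n + 1) → Spacetime s)) =
        S.indicator (fun _ => (1 : ℂ)) x.1 *
          (conj (g x.2) * W.toFun n x.2 x.1 * Φ (Fin.cons x.2 x.1)) := by
      filter_upwards [(measurePreserving_cons s m n).quasiMeasurePreserving.ae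
        ((coeFn_tensorL W g χ).trans (tensorFun_congr W (ae_eq_refl g) hχ))] with x hx
      rw [hx]
      simp only [tensorFun, Fin.cons_zero, Fin.tail_cons, RCLike.inner_apply, map_mul,
        Complex.conj_conj]
      by_cases h : x.1 ∈ S <;> simp [h] ; ring
    have hint := (L2.integrable_inner (𝕜 := ℂ) (tensorL W g χ) Φ)
    have hint2 := ((measurePreserving_cons s m n).integrable_comp hint.1).2 hint
    have hint3 := hint2.congr hT
    have hin : ∀ q, ∫ p, S.indicator (fun _ => (1 : ℂ)) q *
        (conj (g p) * W.toFun n p q * Φ (Fin.cons p q)) ∂(shellMeasure s m) =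
        S.indicator (fun q => ∫ p, conj (g p) * W.toFun n p q * Φ (Fin.cons p q)
          ∂(shellMeasure s m)) q := by
      intro q
      by_cases h : q ∈ S <;> simp [h]
    constructor
    · rw [← integrable_indicator_iff hS]
      exact hint3.integral_prod_left.congr (Filter.Eventually.of_forall hin)
    · have e1 : ∫ q in S, (tensorL W g).adjoint Φ q ∂(shellPi s m n) =
          inner ℂ (tensorL W g χ) Φ := by
        rw [← L2.inner_indicatorConstLp_one hS hμS.ne, ContinuousLinearMap.adjoint_inner_right]
      rw [e1, L2.inner_def, ← integral_indicator hS, integral_eq_integral_cons hint.1,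
        integral_congr_ae hT, integral_prod _ hint3]
      exact integral_congr_ae (Filter.Eventually.of_forall hin)
  refine ae_eq_of_forall_setIntegral_eq_of_sigmaFinite (fun S hS hμS => ?_)
    (fun S hS hμS => (key S hS hμS).1) fun S hS hμS => (key S hS hμS).2
  exact integrableOn_Lp_of_measure_ne_top _ one_le_two hμS.ne

/-- The map `Ψ ↦ g ⊗ Ψ` intertwines `τ` with `liftPerm τ`, hence its adjoint does the reverse; and
`liftPerm` preserves the sign. -/
lemma adjoint_tensorL_mem (hW : W.IsSymmetric) (g : OneParticle s m)
    {Φ : Lp ℂ 2 (shellPi s m (n + 1))} (hΦ : Φ ∈ nParticle s m (n + 1)) :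
    (tensorL W g).adjoint Φ ∈ nParticle s m n := by
  intro σ
  refine ext_inner_left ℂ fun v => ?_
  have h1 := hΦ (liftPerm σ⁻¹)⁻¹
  have h2 := inner_permute σ⁻¹ v ((tensorL W g).adjoint Φ)
  rw [inv_inv] at h2
  rw [← h2, ContinuousLinearMap.adjoint_inner_right, ← permute_liftPerm_tensorL hW, inner_permute,
    h1, inner_smul_right, inner_smul_right, ContinuousLinearMap.adjoint_inner_right,
    Equiv.Perm.sign_inv, sign_liftPerm, Equiv.Perm.sign_inv]

/-- Against an antisymmetric vector all `n + 1` terms contribute the same, because the sign from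
moving the permutation onto `Φ` cancels the sign in the sum. -/
lemma inner_creationSum (W : Multiplier s) (g : OneParticle s m) (Ψ : Lp ℂ 2 (shellPi s m n))
    {Φ : Lp ℂ 2 (shellPi s m (n + 1))} (hΦ : Φ ∈ nParticle s m (n + 1)) :
    inner ℂ (creationSum W g Ψ) Φ = ((√(n + 1 : ℝ) : ℝ) : ℂ) * inner ℂ (tensorL W g Ψ) Φ := by
  have hn : (0 : ℝ) < √(n + 1 : ℝ) := Real.sqrt_pos.2 (by positivity)
  have hn' : ((√(n + 1 : ℝ) : ℝ) : ℂ) ≠ 0 := by exact_mod_cast hn.ne'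
  have hsq : ((√(n + 1 : ℝ) : ℝ) : ℂ) * ((√(n + 1 : ℝ) : ℝ) : ℂ) = n + 1 := by
    rw [← Complex.ofReal_mul, Real.mul_self_sqrt (by positivity)]; simp
  have hk : ∀ k : Fin (n + 1), inner ℂ (((-1 : ℂ) ^ (k : ℕ)) •
      permute s m k.cycleRange.symm (tensorL W g Ψ)) Φ = inner ℂ (tensorL W g Ψ) Φ := by
    intro k
    have h1 := hΦ (k.cycleRange.symm)⁻¹
    rw [inner_smul_left, inner_permute, h1, inner_smul_right, Equiv.Perm.sign_inv,
      sign_cycleRange_symm, map_pow, map_neg, map_one, ← mul_assoc, ← mul_pow]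
    simp
  rw [creationSum, inner_smul_left, sum_inner, Finset.sum_congr rfl fun k _ => hk k,
    Finset.sum_const, Finset.card_univ, Fintype.card_fin, nsmul_eq_mul, map_inv₀, Complex.conj_ofReal]
  push_cast
  rw [← hsq]
  field_simp

/-- The annihilation operators `ℋₙ₊₁ → ℋₙ`. -/
def annL (hW : W.IsSymmetric) (g : OneParticle s m) (n : ℕ) :
    nParticle s m (n + 1) →L[ℂ] nParticle s m n :=
  (creL hW m n g).adjoint

lemma inner_creL_left (hW : W.IsSymmetric) (g : OneParticle s m) (Ψ : nParticle s m n)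
    (Φ : nParticle s m (n + 1)) :
    inner ℂ (creL hW m n g Ψ) Φ = inner ℂ Ψ (annL hW g n Φ) :=
  (ContinuousLinearMap.adjoint_inner_right _ _ _).symm

/-- `annL` is the adjoint within the antisymmetric spaces. It is obtained from the adjoint on the
full `L²` spaces without a further projection, because that adjoint already maps into the
antisymmetric subspace. -/
lemma coe_annL (hW : W.IsSymmetric) (g : OneParticle s m) (Φ : nParticle s m (n + 1)) :
    (annL hW g n Φ : Lp ℂ 2 (shellPi s m n)) =
      ((√(n + 1 : ℝ) : ℝ) : ℂ) • (tensorL W g).adjoint (Φ : Lp ℂ 2 (shellPi s m (n + 1))) := by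
  suffices h : annL hW g n Φ = ⟨((√(n + 1 : ℝ) : ℝ) : ℂ) • (tensorL W g).adjoint
      (Φ : Lp ℂ 2 (shellPi s m (n + 1))),
      Submodule.smul_mem _ _ (adjoint_tensorL_mem hW g Φ.2)⟩ by rw [h]
  refine ext_inner_left ℂ fun v => ?_
  rw [← inner_creL_left, Submodule.coe_inner, Submodule.coe_inner, coe_creL,
    inner_creationSum W g _ Φ.2, inner_smul_right, ContinuousLinearMap.adjoint_inner_right]

lemma coeFn_annL (hW : W.IsSymmetric) (g : OneParticle s m) (Ψ : Fock s m) :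
    annihilationFun W g Ψ n =ᵐ[shellPi s m n]
      (annL hW g n (Ψ (n + 1)) : Lp ℂ 2 (shellPi s m n)) := by
  rw [coe_annL]
  filter_upwards [Lp.coeFn_smul ((√(n + 1 : ℝ) : ℝ) : ℂ) ((tensorL W g).adjoint
    (Ψ (n + 1) : Lp ℂ 2 (shellPi s m (n + 1)))), coeFn_adjoint_tensorL W g
    (Ψ (n + 1) : Lp ℂ 2 (shellPi s m (n + 1)))] with q h1 h2
  rw [h1, Pi.smul_apply, h2]
  rfl

/-- An `(n+1)`-particle vector that is annihilated by all annihilation operators is zero. -/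
lemma eq_zero_of_annL_eq_zero (hW : W.IsSymmetric) (hW0 : ∀ n p q, W.toFun n p q ≠ 0)
    {Φ : nParticle s m (n + 1)} (h : ∀ g : OneParticle s m, annL hW g n Φ = 0) : Φ = 0 := by
  have hn : ((√(n + 1 : ℝ) : ℝ) : ℂ) ≠ 0 := by
    exact_mod_cast (Real.sqrt_pos.2 (by positivity : (0 : ℝ) < n + 1)).ne'
  have hT : ∀ g : OneParticle s m, (tensorL W g).adjoint
      (Φ : Lp ℂ 2 (shellPi s m (n + 1))) = 0 := by
    intro g
    have := coe_annL hW g Φ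
    rw [h g, Submodule.coe_zero, eq_comm, smul_eq_zero] at this
    exact this.resolve_left hn
  have : Fact ((2 : ℝ≥0∞) ≠ ∞) := ⟨ENNReal.ofNat_ne_top⟩
  -- The null set of exceptional `q` depends on the one-particle vector. A countable dense family
  -- permits a common null set and still detects zero in `ℋ₁`.
  let D := TopologicalSpace.denseSeq (OneParticle s m)
  have hD : ∀ j, ∀ᵐ q ∂(shellPi s m n),
      ∫ p, conj (D j p) * W.toFun n p q *
        (Φ : Lp ℂ 2 (shellPi s m (n + 1))) (Fin.cons p q) ∂(shellMeasure s m) = 0 := by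
    intro j
    filter_upwards [coeFn_adjoint_tensorL W (D j) (Φ : Lp ℂ 2 (shellPi s m (n + 1))),
      Lp.coeFn_zero ℂ 2 (shellPi s m n)] with q h1 h2
    rw [← h1, hT, h2]; rfl
  have hΦ : MemLp (Φ : Lp ℂ 2 (shellPi s m (n + 1))) 2 (shellPi s m (n + 1)) := Lp.memLp _
  have hΦ2 := hΦ.comp_measurePreserving (measurePreserving_cons s m n)
  have hi := (hΦ2.integrable_norm_pow (by norm_num)).prod_right_ae
  have hz : ∀ᵐ q ∂(shellPi s m n), ∀ᵐ p ∂(shellMeasure s m),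
      (Φ : Lp ℂ 2 (shellPi s m (n + 1))) (Fin.cons p q) = 0 := by
    filter_upwards [ae_all_iff.2 hD, hi, hΦ2.1.prodMk_left] with q hq hq2 hqm
    have h2 : MemLp (fun p => (Φ : Lp ℂ 2 (shellPi s m (n + 1))) (Fin.cons p q)) 2
        (shellMeasure s m) := by
      refine (memLp_two_iff_integrable_sq_norm hqm).2 ?_
      simpa using hq2
    have hWm : Measurable fun p => W.toFun n p q :=
      (W.measurable_toFun n).comp (measurable_id.prodMk measurable_const)
    have h3 : MemLp (fun p => W.toFun n p q *
        (Φ : Lp ℂ 2 (shellPi s m (n + 1))) (Fin.cons p q)) 2 (shellMeasure s m) := by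
      refine h2.mono (hWm.aestronglyMeasurable.mul h2.1) (Filter.Eventually.of_forall fun p => ?_)
      rw [norm_mul]
      exact mul_le_of_le_one_left (norm_nonneg _) (W.norm_le_one n p q)
    have h4 : h3.toLp = 0 := by
      refine (TopologicalSpace.denseRange_denseSeq (OneParticle s m)).eq_zero_of_inner_right ℂ ?_
      intro j
      rw [L2.inner_def, ← hq j]
      refine integral_congr_ae ?_
      filter_upwards [h3.coeFn_toLp] with p hp
      rw [hp, RCLike.inner_apply]
      ring
    have h5 := h3.coeFn_toLp
    rw [h4] at h5
    filter_upwards [h5, Lp.coeFn_zero ℂ 2 (shellMeasure s m)] with p h6 h7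
    rw [h7, Pi.zero_apply, eq_comm, mul_eq_zero] at h6
    -- Being nowhere zero, the multiplier can be divided out.
    exact h6.resolve_left (hW0 n p q)
  have hz2 : ∀ᵐ x ∂((shellPi s m n).prod (shellMeasure s m)),
      (Φ : Lp ℂ 2 (shellPi s m (n + 1))) (Fin.cons x.2 x.1 : Fin (n + 1) → Spacetime s) = 0 := by
    have hmeas : MeasurableSet {x : (Fin n → Spacetime s) × Spacetime s |
        (Φ : Lp ℂ 2 (shellPi s m (n + 1))) (Fin.cons x.2 x.1 : Fin (n + 1) → Spacetime s) = 0} :=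
      ((Lp.stronglyMeasurable (Φ : Lp ℂ 2 (shellPi s m (n + 1)))).measurable.comp
        (measurePreserving_cons s m n).measurable) (measurableSet_singleton 0)
    exact (Measure.ae_prod_iff_ae_ae hmeas).2 hz
  refine Subtype.ext (Lp.ext ?_)
  filter_upwards [(measurePreserving_uncons s m n).quasiMeasurePreserving.ae hz2,
    Lp.coeFn_zero ℂ 2 (shellPi s m (n + 1))] with p h1 h2
  rw [Submodule.coe_zero, h2, Pi.zero_apply, ← h1]
  simp only [Fin.cons_self_tail]

end annihilation

end ScalarFermion

end

noncomputable section

namespace ScalarFermion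

set_option linter.unusedSectionVars false

/-! ### Sequences in a graded Hilbert space

Creation and annihilation operators act on arbitrary sequences; these are paired with sequences
that have only finitely many nonzero entries. -/

section sequences

variable {G : ℕ → Type*} [∀ n, NormedAddCommGroup (G n)] [∀ n, InnerProductSpace ℂ (G n)]
  [∀ n, CompleteSpace (G n)]

/-- The operator of degree one with components `C n`. -/
def raise (C : ∀ n, G n →L[ℂ] G (n + 1)) : (∀ n, G n) →ₗ[ℂ] (∀ n, G n) where
  toFun χ
    | 0 => 0
    | n + 1 => C n (χ n)
  map_add' χ η := by ext1 n; cases n <;> simp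
  map_smul' c χ := by ext1 n; cases n <;> simp

/-- The operator of degree minus one with components `(C n)*`. -/
def lower (C : ∀ n, G n →L[ℂ] G (n + 1)) : (∀ n, G n) →ₗ[ℂ] (∀ n, G n) where
  toFun χ n := (C n).adjoint (χ (n + 1))
  map_add' χ η := by ext1 n; simp
  map_smul' c χ := by ext1 n; simp

variable (C C' : ∀ n, G n →L[ℂ] G (n + 1))

@[simp] lemma raise_zero (χ : ∀ n, G n) : raise C χ 0 = 0 := rfl

@[simp] lemma raise_succ (χ : ∀ n, G n) (n : ℕ) : raise C χ (n + 1) = C n (χ n) := rfl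

@[simp] lemma lower_apply (χ : ∀ n, G n) (n : ℕ) :
    lower C χ n = (C n).adjoint (χ (n + 1)) := rfl

/-- Sequences with finitely many nonzero entries. -/
def IsFinite (χ : ∀ n, G n) : Prop := ∃ N, ∀ n, N < n → χ n = 0

variable {C C'}

lemma IsFinite.add {χ η : ∀ n, G n} (hχ : IsFinite χ) (hη : IsFinite η) :
    IsFinite (χ + η) := by
  obtain ⟨N, hN⟩ := hχ
  obtain ⟨M, hM⟩ := hη
  refine ⟨max N M, fun n hn => ?_⟩
  rw [Pi.add_apply, hN n ((le_max_left _ _).trans_lt hn), hM n ((le_max_right _ _).trans_lt hn),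
    add_zero]

lemma IsFinite.raise {χ : ∀ n, G n} (hχ : IsFinite χ) : IsFinite (raise C χ) := by
  obtain ⟨N, hN⟩ := hχ
  refine ⟨N + 1, fun n hn => ?_⟩
  cases n with
  | zero => rfl
  | succ n => rw [raise_succ, hN n (by omega), map_zero]

lemma IsFinite.lower {χ : ∀ n, G n} (hχ : IsFinite χ) : IsFinite (lower C χ) := by
  obtain ⟨N, hN⟩ := hχ
  exact ⟨N, fun n hn => by rw [lower_apply, hN (n + 1) (by omega), map_zero]⟩

lemma IsFinite.memℓp {χ : ∀ n, G n} (hχ : IsFinite χ) : Memℓp χ 2 := by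
  obtain ⟨N, hN⟩ := hχ
  refine memℓp_gen (summable_of_ne_finset_zero (s := Finset.range (N + 1)) fun n hn => ?_)
  rw [hN n (by simpa using hn), norm_zero]
  simp

/-- The pairing `∑ₙ ⟨χₙ, ηₙ⟩`. -/
def bracket (χ η : ∀ n, G n) : ℂ := ∑' n, inner ℂ (χ n) (η n)

lemma IsFinite.summable_left {χ : ∀ n, G n} (hχ : IsFinite χ) (η : ∀ n, G n) :
    Summable fun n => inner ℂ (χ n) (η n) := by
  obtain ⟨N, hN⟩ := hχ
  refine summable_of_ne_finset_zero (s := Finset.range (N + 1)) fun n hn => ?_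
  rw [hN n (by simpa using hn), inner_zero_left]

lemma IsFinite.summable_right {η : ∀ n, G n} (hη : IsFinite η) (χ : ∀ n, G n) :
    Summable fun n => inner ℂ (χ n) (η n) := by
  obtain ⟨N, hN⟩ := hη
  refine summable_of_ne_finset_zero (s := Finset.range (N + 1)) fun n hn => ?_
  rw [hN n (by simpa using hn), inner_zero_right]

lemma bracket_add_right (χ : ∀ n, G n) {η ξ : ∀ n, G n} (hη : IsFinite η)
    (hξ : IsFinite ξ) : bracket χ (η + ξ) = bracket χ η + bracket χ ξ := by
  simp only [bracket, Pi.add_apply, inner_add_right]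
  exact (hη.summable_right χ).tsum_add (hξ.summable_right χ)

lemma bracket_conj (χ η : ∀ n, G n) : conj (bracket χ η) = bracket η χ := by
  rw [bracket, Complex.conj_tsum]
  exact tsum_congr fun n => inner_conj_symm (η n) (χ n)

/-- Summability plays no role: the term at `0` vanishes and the others agree one by one after a
shift of the index, so the two series are the same. -/
lemma bracket_raise_right (χ η : ∀ n, G n) :
    bracket χ (raise C η) = bracket (lower C χ) η := by
  rw [bracket, ← Nat.succ_injective.tsum_eq (f := fun n => inner ℂ (χ n) (raise C η n))]
  · exact tsum_congr fun n => (ContinuousLinearMap.adjoint_inner_left (C n) _ _).symm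
  · intro n hn
    cases n with
    | zero => simp at hn
    | succ n => exact ⟨n, rfl⟩

lemma bracket_lower_right (χ η : ∀ n, G n) :
    bracket χ (lower C η) = bracket (raise C χ) η := by
  rw [← bracket_conj, ← bracket_raise_right, bracket_conj]

/-- Finiteness of one side alone makes all series finite sums, which can be split. The sequence `η`
may be arbitrary, so that the identity reaches vectors of the maximal domains and sequences outside
the Hilbert space. -/
lemma bracket_field {χ : ∀ n, G n} (hχ : IsFinite χ) (η : ∀ n, G n) :
    bracket (raise C' χ + lower C χ) η = bracket χ (raise C η + lower C' η) := by
  have e : bracket χ (raise C η + lower C' η) =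
      bracket χ (raise C η) + bracket χ (lower C' η) := by
    simp only [bracket, Pi.add_apply, inner_add_right]
    exact (hχ.summable_left _).tsum_add (hχ.summable_left _)
  have e' : bracket (raise C' χ + lower C χ) η =
      bracket (raise C' χ) η + bracket (lower C χ) η := by
    simp only [bracket, Pi.add_apply, inner_add_left]
    exact (hχ.raise.summable_left _).tsum_add (hχ.lower.summable_left _)
  rw [e, e', bracket_raise_right, bracket_lower_right, add_comm]

lemma inner_eq_bracket (Ψ Φ : lp G 2) : inner ℂ Ψ Φ = bracket (⇑Ψ) (⇑Φ) :=
  lp.inner_eq_tsum Ψ Φ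

/-- Operators that act on sequences as `A + B*` and `B + A*`, with `A` and `B` of degree one, are
adjoint to each other on finite sequences. -/
lemma inner_field_left {A B : lp G 2 →ₗ.[ℂ] lp G 2}
    (hA : ∀ Ψ : A.domain, ⇑(A Ψ) = raise C (⇑(Ψ : lp G 2)) + lower C' (⇑(Ψ : lp G 2)))
    (hB : ∀ Ψ : B.domain, ⇑(B Ψ) = raise C' (⇑(Ψ : lp G 2)) + lower C (⇑(Ψ : lp G 2)))
    (Ψ : B.domain) (hΨ : IsFinite (⇑(Ψ : lp G 2))) (Φ : A.domain) :
    inner ℂ (B Ψ) (Φ : lp G 2) = inner ℂ (Ψ : lp G 2) (A Φ) := by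
  rw [inner_eq_bracket, inner_eq_bracket, hA, hB]
  exact bracket_field hΨ _

lemma isFinite_single (n : ℕ) (v : G n) : IsFinite (⇑(lp.single 2 n v : lp G 2)) :=
  ⟨n, fun _ hk => lp.single_apply_ne _ _ _ hk.ne'⟩

lemma bracket_single (χ : ∀ n, G n) (n : ℕ) (v : G n) :
    bracket χ (⇑(lp.single 2 n v : lp G 2)) = inner ℂ (χ n) v := by
  rw [bracket, tsum_eq_single n fun k hk => by
    rw [lp.single_apply_ne _ _ _ hk, inner_zero_right], lp.single_apply_self]

lemma dense_of_isFinite {D : Submodule ℂ (lp G 2)} (hD : ∀ Ψ : lp G 2, IsFinite (⇑Ψ) → Ψ ∈ D) :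
    Dense (D : Set (lp G 2)) := by
  intro Ψ
  refine mem_closure_of_tendsto (lp.hasSum_single (by norm_num) Ψ)
    (Filter.Eventually.of_forall fun S => ?_)
  exact Submodule.sum_mem _ fun n _ => hD _ (isFinite_single n _)

end sequences

/-! ### Essential selfadjointness -/

/-- A densely defined symmetric operator is essentially selfadjoint if the graph of its adjoint is
contained in the closure of its graph. -/
lemma isSelfAdjoint_closure_of_adjoint_le {E : Type*} [NormedAddCommGroup E]
    [InnerProductSpace ℂ E] [CompleteSpace E] {T : E →ₗ.[ℂ] E} (hT : Dense (T.domain : Set E))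
    (hsymm : T.IsFormalAdjoint T)
    (h : ∀ x : T.adjoint.domain, ((x : E), T.adjoint x) ∈ closure (T.graph : Set (E × E))) :
    T.IsClosable ∧ IsSelfAdjoint T.closure := by
  have hle : T ≤ T.adjoint := hsymm.le_adjoint hT
  have hcl : T.IsClosable := (LinearPMap.adjoint_isClosed hT).isClosable.leIsClosable hle
  have hg := hcl.graph_closure_eq_closure_graph
  -- The closure is contained in the adjoint since the latter is closed and extends `T`; the reverse
  -- inclusion is the hypothesis `h`.
  have heq : T.closure.graph = T.adjoint.graph := by
    rw [← hg]
    refine le_antisymm (Submodule.topologicalClosure_minimal _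
      (LinearPMap.le_graph_of_le hle) (LinearPMap.adjoint_isClosed hT)) ?_
    rintro ⟨x, y⟩ hxy
    rw [LinearPMap.mem_graph_iff] at hxy
    obtain ⟨z, rfl, rfl⟩ := hxy
    exact h z
  have hT' : Dense (T.closure.domain : Set E) := hT.mono T.le_closure.1
  refine ⟨hcl, ?_⟩
  rw [LinearPMap.isSelfAdjoint_def]
  refine LinearPMap.eq_of_eq_graph ?_
  -- It remains to see that `T` and its closure have the same adjoint: the defining condition is
  -- continuous in the graph element, so it extends from the graph to its closure.
  rw [LinearPMap.adjoint_graph_eq_graph_adjoint hT', ← hg]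
  conv_rhs => rw [hg, heq, LinearPMap.adjoint_graph_eq_graph_adjoint hT]
  ext x
  simp only [Submodule.mem_adjoint_iff]
  refine ⟨fun hx a b hab => hx a b (Submodule.le_topologicalClosure _ hab), fun hx a b hab => ?_⟩
  have hclosed : IsClosed {z : E × E | inner ℂ z.2 x.1 - inner ℂ z.1 x.2 = 0} :=
    isClosed_eq (by fun_prop) continuous_const
  exact closure_minimal (fun z hz => hx z.1 z.2 hz) hclosed hab

/-- The cutoff functions `n ↦ max(0, 1 - √n / (j + 1))` for the particle number. -/
def cutoff (j n : ℕ) : ℝ := max 0 (1 - √n / (j + 1))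

lemma cutoff_nonneg (j n : ℕ) : 0 ≤ cutoff j n := le_max_left _ _

lemma cutoff_le_one (j n : ℕ) : cutoff j n ≤ 1 :=
  max_le zero_le_one (sub_le_self _ (by positivity))

lemma cutoff_eq_zero {j n : ℕ} (h : (j + 1) ^ 2 < n) : cutoff j n = 0 := by
  refine max_eq_left ?_
  have h1 : ((j : ℝ) + 1) ≤ √n := by
    refine Real.le_sqrt_of_sq_le ?_
    exact_mod_cast h.le
  rw [sub_nonpos, le_div_iff₀ (by positivity)]
  linarith

/-- This is the reason for a cutoff in `√n`: its increments are at most `√(n+1) - √n`, and `(√(n+1)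
- √n) √(n+1) ≤ (√(n+1) - √n)(√(n+1) + √n) = 1`. The growth of the creation operators is thereby
absorbed uniformly in `j`. -/
lemma abs_cutoff_sub_le (j n : ℕ) : |cutoff j n - cutoff j (n + 1)| * √(n + 1 : ℝ) ≤ 1 := by
  have h1 : |cutoff j n - cutoff j (n + 1)| ≤ √(n + 1 : ℝ) - √n := by
    refine (abs_max_sub_max_le_max _ _ _ _).trans ?_
    have h2 : √(n : ℝ) ≤ √(n + 1 : ℝ) := Real.sqrt_le_sqrt (by linarith)
    have h3 : 1 - √(n : ℝ) / (j + 1) - (1 - √((n + 1 : ℕ) : ℝ) / (j + 1)) =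
        (√(n + 1 : ℝ) - √n) / (j + 1) := by push_cast; ring
    rw [h3, sub_self, abs_zero, abs_of_nonneg (div_nonneg (by linarith) (by positivity))]
    refine max_le (by linarith) (div_le_self (by linarith) ?_)
    linarith [(Nat.cast_nonneg j : (0 : ℝ) ≤ j)]
  have h4 : (√(n + 1 : ℝ)) ^ 2 = n + 1 := Real.sq_sqrt (by positivity)
  have h5 : (√(n : ℝ)) ^ 2 = n := Real.sq_sqrt (by positivity)
  have h2 : √(n : ℝ) ≤ √(n + 1 : ℝ) := Real.sqrt_le_sqrt (by linarith)
  have h6 := Real.sqrt_nonneg (n : ℝ)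
  have h7 := Real.sqrt_nonneg (n + 1 : ℝ)
  nlinarith

lemma tendsto_cutoff (n : ℕ) :
    Filter.Tendsto (fun j => ((cutoff j n : ℝ) : ℂ)) Filter.atTop (nhds 1) := by
  have h1 : Filter.Tendsto (fun j : ℕ => √(n : ℝ) / ((j : ℝ) + 1)) Filter.atTop (nhds 0) :=
    tendsto_const_nhds.div_atTop
      (Filter.tendsto_atTop_add_const_right _ _ tendsto_natCast_atTop_atTop)
  have h2 : Filter.Tendsto (fun j => cutoff j n) Filter.atTop (nhds (max 0 (1 - 0))) :=
    tendsto_const_nhds.max (tendsto_const_nhds.sub h1)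
  rw [sub_zero, max_eq_right zero_le_one] at h2
  exact_mod_cast (Complex.continuous_ofReal.tendsto 1).comp h2

/-! ### Approximation in the graph norm by particle number cutoffs -/

section selfadjoint

variable {G : ℕ → Type*} [∀ n, NormedAddCommGroup (G n)] [∀ n, InnerProductSpace ℂ (G n)]

/-- Dominated convergence in a Hilbert space direct sum. -/
lemma tendsto_of_dominated {Ψ : ℕ → lp G 2} {Φ : lp G 2} {b : ℕ → ℝ}
    (hb : Summable fun n => b n ^ 2) (hle : ∀ j n, ‖Ψ j n - Φ n‖ ≤ b n)
    (hlim : ∀ n, Filter.Tendsto (fun j => Ψ j n) Filter.atTop (nhds (Φ n))) :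
    Filter.Tendsto Ψ Filter.atTop (nhds Φ) := by
  rw [tendsto_iff_norm_sub_tendsto_zero]
  have hsq : ∀ j, ‖Ψ j - Φ‖ ^ 2 = ∑' n, ‖Ψ j n - Φ n‖ ^ 2 := by
    intro j
    have := lp.norm_rpow_eq_tsum (p := 2) (by norm_num) (Ψ j - Φ)
    simpa using this
  have h0 : Filter.Tendsto (fun j => ∑' n, ‖Ψ j n - Φ n‖ ^ 2) Filter.atTop
      (nhds (∑' _ : ℕ, (0 : ℝ))) := by
    refine tendsto_tsum_of_dominated_convergence hb (fun n => ?_)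
      (Filter.Eventually.of_forall fun j n => ?_)
    · have := (tendsto_iff_norm_sub_tendsto_zero.1 (hlim n)).pow 2
      simpa using this
    · rw [Real.norm_of_nonneg (by positivity)]
      exact pow_le_pow_left₀ (norm_nonneg _) (hle j n) 2
  rw [tsum_zero] at h0
  have h1 : Filter.Tendsto (fun j => √(‖Ψ j - Φ‖ ^ 2)) Filter.atTop (nhds √0) := by
    simp only [hsq]
    exact (Real.continuous_sqrt.tendsto 0).comp h0
  simpa [Real.sqrt_sq (norm_nonneg _)] using h1

lemma summable_norm_sq (Ψ : lp G 2) : Summable fun n => ‖Ψ n‖ ^ 2 := by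
  have := (lp.memℓp Ψ).summable (by norm_num)
  simpa using this

/-- The sequence `χ` multiplied with a cutoff function. -/
def cutSeq (j : ℕ) (χ : ∀ n, G n) : ∀ n, G n := fun n => ((cutoff j n : ℝ) : ℂ) • χ n

lemma isFinite_cutSeq (j : ℕ) (χ : ∀ n, G n) : IsFinite (cutSeq j χ) :=
  ⟨(j + 1) ^ 2, fun n hn => by simp [cutSeq, cutoff_eq_zero hn]⟩

/-- The norms of a sequence, shifted by one. -/
def shiftNorm (χ : ∀ n, G n) : ℕ → ℝ
  | 0 => 0
  | n + 1 => ‖χ n‖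

variable [∀ n, CompleteSpace (G n)] {C : ∀ n, G n →L[ℂ] G (n + 1)} {K : ℝ}

/-- The left side is the commutator of `raise C` with the cutoff. Only the difference of
neighbouring cutoff values survives, and its product with `‖C n‖` is bounded independently of `j`.
-/
lemma norm_raise_cutSeq_le (hC : ∀ n, ‖C n‖ ≤ √(n + 1 : ℝ) * K) (hK : 0 ≤ K) (j : ℕ)
    (χ : ∀ n, G n) (n : ℕ) :
    ‖raise C (cutSeq j χ) n - ((cutoff j n : ℝ) : ℂ) • raise C χ n‖ ≤ K * shiftNorm χ n := by
  cases n with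
  | zero => simp [shiftNorm]
  | succ n =>
    rw [raise_succ, raise_succ, cutSeq, map_smul, ← sub_smul, norm_smul, ← Complex.ofReal_sub,
      Complex.norm_real, Real.norm_eq_abs, shiftNorm]
    calc _ ≤ |cutoff j n - cutoff j (n + 1)| * (√(n + 1 : ℝ) * K * ‖χ n‖) := by
          gcongr
          exact ContinuousLinearMap.le_of_opNorm_le _ (hC n) _
      _ = (|cutoff j n - cutoff j (n + 1)| * √(n + 1 : ℝ)) * (K * ‖χ n‖) := by ring
      _ ≤ 1 * (K * ‖χ n‖) := by gcongr; exact abs_cutoff_sub_le j n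
      _ = _ := one_mul _

lemma norm_lower_cutSeq_le (hC : ∀ n, ‖C n‖ ≤ √(n + 1 : ℝ) * K) (hK : 0 ≤ K) (j : ℕ)
    (χ : ∀ n, G n) (n : ℕ) :
    ‖lower C (cutSeq j χ) n - ((cutoff j n : ℝ) : ℂ) • lower C χ n‖ ≤ K * ‖χ (n + 1)‖ := by
  rw [lower_apply, lower_apply, cutSeq, map_smul, ← sub_smul, norm_smul, ← Complex.ofReal_sub,
    Complex.norm_real, Real.norm_eq_abs, abs_sub_comm]
  calc _ ≤ |cutoff j n - cutoff j (n + 1)| * (√(n + 1 : ℝ) * K * ‖χ (n + 1)‖) := by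
        gcongr
        refine ContinuousLinearMap.le_of_opNorm_le _ ?_ _
        rw [LinearIsometryEquiv.norm_map]
        exact hC n
    _ = (|cutoff j n - cutoff j (n + 1)| * √(n + 1 : ℝ)) * (K * ‖χ (n + 1)‖) := by ring
    _ ≤ 1 * (K * ‖χ (n + 1)‖) := by gcongr; exact abs_cutoff_sub_le j n
    _ = _ := one_mul _

lemma tendsto_raise_cutSeq (χ : ∀ n, G n) (n : ℕ) :
    Filter.Tendsto (fun j => raise C (cutSeq j χ) n) Filter.atTop (nhds (raise C χ n)) := by
  cases n with
  | zero => exact tendsto_const_nhds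
  | succ n =>
    simp only [raise_succ, cutSeq, map_smul]
    simpa using (tendsto_cutoff n).smul_const (C n (χ n))

lemma tendsto_lower_cutSeq (χ : ∀ n, G n) (n : ℕ) :
    Filter.Tendsto (fun j => lower C (cutSeq j χ) n) Filter.atTop (nhds (lower C χ n)) := by
  simp only [lower_apply, cutSeq, map_smul]
  simpa using (tendsto_cutoff (n + 1)).smul_const ((C n).adjoint (χ (n + 1)))

/-- Vectors in the maximal domain are approximated in the graph norm by their cutoffs. -/
lemma mem_closure_graph (hC : ∀ n, ‖C n‖ ≤ √(n + 1 : ℝ) * K) (hK : 0 ≤ K)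
    {T : lp G 2 →ₗ.[ℂ] lp G 2} (hdom : ∀ Ψ : lp G 2, IsFinite (⇑Ψ) → Ψ ∈ T.domain)
    (hT : ∀ Ψ : T.domain, ⇑(T Ψ) = raise C (⇑(Ψ : lp G 2)) + lower C (⇑(Ψ : lp G 2)))
    {X Ψ : lp G 2} (hX : ⇑X = raise C (⇑Ψ) + lower C (⇑Ψ)) :
    (Ψ, X) ∈ closure (T.graph : Set (lp G 2 × lp G 2)) := by
  let Y : ℕ → lp G 2 := fun j => ⟨cutSeq j Ψ, (isFinite_cutSeq j _).memℓp⟩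
  have hY : ∀ j, Y j ∈ T.domain := fun j => hdom _ (isFinite_cutSeq j _)
  have hTY : ∀ j, ⇑(T ⟨Y j, hY j⟩) = raise C (cutSeq j Ψ) + lower C (cutSeq j Ψ) :=
    fun j => hT _
  refine mem_closure_of_tendsto (f := fun j => (Y j, T ⟨Y j, hY j⟩)) (b := Filter.atTop)
    (Filter.Tendsto.prodMk_nhds ?_ ?_) (Filter.Eventually.of_forall fun j =>
      LinearPMap.mem_graph T ⟨Y j, hY j⟩)
  · refine tendsto_of_dominated (summable_norm_sq Ψ) (fun j n => ?_) fun n => ?_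
    · have : Y j n - Ψ n = (((cutoff j n - 1 : ℝ)) : ℂ) • Ψ n := by
        simp [Y, cutSeq, sub_smul]
      rw [this, norm_smul, Complex.norm_real, Real.norm_eq_abs]
      refine mul_le_of_le_one_left (norm_nonneg _) ?_
      rw [abs_le]; constructor <;> linarith [cutoff_nonneg j n, cutoff_le_one j n]
    · simpa [Y, cutSeq] using (tendsto_cutoff n).smul_const (Ψ n)
  -- The three terms of the bound belong to `X` and to the two commutators. Square summability uses
  -- `(a + b + c)² ≤ 3 (a² + b² + c²)`.
  · refine tendsto_of_dominated (b := fun n => ‖X n‖ + (K * shiftNorm (⇑Ψ) n +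
      K * ‖Ψ (n + 1)‖)) ?_ (fun j n => ?_) fun n => ?_
    · have hs : Summable fun n => shiftNorm (⇑Ψ) n ^ 2 := by
        rw [← summable_nat_add_iff 1]
        exact summable_norm_sq Ψ
      have hs2 : Summable fun n => ‖Ψ (n + 1)‖ ^ 2 :=
        (summable_nat_add_iff 1).2 (summable_norm_sq Ψ)
      refine Summable.of_nonneg_of_le (fun n => sq_nonneg _) (fun n => ?_)
        (((summable_norm_sq X).mul_left 3).add (((hs.mul_left (3 * K ^ 2))).add
          (hs2.mul_left (3 * K ^ 2))))
      set a := ‖X n‖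
      set b := K * shiftNorm (⇑Ψ) n with hb
      set c := K * ‖Ψ (n + 1)‖ with hc
      have e1 : 3 * K ^ 2 * shiftNorm (⇑Ψ) n ^ 2 = 3 * b ^ 2 := by rw [hb]; ring
      have e2 : 3 * K ^ 2 * ‖Ψ (n + 1)‖ ^ 2 = 3 * c ^ 2 := by rw [hc]; ring
      rw [e1, e2]
      nlinarith [sq_nonneg (a - b), sq_nonneg (a - c), sq_nonneg (b - c)]
    -- Only the sum `X` is known to be square summable, not `raise C Ψ` and `lower C Ψ` separately.
    -- The cutoff is therefore commuted through each summand and then applied to `X` as a whole.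
    · have e : T ⟨Y j, hY j⟩ n - X n = (((cutoff j n - 1 : ℝ)) : ℂ) • X n +
          ((raise C (cutSeq j Ψ) n - ((cutoff j n : ℝ) : ℂ) • raise C (⇑Ψ) n) +
          (lower C (cutSeq j Ψ) n - ((cutoff j n : ℝ) : ℂ) • lower C (⇑Ψ) n)) := by
        rw [hTY, hX]
        simp only [Pi.add_apply, smul_add, Complex.ofReal_sub, Complex.ofReal_one, sub_smul,
          one_smul]
        abel
      rw [e]
      refine (norm_add_le _ _).trans (add_le_add ?_ ((norm_add_le _ _).trans
        (add_le_add (norm_raise_cutSeq_le hC hK j _ n) (norm_lower_cutSeq_le hC hK j _ n))))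
      rw [norm_smul, Complex.norm_real, Real.norm_eq_abs]
      refine mul_le_of_le_one_left (norm_nonneg _) ?_
      rw [abs_le]; constructor <;> linarith [cutoff_nonneg j n, cutoff_le_one j n]
    · rw [hX]
      simp only [hTY]
      exact (tendsto_raise_cutSeq _ n).add (tendsto_lower_cutSeq _ n)

/-- An operator that acts on finite sequences as `C + C*` with `‖C n‖ = O(√n)` is essentially
selfadjoint. -/
lemma isSelfAdjoint_closure_of_raise_add_lower (hC : ∀ n, ‖C n‖ ≤ √(n + 1 : ℝ) * K) (hK : 0 ≤ K)
    {T : lp G 2 →ₗ.[ℂ] lp G 2} (hdom : ∀ Ψ : lp G 2, Ψ ∈ T.domain ↔ IsFinite (⇑Ψ))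
    (hT : ∀ Ψ : T.domain, ⇑(T Ψ) = raise C (⇑(Ψ : lp G 2)) + lower C (⇑(Ψ : lp G 2))) :
    T.IsClosable ∧ IsSelfAdjoint T.closure := by
  have hd : Dense (T.domain : Set (lp G 2)) := dense_of_isFinite fun Ψ => (hdom Ψ).2
  refine isSelfAdjoint_closure_of_adjoint_le hd
    (fun x y => inner_field_left hT hT x ((hdom x).1 x.2) y) fun x => ?_
  refine mem_closure_graph hC hK (fun Ψ => (hdom Ψ).2) hT ?_
  ext1 n
  -- Testing the adjoint against vectors concentrated at level `n` shows that it, too, acts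
  -- componentwise as `C + C*`, without assuming that its arguments are finite.
  refine ext_inner_right ℂ fun v => ?_
  have h1 := LinearPMap.adjoint_isFormalAdjoint hd x
    ⟨lp.single 2 n v, (hdom _).2 (isFinite_single n v)⟩
  rw [inner_eq_bracket, inner_eq_bracket, hT] at h1
  have h2 := congrArg conj (bracket_field (C := C) (C' := C) (isFinite_single n v) (⇑(x : lp G 2)))
  rw [bracket_conj, bracket_conj] at h2
  have h3 := h1.trans h2
  rwa [bracket_single, bracket_single] at h3

end selfadjoint

end ScalarFermion

end

noncomputable section

namespace ScalarFermion

set_option linter.unusedSectionVars false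

/-! ### The smeared operators on Fock space in terms of sequences -/

lemma raise_zero_left {G : ℕ → Type*} [∀ n, NormedAddCommGroup (G n)]
    [∀ n, InnerProductSpace ℂ (G n)] [∀ n, CompleteSpace (G n)] (χ : ∀ n, G n) :
    raise (0 : ∀ n, G n →L[ℂ] G (n + 1)) χ = 0 := by
  ext1 n
  cases n <;> rfl

lemma lower_zero_left {G : ℕ → Type*} [∀ n, NormedAddCommGroup (G n)]
    [∀ n, InnerProductSpace ℂ (G n)] [∀ n, CompleteSpace (G n)] (χ : ∀ n, G n) :
    lower (0 : ∀ n, G n →L[ℂ] G (n + 1)) χ = 0 := by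
  ext1 n
  simp

/-- Sequences of `n`-particle vectors, without summability condition. -/
abbrev ParticleSeq (s : ℕ) (m : ℝ) : Type := ∀ n, nParticle s m n

section operators

variable {s : ℕ} {m : ℝ} {W : Multiplier s} (hW : W.IsSymmetric)

/-- The creation operators `ℋₙ → ℋₙ₊₁` for a fixed one-particle vector. -/
def cre (g : OneParticle s m) (n : ℕ) : nParticle s m n →L[ℂ] nParticle s m (n + 1) :=
  creL hW m n g

/-- `a*(g) + a(h)`. -/
def smeared (W : Multiplier s) (g h : OneParticle s m) : Fock s m →ₗ.[ℂ] Fock s m :=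
  creation W g + annihilation W h

lemma coeFn_raise_cre (g : OneParticle s m) (Ψ : Fock s m) (n : ℕ) :
    creationFun W g Ψ n =ᵐ[shellPi s m n]
      (raise (cre hW g) (⇑Ψ) n : Lp ℂ 2 (shellPi s m n)) := by
  cases n with
  | zero =>
    filter_upwards [Lp.coeFn_zero ℂ 2 (shellPi s m 0)] with p hp
    rw [raise_zero, Submodule.coe_zero, hp]; rfl
  | succ n => exact coeFn_creL hW g Ψ

lemma mem_creation_domain {g : OneParticle s m} {Ψ : Fock s m}
    (h : Memℓp (raise (cre hW g) (⇑Ψ)) 2) : Ψ ∈ (creation W g).domain :=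
  ⟨⟨raise (cre hW g) (⇑Ψ), h⟩, fun n => (coeFn_raise_cre hW g Ψ n).symm⟩

lemma mem_annihilation_domain {g : OneParticle s m} {Ψ : Fock s m}
    (h : Memℓp (lower (cre hW g) (⇑Ψ)) 2) : Ψ ∈ (annihilation W g).domain :=
  ⟨⟨lower (cre hW g) (⇑Ψ), h⟩, fun _ => (coeFn_annL hW g Ψ).symm⟩

lemma coe_creation (g : OneParticle s m) (Ψ : (creation W g).domain) :
    (⇑(creation W g Ψ) : ParticleSeq s m) = raise (cre hW g) (⇑(Ψ : Fock s m)) := by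
  ext1 n
  refine Subtype.ext (Lp.ext ?_)
  have h := maximalOperator_spec (creationFun W g) (creationFun_add W g) (creationFun_smul W g) Ψ n
  exact h.trans (coeFn_raise_cre hW g Ψ n)

lemma coe_annihilation (g : OneParticle s m) (Ψ : (annihilation W g).domain) :
    (⇑(annihilation W g Ψ) : ParticleSeq s m) = lower (cre hW g) (⇑(Ψ : Fock s m)) := by
  ext1 n
  refine Subtype.ext (Lp.ext ?_)
  have h := maximalOperator_spec (annihilationFun W g) (annihilationFun_add W g)
    (annihilationFun_smul W g) Ψ n
  exact h.trans (coeFn_annL hW g Ψ)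

lemma smeared_apply (g h : OneParticle s m) (Ψ : (smeared W g h).domain) :
    smeared W g h Ψ = creation W g ⟨Ψ, Ψ.2.1⟩ + annihilation W h ⟨Ψ, Ψ.2.2⟩ := rfl

lemma coe_smeared (g h : OneParticle s m) (Ψ : (smeared W g h).domain) :
    (⇑(smeared W g h Ψ) : ParticleSeq s m) =
      raise (cre hW g) (⇑(Ψ : Fock s m)) + lower (cre hW h) (⇑(Ψ : Fock s m)) := by
  rw [smeared_apply, lp.coeFn_add, coe_creation hW, coe_annihilation hW]

lemma mem_smeared_domain {g h : OneParticle s m} {Ψ : Fock s m}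
    (h1 : Memℓp (raise (cre hW g) (⇑Ψ)) 2) (h2 : Memℓp (lower (cre hW h) (⇑Ψ)) 2) :
    Ψ ∈ (smeared W g h).domain :=
  ⟨mem_creation_domain hW h1, mem_annihilation_domain hW h2⟩

lemma mem_finiteParticle_iff {Ψ : Fock s m} :
    Ψ ∈ finiteParticle s m ↔ IsFinite (⇑Ψ : ParticleSeq s m) := Iff.rfl

lemma dense_finiteParticle (s : ℕ) (m : ℝ) : Dense (finiteParticle s m : Set (Fock s m)) :=
  dense_of_isFinite fun _ => mem_finiteParticle_iff.2

lemma finiteParticle_le_domain (hW : W.IsSymmetric) (g h : OneParticle s m) :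
    finiteParticle s m ≤ (smeared W g h).domain := fun _ hΨ =>
  mem_smeared_domain hW (mem_finiteParticle_iff.1 hΨ).raise.memℓp
    (mem_finiteParticle_iff.1 hΨ).lower.memℓp

lemma smeared_mem_finiteParticle (hW : W.IsSymmetric) (g h : OneParticle s m)
    (Ψ : (smeared W g h).domain) (hΨ : (Ψ : Fock s m) ∈ finiteParticle s m) :
    smeared W g h Ψ ∈ finiteParticle s m := by
  rw [mem_finiteParticle_iff] at hΨ ⊢
  rw [coe_smeared hW]
  exact hΨ.raise.add hΨ.lower

/-- Since `Ψ` is finite, the adjointness relation holds against every `Φ` of the maximal domain,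
finite or not. Taking adjoints turns `a*(g)` into `a(g)` and `a(h)` into `a*(h)`, hence the exchange
of `g` and `h`. -/
lemma smeared_adjoint (hW : W.IsSymmetric) (g h : OneParticle s m) {Ψ : Fock s m}
    (hΨ : Ψ ∈ finiteParticle s m) : ∃ (h1 : Ψ ∈ (smeared W g h).adjoint.domain) (h2 : Ψ ∈ (smeared W h g).domain),
      (smeared W g h).adjoint ⟨Ψ, h1⟩ = smeared W h g ⟨Ψ, h2⟩ := by
  have h2 : Ψ ∈ (smeared W h g).domain := finiteParticle_le_domain hW h g hΨ
  have h3 : ∀ Φ : (smeared W g h).domain,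
      inner ℂ (smeared W h g ⟨Ψ, h2⟩) (Φ : Fock s m) = inner ℂ Ψ (smeared W g h Φ) :=
    fun Φ => inner_field_left (coe_smeared hW g h) (coe_smeared hW h g) ⟨Ψ, h2⟩
      (mem_finiteParticle_iff.1 hΨ) Φ
  have h1 := LinearPMap.mem_adjoint_domain_of_exists Ψ ⟨_, h3⟩
  exact ⟨h1, h2, LinearPMap.adjoint_apply_eq
    ((dense_finiteParticle s m).mono (finiteParticle_le_domain hW g h)) _ h3⟩

/-- `a*(g) + a(g)` is essentially selfadjoint on the vectors of finite particle number. -/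
lemma smeared_isEssentiallySelfAdjointOn (hW : W.IsSymmetric) (g : OneParticle s m) :
    IsEssentiallySelfAdjointOn (smeared W g g) (finiteParticle s m) := by
  have hdom := finiteParticle_le_domain hW g g
  refine ⟨hdom, isSelfAdjoint_closure_of_raise_add_lower (C := cre hW g)
    (fun n => norm_creL_le hW g) (norm_nonneg g) (fun Ψ => ?_) fun Ψ => ?_⟩
  · exact ⟨fun h => mem_finiteParticle_iff.1 h.1, fun h =>
      ⟨mem_finiteParticle_iff.2 h, hdom (mem_finiteParticle_iff.2 h)⟩⟩
  · exact coe_smeared hW g g ⟨Ψ, Ψ.2.2⟩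

lemma tensorL_eq_of_zero {W' : Multiplier s} (h : ∀ p q, W.toFun 0 p q = W'.toFun 0 p q)
    (g : OneParticle s m) (Ψ : Lp ℂ 2 (shellPi s m 0)) : tensorL W g Ψ = tensorL W' g Ψ := by
  refine Lp.ext ((coeFn_tensorL W g Ψ).trans (Filter.EventuallyEq.trans ?_
    (coeFn_tensorL W' g Ψ).symm))
  exact Filter.Eventually.of_forall fun p => by simp only [tensorFun, h]

lemma vacuum_mem (s : ℕ) (m : ℝ) : vacuum s m ∈ finiteParticle s m :=
  mem_finiteParticle_iff.2 (isFinite_single 0 _)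

lemma vacuum_succ (s : ℕ) (m : ℝ) (n : ℕ) : vacuum s m (n + 1) = 0 :=
  lp.single_apply_ne _ _ _ (Nat.succ_ne_zero n)

/-- The action of `a*(g) + a(h)` on the vacuum does not depend on the multiplier. -/
lemma smeared_vacuum {W' : Multiplier s} (hW : W.IsSymmetric) (hW' : W'.IsSymmetric)
    (h0 : ∀ p q, W.toFun 0 p q = W'.toFun 0 p q) (g h : OneParticle s m)
    (h1 : vacuum s m ∈ (smeared W g h).domain) (h2 : vacuum s m ∈ (smeared W' g h).domain) :
    smeared W g h ⟨vacuum s m, h1⟩ = smeared W' g h ⟨vacuum s m, h2⟩ := by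
  refine lp.ext ?_
  rw [coe_smeared hW, coe_smeared hW']
  ext1 n
  simp only [Pi.add_apply, lower_apply, vacuum_succ, map_zero, add_zero]
  rcases n with _ | _ | n
  · rfl
  · rw [raise_succ, raise_succ]
    refine Subtype.ext ?_
    rw [cre, cre, coe_creL, coe_creL, creationSum, creationSum, tensorL_eq_of_zero h0]
  · rw [raise_succ, raise_succ, vacuum_succ, map_zero, map_zero]

/-- `a*(0) + a(0) = 0`, with domain the whole Fock space. -/
lemma smeared_zero (hW : W.IsSymmetric) : smeared W (0 : OneParticle s m) 0 = 0 := by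
  have hc : cre hW (0 : OneParticle s m) = 0 := funext fun n => (creL hW m n).map_zero
  have hr : ∀ χ : ParticleSeq s m, raise (cre hW 0) χ = 0 := fun χ => by rw [hc, raise_zero_left]
  have hl : ∀ χ : ParticleSeq s m, lower (cre hW 0) χ = 0 := fun χ => by rw [hc, lower_zero_left]
  have hdom : ∀ Ψ, Ψ ∈ (smeared W (0 : OneParticle s m) 0).domain := by
    intro Ψ
    refine mem_smeared_domain hW ?_ ?_
    · rw [hr]; exact zero_memℓp
    · rw [hl]; exact zero_memℓp
  refine LinearPMap.ext (eq_top_iff.2 fun Ψ _ => hdom Ψ) fun x h1 h2 => ?_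
  refine lp.ext ((coe_smeared hW _ _ _).trans ?_)
  rw [hr, hl, add_zero]
  rfl

end operators

/-! ### The test functions -/

section testFunctions

variable {s : ℕ} {m : ℝ} (hm : 0 < m)

lemma mink_neg_left (x y : Spacetime s) : mink (-x) y = -mink x y := by
  simp only [mink, PiLp.neg_apply, neg_mul, Finset.sum_neg_distrib]; ring

lemma conjTest_apply (f : 𝓢(Spacetime s, ℂ)) (x : Spacetime s) : conjTest f x = conj (f x) := rfl

lemma minkFourier_conjTest (f : 𝓢(Spacetime s, ℂ)) (p : Spacetime s) :
    minkFourier (conjTest f) p = conj (minkFourier f (-p)) := by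
  rw [minkFourier, minkFourier, ← integral_conj]
  refine integral_congr_ae (Filter.Eventually.of_forall fun x => ?_)
  simp only [conjTest_apply, map_mul, ← Complex.exp_conj, Complex.conj_I, Complex.conj_ofReal,
    mink_neg_left]
  push_cast
  ring_nf

lemma coeFn_fPlus (f : 𝓢(Spacetime s, ℂ)) :
    fPlus hm f =ᵐ[shellMeasure s m] fun p => minkFourier f p :=
  MemLp.coeFn_toLp (by simpa using memLp_minkFourier hm f 1 (by simp))

lemma coeFn_fMinus (f : 𝓢(Spacetime s, ℂ)) :
    fMinus hm f =ᵐ[shellMeasure s m] fun p => minkFourier f (-p) :=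
  MemLp.coeFn_toLp (by simpa using memLp_minkFourier hm f (-1) (by simp))

lemma fPlus_conjTest (f : 𝓢(Spacetime s, ℂ)) : fPlus hm (conjTest f) = star (fMinus hm f) := by
  refine Lp.ext ?_
  filter_upwards [coeFn_fPlus hm (conjTest f), coeFn_fMinus hm f, Lp.coeFn_star (fMinus hm f)]
    with p h1 h2 h3
  rw [h3, Pi.star_apply, h1, h2, minkFourier_conjTest]
  rfl

lemma star_fMinus_conjTest (f : 𝓢(Spacetime s, ℂ)) :
    star (fMinus hm (conjTest f)) = fPlus hm f := by
  rw [← fPlus_conjTest]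
  congr 1
  ext x
  simp [conjTest_apply]

lemma minkFourier_lineDeriv (f : 𝓢(Spacetime s, ℂ)) (v p : Spacetime s) :
    minkFourier (∂_{v} f) p = -(I * (mink p v : ℂ)) * minkFourier f p := by
  have htg : (fun y : Spacetime s => inner ℝ y v).HasTemperateGrowth :=
    ((innerSL ℝ).flip v).hasTemperateGrowth
  have hpi : (Real.pi : ℂ) ≠ 0 := by exact_mod_cast Real.pi_ne_zero
  rw [minkFourier_eq, minkFourier_eq, SchwartzMap.fourier_lineDerivOp_eq, smul_apply,
    SchwartzMap.smulLeftCLM_apply_apply htg, smul_eq_mul, real_smul, ← mul_assoc]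
  congr 1
  simp only [mink, PiLp.inner_apply, Fin.sum_univ_succ, Fin.cons_zero, Fin.cons_succ,
    RCLike.inner_apply, conj_trivial]
  push_cast
  simp only [mul_left_comm _ ((2 * (Real.pi : ℂ))⁻¹), ← Finset.mul_sum, mul_comm (v _ : ℂ)]
  field_simp
  ring

lemma mink_single_zero (p : Spacetime s) :
    mink p (EuclideanSpace.single (0 : Fin (s + 1)) (1 : ℝ)) = p 0 := by
  simp [mink]

lemma mink_single_succ (p : Spacetime s) (i : Fin s) :
    mink p (EuclideanSpace.single i.succ (1 : ℝ)) = -p i.succ := by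
  simp [mink, Fin.succ_inj, (Fin.succ_ne_zero i).symm]

/-- Each derivative `∂ᵥ` becomes the factor `-i p·v`, so `□` becomes `-p·p`. The symbol is even in
`p` and vanishes where `p·p = m²`, which disposes of `f⁺` and `f⁻` alike. -/
lemma minkFourier_kleinGordon (m : ℝ) (f : 𝓢(Spacetime s, ℂ)) (p : Spacetime s) :
    minkFourier (kleinGordon m f) p = ((m ^ 2 - mink p p : ℝ) : ℂ) * minkFourier f p := by
  have h : ∀ g : 𝓢(Spacetime s, ℂ), 𝓕 g (WithLp.toLp 2
      (Fin.cons (-(2 * Real.pi)⁻¹ * p 0) (fun i : Fin s => (2 * Real.pi)⁻¹ * p i.succ))) =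
      minkFourier g p := fun g => (minkFourier_eq g p).symm
  rw [minkFourier_eq, kleinGordon, FourierTransform.fourier_add, sub_eq_add_neg,
    FourierTransform.fourier_add, FourierTransform.fourier_neg, FourierTransform.fourier_sum, FourierTransform.fourier_smul]
  simp only [add_apply, neg_apply, sum_apply, smul_apply, h, minkFourier_lineDeriv,
    mink_single_zero, mink_single_succ]
  rw [real_smul]
  have h2 : ∑ i : Fin s, -(I * ((-p i.succ : ℝ) : ℂ)) * (-(I * ((-p i.succ : ℝ) : ℂ)) *
      minkFourier f p) = -(∑ i : Fin s, (p i.succ : ℂ) * p i.succ) * minkFourier f p := by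
    rw [← Finset.sum_neg_distrib, Finset.sum_mul]
    refine Finset.sum_congr rfl fun i _ => ?_
    push_cast
    linear_combination ((p i.succ : ℂ) * p i.succ * minkFourier f p) * I_mul_I
  rw [h2, mink]
  push_cast
  linear_combination ((p 0 : ℂ) * p 0 * minkFourier f p) * I_mul_I

lemma mink_shellPoint_self (m : ℝ) (p : EuclideanSpace ℝ (Fin s)) :
    mink (shellPoint m p) (shellPoint m p) = m ^ 2 := by
  have h : energy m p * energy m p = ‖p‖ ^ 2 + m ^ 2 := Real.mul_self_sqrt (by positivity)
  have h2 : ∑ i, p i * p i = ‖p‖ ^ 2 := by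
    rw [EuclideanSpace.norm_sq_eq]
    exact Finset.sum_congr rfl fun i _ => by rw [Real.norm_eq_abs, sq_abs, sq]
  simp only [mink, shellPoint, Fin.cons_zero, Fin.cons_succ, h, h2]
  ring

lemma measurableEmbedding_shellPoint (m : ℝ) :
    MeasurableEmbedding (shellPoint m : EuclideanSpace ℝ (Fin s) → Spacetime s) :=
  (continuous_shellPoint m).measurableEmbedding (shellPoint_injective m)

lemma ae_shellMeasure_of_forall {P : Spacetime s → Prop} (h : ∀ p, P (shellPoint m p)) :
    ∀ᵐ p ∂(shellMeasure s m), P p := by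
  rw [shellMeasure, (measurableEmbedding_shellPoint m).ae_map_iff]
  exact Filter.Eventually.of_forall h

lemma mink_neg_neg (x y : Spacetime s) : mink (-x) (-y) = mink x y := by
  simp [mink]

lemma fPlus_kleinGordon (f : 𝓢(Spacetime s, ℂ)) : fPlus hm (kleinGordon m f) = 0 := by
  refine Lp.ext ((coeFn_fPlus hm _).trans (Filter.EventuallyEq.trans ?_
    (Lp.coeFn_zero ℂ 2 (shellMeasure s m)).symm))
  refine ae_shellMeasure_of_forall fun p => ?_
  simp [minkFourier_kleinGordon, mink_shellPoint_self]

lemma fMinus_kleinGordon (f : 𝓢(Spacetime s, ℂ)) : fMinus hm (kleinGordon m f) = 0 := by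
  refine Lp.ext ((coeFn_fMinus hm _).trans (Filter.EventuallyEq.trans ?_
    (Lp.coeFn_zero ℂ 2 (shellMeasure s m)).symm))
  refine ae_shellMeasure_of_forall fun p => ?_
  simp [minkFourier_kleinGordon, mink_neg_neg, mink_shellPoint_self]

/-- The deformed field is `a*(f⁺) + a(conj f⁻)`. -/
lemma deformedField_eq (R : DeformationFunction) (Q : Matrix (Fin (s + 1)) (Fin (s + 1)) ℝ)
    (f : 𝓢(Spacetime s, ℂ)) : deformedField hm R Q f =
      smeared (Multiplier.deformation R Q) (fPlus hm f) (star (fMinus hm f)) := rfl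

end testFunctions

end ScalarFermion

end

noncomputable section

namespace ScalarFermion

/-! ### Multiplication with phases -/

section phase

variable {α : Type*} [MeasurableSpace α] {ν : Measure α} {θ θ' : α → ℝ}

lemma norm_exp_I_mul (t : ℝ) : ‖exp (I * (t : ℂ))‖ = 1 := by
  rw [mul_comm]; exact Complex.norm_exp_ofReal_mul_I t

lemma memLp_phase (hθ : Measurable θ) {f : α → ℂ} (hf : MemLp f 2 ν) :
    MemLp (fun x => exp (I * (θ x : ℂ)) * f x) 2 ν :=
  (hf.congr_norm ((by fun_prop : Measurable fun x => exp (I * (θ x : ℂ))).aestronglyMeasurable.mul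
    hf.1)) (Filter.Eventually.of_forall fun x => by
      rw [Pi.mul_apply, norm_mul, norm_exp_I_mul, one_mul])

/-- Multiplication with `e^{iθ}` on `L²`. -/
def phaseL (ν : Measure α) (hθ : Measurable θ) : Lp ℂ 2 ν →L[ℂ] Lp ℂ 2 ν :=
  LinearMap.mkContinuous
    { toFun := fun f => (memLp_phase hθ (Lp.memLp f)).toLp _
      map_add' := fun f g => by
        rw [← MemLp.toLp_add, MemLp.toLp_eq_toLp_iff]
        filter_upwards [Lp.coeFn_add f g] with x hx
        rw [hx]; simp [mul_add]
      map_smul' := fun c f => by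
        rw [RingHom.id_apply, ← MemLp.toLp_const_smul, MemLp.toLp_eq_toLp_iff]
        filter_upwards [Lp.coeFn_smul c f] with x hx
        rw [hx]; simp [mul_left_comm] }
    1 fun f => by
      rw [one_mul, LinearMap.coe_mk, AddHom.coe_mk, Lp.norm_toLp, Lp.norm_def]
      refine le_of_eq (congrArg _ (eLpNorm_congr_norm_ae (Filter.Eventually.of_forall fun x => ?_)))
      rw [norm_mul, norm_exp_I_mul, one_mul]

lemma coeFn_phaseL (hθ : Measurable θ) (f : Lp ℂ 2 ν) :
    phaseL ν hθ f =ᵐ[ν] fun x => exp (I * (θ x : ℂ)) * f x :=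
  MemLp.coeFn_toLp (memLp_phase hθ (Lp.memLp f))

lemma phaseL_phaseL (hθ : Measurable θ) (hθ' : Measurable θ') (f : Lp ℂ 2 ν) :
    phaseL ν hθ (phaseL ν hθ' f) = phaseL ν (hθ.add hθ') f := by
  refine Lp.ext ?_
  filter_upwards [coeFn_phaseL hθ (phaseL ν hθ' f), coeFn_phaseL hθ' f,
    coeFn_phaseL (hθ.add hθ') f] with x h1 h2 h3
  rw [h1, h2, h3, ← mul_assoc, ← Complex.exp_add, Pi.add_apply]
  push_cast; ring_nf

lemma phaseL_eq_self (hθ : Measurable θ) (h : ∀ x, θ x = 0) (f : Lp ℂ 2 ν) :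
    phaseL ν hθ f = f := by
  refine Lp.ext ?_
  filter_upwards [coeFn_phaseL hθ f] with x h1
  simp [h1, h]

lemma inner_phaseL_right (hθ : Measurable θ) (f g : Lp ℂ 2 ν) :
    inner ℂ f (phaseL ν hθ g) = ∫ x, inner ℂ (f x) (g x) * exp (I * (θ x : ℂ)) ∂ν := by
  rw [L2.inner_def]
  refine integral_congr_ae ?_
  filter_upwards [coeFn_phaseL hθ g] with x h1
  rw [h1, RCLike.inner_apply, RCLike.inner_apply]
  ring

lemma inner_phaseL_left (hθ : Measurable θ) (hθ' : Measurable θ') (h : ∀ x, θ' x = -θ x)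
    (f g : Lp ℂ 2 ν) : inner ℂ (phaseL ν hθ' f) g = inner ℂ f (phaseL ν hθ g) := by
  rw [L2.inner_def, L2.inner_def]
  refine integral_congr_ae ?_
  filter_upwards [coeFn_phaseL hθ g, coeFn_phaseL hθ' f] with x h1 h2
  rw [h1, h2, RCLike.inner_apply, RCLike.inner_apply, map_mul, ← Complex.exp_conj, map_mul,
    Complex.conj_I, Complex.conj_ofReal, h]
  push_cast
  ring_nf

end phase

/-! ### Translations -/

section translations

variable {s : ℕ} {m : ℝ} {n : ℕ} {W : Multiplier s} (hW : W.IsSymmetric)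

lemma continuous_mink : Continuous fun z : Spacetime s × Spacetime s => mink z.1 z.2 := by
  unfold mink; fun_prop

lemma mink_add_right (p x y : Spacetime s) : mink p (x + y) = mink p x + mink p y := by
  simp only [mink, PiLp.add_apply, mul_add, Finset.sum_add_distrib]; ring

lemma mink_smul_right (c : ℝ) (p x : Spacetime s) : mink p (c • x) = c * mink p x := by
  simp only [mink, PiLp.smul_apply, smul_eq_mul, mul_sub, Finset.mul_sum, mul_left_comm]

lemma mink_neg_right (p x : Spacetime s) : mink p (-x) = -mink p x := by
  simpa using mink_smul_right (-1) p x

lemma mink_zero_right (p : Spacetime s) : mink p 0 = 0 := by simp [mink]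

lemma measurable_mink_left (x : Spacetime s) : Measurable fun p : Spacetime s => mink p x :=
  (continuous_mink.comp (continuous_id.prodMk continuous_const)).measurable

/-- `(p₁, …, pₙ) ↦ (p₁ + … + pₙ) · x`. -/
def totalPhase (x : Spacetime s) (p : Fin n → Spacetime s) : ℝ := ∑ k, mink (p k) x

lemma measurable_totalPhase (x : Spacetime s) :
    Measurable (totalPhase x : (Fin n → Spacetime s) → ℝ) :=
  Finset.measurable_fun_sum _ fun k _ => (measurable_mink_left x).comp (measurable_pi_apply k)

lemma totalPhase_add (x y : Spacetime s) (p : Fin n → Spacetime s) :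
    totalPhase (x + y) p = totalPhase x p + totalPhase y p := by
  simp only [totalPhase, mink_add_right, Finset.sum_add_distrib]

lemma totalPhase_smul (c : ℝ) (x : Spacetime s) (p : Fin n → Spacetime s) :
    totalPhase (c • x) p = c * totalPhase x p := by
  simp only [totalPhase, mink_smul_right, Finset.mul_sum]

lemma totalPhase_neg (x : Spacetime s) (p : Fin n → Spacetime s) :
    totalPhase (-x) p = -totalPhase x p := by
  simp only [totalPhase, mink_neg_right, Finset.sum_neg_distrib]

lemma totalPhase_zero (p : Fin n → Spacetime s) : totalPhase (0 : Spacetime s) p = 0 := by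
  simp [totalPhase, mink_zero_right]

lemma totalPhase_comp (x : Spacetime s) (p : Fin n → Spacetime s) (σ : Equiv.Perm (Fin n)) :
    totalPhase x (p ∘ σ) = totalPhase x p :=
  Equiv.sum_comp σ fun k => mink (p k) x

/-- Translations on the one-particle space. -/
def transOne (x : Spacetime s) : OneParticle s m →L[ℂ] OneParticle s m :=
  phaseL _ (measurable_mink_left x)

/-- Translations on `L²((ℝ^d)ⁿ)`. -/
def transLp (m : ℝ) (n : ℕ) (x : Spacetime s) :
    Lp ℂ 2 (shellPi s m n) →L[ℂ] Lp ℂ 2 (shellPi s m n) :=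
  phaseL _ (measurable_totalPhase x)

lemma permute_transLp (x : Spacetime s) (σ : Equiv.Perm (Fin n)) (Ψ : Lp ℂ 2 (shellPi s m n)) :
    permute s m σ (transLp m n x Ψ) = transLp m n x (permute s m σ Ψ) := by
  refine Lp.ext ?_
  filter_upwards [permute_congr (σ := σ) (coeFn_phaseL (measurable_totalPhase x) Ψ),
    coeFn_phaseL (measurable_totalPhase x) (permute s m σ Ψ), coeFn_permute σ Ψ] with p h1 h2 h3
  rw [transLp, h1, h2, h3, totalPhase_comp]

/-- Translations on the `n`-particle space. -/
def trans (m : ℝ) (x : Spacetime s) (n : ℕ) : nParticle s m n →L[ℂ] nParticle s m n :=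
  ((transLp m n x).comp (nParticle s m n).subtypeL).codRestrict (nParticle s m n) fun Ψ σ => by
    have h := Ψ.2 σ
    change permute s m σ (transLp m n x Ψ) = _ • transLp m n x Ψ
    rw [permute_transLp, h, map_smul]

lemma coe_trans (x : Spacetime s) (Ψ : nParticle s m n) :
    (trans m x n Ψ : Lp ℂ 2 (shellPi s m n)) = transLp m n x Ψ := rfl

lemma trans_trans (x y : Spacetime s) (Ψ : nParticle s m n) :
    trans m x n (trans m y n Ψ) = trans m (x + y) n Ψ := by
  refine Subtype.ext ?_
  rw [coe_trans, coe_trans, coe_trans, transLp, transLp, phaseL_phaseL, transLp]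
  congr 2
  exact funext fun p => (totalPhase_add x y p).symm

lemma trans_zero (Ψ : nParticle s m n) : trans m 0 n Ψ = Ψ :=
  Subtype.ext (phaseL_eq_self (measurable_totalPhase 0) totalPhase_zero _)

lemma inner_trans_left (x : Spacetime s) (Ψ Φ : nParticle s m n) :
    inner ℂ (trans m (-x) n Ψ) Φ = inner ℂ Ψ (trans m x n Φ) := by
  rw [Submodule.coe_inner, Submodule.coe_inner, coe_trans, coe_trans]
  exact inner_phaseL_left _ _ (totalPhase_neg x) _ _

lemma transLp_tensorL (W : Multiplier s) (x : Spacetime s) (g : OneParticle s m)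
    (Ψ : Lp ℂ 2 (shellPi s m n)) :
    transLp m (n + 1) x (tensorL W g Ψ) = tensorL W (transOne x g) (transLp m n x Ψ) := by
  refine Lp.ext ?_
  filter_upwards [coeFn_phaseL (measurable_totalPhase x) (tensorL W g Ψ), coeFn_tensorL W g Ψ,
    (coeFn_tensorL W (transOne x g) (transLp m n x Ψ)).trans (tensorFun_congr W
      (coeFn_phaseL (measurable_mink_left x) g) (coeFn_phaseL (measurable_totalPhase x) Ψ))]
    with p h1 h2 h3
  rw [transLp, h1, h2, h3]
  have h4 : totalPhase x p = mink (p 0) x + totalPhase x (Fin.tail p) := by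
    simp only [totalPhase, Fin.sum_univ_succ, Fin.tail]
  rw [h4]
  simp only [tensorFun]
  push_cast
  rw [mul_add, Complex.exp_add]
  ring

/-- Translations and the multiplier are both multiplication operators and commute, while the total
phase of `n + 1` particles is that of the created one plus that of the rest. The deformation thus
does not affect translation covariance. -/
lemma trans_cre (x : Spacetime s) (g : OneParticle s m) (Ψ : nParticle s m n) :
    trans m x (n + 1) (cre hW g n Ψ) = cre hW (transOne x g) n (trans m x n Ψ) := by
  refine Subtype.ext ?_
  rw [coe_trans, cre, cre, coe_creL, coe_creL, coe_trans, creationSum, creationSum, map_smul,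
    map_sum]
  congr 1
  refine Finset.sum_congr rfl fun k _ => ?_
  rw [map_smul, ← permute_transLp, transLp_tensorL]

lemma transOne_transOne (x y : Spacetime s) (g : OneParticle s m) :
    transOne x (transOne y g) = transOne (x + y) g := by
  rw [transOne, transOne, phaseL_phaseL, transOne]
  congr 2
  exact funext fun p => (mink_add_right p x y).symm

lemma transOne_zero (g : OneParticle s m) : transOne 0 g = g :=
  phaseL_eq_self _ mink_zero_right _

lemma adjoint_intertwine {E F : Type*} [NormedAddCommGroup E] [InnerProductSpace ℂ E]
    [CompleteSpace E] [NormedAddCommGroup F] [InnerProductSpace ℂ F] [CompleteSpace F]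
    {T T' : E →L[ℂ] E} {S S' : F →L[ℂ] F} {C C' : E →L[ℂ] F}
    (hT : ∀ v w, inner ℂ (T' v) w = inner ℂ v (T w))
    (hS : ∀ v w, inner ℂ (S' v) w = inner ℂ v (S w)) (h : ∀ v, S' (C' v) = C (T' v)) (Φ : F) :
    T (C.adjoint Φ) = C'.adjoint (S Φ) := by
  refine ext_inner_left ℂ fun v => ?_
  rw [← hT, ContinuousLinearMap.adjoint_inner_right, ContinuousLinearMap.adjoint_inner_right,
    ← hS, h]

lemma trans_cre_adjoint (x : Spacetime s) (g : OneParticle s m) (Φ : nParticle s m (n + 1)) :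
    trans m x n ((cre hW g n).adjoint Φ) =
      (cre hW (transOne x g) n).adjoint (trans m x (n + 1) Φ) :=
  adjoint_intertwine (T := trans m x n) (T' := trans m (-x) n) (S := trans m x (n + 1))
    (S' := trans m (-x) (n + 1)) (C := cre hW g n) (C' := cre hW (transOne x g) n)
    (fun v w => inner_trans_left x v w) (fun v w => inner_trans_left x v w) (fun v => by
    have h := trans_cre hW (-x) (transOne x g) v
    have h2 : transOne (-x) (transOne x g) = g := by
      rw [transOne_transOne, neg_add_cancel, transOne_zero]
    exact h.trans (by rw [h2])) Φ

lemma IsFinite.map {G : ℕ → Type*} [∀ n, NormedAddCommGroup (G n)]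
    [∀ n, InnerProductSpace ℂ (G n)] {χ : ∀ n, G n} (hχ : IsFinite χ)
    (T : ∀ n, G n →L[ℂ] G n) : IsFinite fun n => T n (χ n) :=
  let ⟨N, hN⟩ := hχ
  ⟨N, fun n hn => (congrArg (T n) (hN n hn)).trans (T n).map_zero⟩

/-- Translations on sequences of `n`-particle vectors. -/
def transSeq (x : Spacetime s) (χ : ParticleSeq s m) : ParticleSeq s m := fun n => trans m x n (χ n)

lemma transSeq_transSeq (x y : Spacetime s) (χ : ParticleSeq s m) :
    transSeq x (transSeq y χ) = transSeq (x + y) χ :=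
  funext fun n => trans_trans x y (χ n)

lemma transSeq_zero (χ : ParticleSeq s m) : transSeq 0 χ = χ := funext fun n => trans_zero (χ n)

lemma IsFinite.transSeq {χ : ParticleSeq s m} (hχ : IsFinite χ) (x : Spacetime s) :
    IsFinite (transSeq x χ) := hχ.map (trans m x)

/-- The action of `a*(g) + a(h)` on sequences. -/
def fieldSeq (g h : OneParticle s m) (χ : ParticleSeq s m) : ParticleSeq s m :=
  raise (cre hW g) χ + lower (cre hW h) χ

lemma IsFinite.fieldSeq {χ : ParticleSeq s m} (hχ : IsFinite χ) (g h : OneParticle s m) :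
    IsFinite (fieldSeq hW g h χ) := hχ.raise.add hχ.lower

lemma transSeq_fieldSeq (x : Spacetime s) (g h : OneParticle s m) (χ : ParticleSeq s m) :
    transSeq x (fieldSeq hW g h χ) = fieldSeq hW (transOne x g) (transOne x h) (transSeq x χ) := by
  ext1 n
  have e1 : trans m x n (raise (cre hW g) χ n) =
      raise (cre hW (transOne x g)) (transSeq x χ) n := by
    cases n with
    | zero => exact (trans m x 0).map_zero
    | succ n => exact trans_cre hW x g (χ n)
  have e2 : trans m x n (lower (cre hW h) χ n) =
      lower (cre hW (transOne x h)) (transSeq x χ) n := trans_cre_adjoint hW x h (χ (n + 1))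
  exact ((trans m x n).map_add _ _).trans (congrArg₂ (· + ·) e1 e2)

lemma bracket_fieldSeq (g h : OneParticle s m) (χ : ParticleSeq s m) {η : ParticleSeq s m}
    (hη : IsFinite η) : bracket χ (fieldSeq hW g h η) = bracket (fieldSeq hW h g χ) η := by
  have h1 := congrArg conj (bracket_field (C := cre hW h) (C' := cre hW g) hη χ)
  rw [bracket_conj, bracket_conj] at h1
  exact h1

lemma transSeq_vacuum (x : Spacetime s) :
    transSeq x (⇑(vacuum s m) : ParticleSeq s m) = ⇑(vacuum s m) := by
  ext1 n
  cases n with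
  | zero =>
    exact Subtype.ext (phaseL_eq_self (measurable_totalPhase x) (fun p => Fintype.sum_empty _) _)
  | succ n =>
    exact ((congrArg (trans m x (n + 1)) (vacuum_succ s m n)).trans
      (trans m x (n + 1)).map_zero).trans (vacuum_succ s m n).symm

/-- `f⁻` is evaluated at `-p` and so picks up the opposite phase under translation. Conjugation
restores it: both smearing functions of a translated field are moved by the same `transOne x`. -/
lemma star_transOne (x : Spacetime s) (g : OneParticle s m) :
    star (transOne (-x) g) = transOne x (star g) := by
  refine Lp.ext ?_
  filter_upwards [coeFn_phaseL (measurable_mink_left x) (star g),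
    coeFn_phaseL (measurable_mink_left (-x)) g, Lp.coeFn_star g,
    Lp.coeFn_star (transOne (-x) g)] with p h1 h2 h3 h4
  rw [h4, Pi.star_apply, transOne, transOne, h1, h2, h3, Pi.star_apply, mink_neg_right, star_mul,
    mul_comm, star_def, ← Complex.exp_conj, map_mul, Complex.conj_I, Complex.conj_ofReal]
  push_cast
  ring_nf

/-- Translation of test functions. -/
def translate (x : Spacetime s) (f : 𝓢(Spacetime s, ℂ)) : 𝓢(Spacetime s, ℂ) :=
  f.compSubConstCLM ℂ x

lemma translate_apply (x : Spacetime s) (f : 𝓢(Spacetime s, ℂ)) (y : Spacetime s) :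
    translate x f y = f (y - x) := rfl

lemma minkFourier_translate (x : Spacetime s) (f : 𝓢(Spacetime s, ℂ)) (p : Spacetime s) :
    minkFourier (translate x f) p = exp (I * (mink p x : ℂ)) * minkFourier f p := by
  rw [minkFourier, minkFourier, ← integral_const_mul,
    ← integral_add_right_eq_self (fun y => translate x f y * exp (I * (mink p y : ℂ))) x]
  refine integral_congr_ae (Filter.Eventually.of_forall fun y => ?_)
  simp only [translate_apply, add_sub_cancel_right, mink_add_right]
  push_cast
  rw [mul_add, Complex.exp_add]
  ring

lemma fPlus_translate (hm : 0 < m) (x : Spacetime s) (f : 𝓢(Spacetime s, ℂ)) :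
    fPlus hm (translate x f) = transOne x (fPlus hm f) := by
  refine Lp.ext ?_
  filter_upwards [coeFn_fPlus hm (translate x f), coeFn_fPlus hm f,
    coeFn_phaseL (measurable_mink_left x) (fPlus hm f)] with p h1 h2 h3
  rw [h1, transOne, h3, h2, minkFourier_translate]

lemma fMinus_translate (hm : 0 < m) (x : Spacetime s) (f : 𝓢(Spacetime s, ℂ)) :
    fMinus hm (translate x f) = transOne (-x) (fMinus hm f) := by
  refine Lp.ext ?_
  filter_upwards [coeFn_fMinus hm (translate x f), coeFn_fMinus hm f,
    coeFn_phaseL (measurable_mink_left (-x)) (fMinus hm f)] with p h1 h2 h3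
  rw [h1, transOne, h3, h2, minkFourier_translate, mink_neg_left, mink_neg_right]

end translations

end ScalarFermion

end

noncomputable section

namespace ScalarFermion

/-! ### Consequences of the spectrum condition -/

section spectrum

variable {s : ℕ} {m : ℝ}

lemma norm_le_energy (m : ℝ) (p : EuclideanSpace ℝ (Fin s)) : ‖p‖ ≤ energy m p :=
  Real.le_sqrt_of_sq_le (by nlinarith [sq_nonneg m])

lemma energy_nonneg (m : ℝ) (p : EuclideanSpace ℝ (Fin s)) : 0 ≤ energy m p := Real.sqrt_nonneg _

lemma mink_shellPoint_eq (m : ℝ) (p : EuclideanSpace ℝ (Fin s)) (x : Spacetime s) :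
    mink (shellPoint m p) x =
      energy m p * x 0 - inner ℝ (WithLp.toLp 2 fun i : Fin s => x i.succ) p := by
  simp [mink, shellPoint, PiLp.inner_apply]

lemma norm_spatial_le (x : Spacetime s) :
    ‖(WithLp.toLp 2 fun i : Fin s => x i.succ : EuclideanSpace ℝ (Fin s))‖ ≤ ‖x‖ := by
  rw [EuclideanSpace.norm_eq, EuclideanSpace.norm_eq, Fin.sum_univ_succ]
  exact Real.sqrt_le_sqrt (le_add_of_nonneg_left (sq_nonneg _))

/-- Time and space parts contribute `ω ‖x‖` each, because `‖𝐩‖ ≤ ω(𝐩)`. The factor `2` reappears in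
the choice of a future directed vector and of the size of bump functions. -/
lemma abs_mink_shellPoint_le (m : ℝ) (p : EuclideanSpace ℝ (Fin s)) (x : Spacetime s) :
    |mink (shellPoint m p) x| ≤ 2 * energy m p * ‖x‖ := by
  rw [mink_shellPoint_eq]
  have h0 : |x 0| ≤ ‖x‖ := PiLp.norm_apply_le x 0
  have h1 := abs_real_inner_le_norm (WithLp.toLp 2 fun i : Fin s => x i.succ) p
  have h2 : ‖(WithLp.toLp 2 fun i : Fin s => x i.succ : EuclideanSpace ℝ (Fin s))‖ * ‖p‖ ≤
      ‖x‖ * energy m p :=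
    mul_le_mul (norm_spatial_le x) (norm_le_energy m p) (norm_nonneg _) (norm_nonneg _)
  have h3 : |energy m p * x 0| ≤ energy m p * ‖x‖ := by
    rw [abs_mul, abs_of_nonneg (energy_nonneg m p)]
    exact mul_le_mul_of_nonneg_left h0 (energy_nonneg m p)
  calc _ ≤ |energy m p * x 0| + |inner ℝ (WithLp.toLp 2 fun i : Fin s => x i.succ) p| :=
        abs_sub _ _
    _ ≤ _ := by linarith

lemma totalPhase_nonneg {e : Spacetime s}
    (he : ∀ p : EuclideanSpace ℝ (Fin s), 0 ≤ mink (shellPoint m p) e) (n : ℕ) :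
    ∀ᵐ p ∂(shellPi s m n), 0 ≤ totalPhase e p := by
  have h : ∀ k : Fin n, ∀ᵐ p ∂(shellPi s m n), 0 ≤ mink (p k) e := fun k =>
    (Measure.quasiMeasurePreserving_eval (fun _ : Fin n => shellMeasure s m) k).ae
      (p := fun q => 0 ≤ mink q e) (ae_shellMeasure_of_forall he)
  filter_upwards [ae_all_iff.2 h] with p hp
  exact Finset.sum_nonneg fun k _ => hp k

lemma inner_trans_right (x : Spacetime s) {n : ℕ} (Ψ Φ : nParticle s m n) :
    inner ℂ Ψ (trans m x n Φ) = ∫ p, inner ℂ ((Ψ : Lp ℂ 2 (shellPi s m n)) p)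
      ((Φ : Lp ℂ 2 (shellPi s m n)) p) * exp (I * (totalPhase x p : ℂ)) ∂(shellPi s m n) := by
  rw [Submodule.coe_inner, coe_trans]
  exact inner_phaseL_right _ _ _

lemma bracket_eq_sum {G : ℕ → Type*} [∀ n, NormedAddCommGroup (G n)]
    [∀ n, InnerProductSpace ℂ (G n)] (χ : ∀ n, G n) {η : ∀ n, G n} {N : ℕ}
    (hN : ∀ n, N < n → η n = 0) :
    bracket χ η = ∑ n ∈ Finset.range (N + 1), inner ℂ (χ n) (η n) :=
  tsum_eq_sum fun n hn => by
    rw [hN n (Nat.lt_of_succ_le (not_lt.1 fun h => hn (Finset.mem_range.2 h))), inner_zero_right]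

/-- Matrix elements of translations in a future directed direction vanish identically if they
vanish on an interval. -/
lemma bracket_transSeq_smul_eq_zero {e : Spacetime s}
    (he : ∀ p : EuclideanSpace ℝ (Fin s), 0 ≤ mink (shellPoint m p) e) (χ : ParticleSeq s m)
    {η : ParticleSeq s m} (hη : IsFinite η) {δ : ℝ} (hδ : 0 < δ)
    (h : ∀ t : ℝ, |t| < δ → bracket χ (transSeq (t • e) η) = 0) (t : ℝ) :
    bracket χ (transSeq (t • e) η) = 0 := by
  obtain ⟨N, hN⟩ := hη
  have hN' : ∀ x n, N < n → transSeq x η n = 0 := fun x n hn =>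
    (congrArg (trans m x n) (hN n hn)).trans (trans m x n).map_zero
  -- Replacing the parameter `t` by `z` gives the analytic continuation, which exists in the upper
  -- half plane since the total phase along `e` is nonnegative.
  let F : ℂ → ℂ := fun z => ∑ n ∈ Finset.range (N + 1), ∫ p,
    inner ℂ ((χ n : Lp ℂ 2 (shellPi s m n)) p) ((η n : Lp ℂ 2 (shellPi s m n)) p) *
      exp (I * z * (totalPhase e p : ℂ)) ∂(shellPi s m n)
  have hF : ∀ t : ℝ, F t = bracket χ (transSeq (t • e) η) := fun t => by
    rw [bracket_eq_sum χ (hN' _)]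
    refine Finset.sum_congr rfl fun n _ => ((inner_trans_right (t • e) (χ n) (η n)).trans ?_).symm
    refine integral_congr_ae (Filter.Eventually.of_forall fun p => ?_)
    simp only [totalPhase_smul]
    push_cast
    rw [mul_assoc]
  have hL := fun n => laplace_extension
    (L2.integrable_inner (𝕜 := ℂ) (χ n : Lp ℂ 2 (shellPi s m n)) (η n : Lp ℂ 2 (shellPi s m n)))
    (measurable_totalPhase e) (totalPhase_nonneg he n)
  rw [← hF]
  refine eq_zero_of_real_interval (h := F) ?_ ?_ hδ (fun t ht => (hF t).trans (h t ht)) t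
  · exact DifferentiableOn.fun_sum fun n _ => (hL n).1
  · exact continuousOn_finsetSum _ fun n _ => (hL n).2

/-- Matrix elements of translations vanish identically if they vanish near the origin. -/
lemma bracket_transSeq_eq_zero (χ : ParticleSeq s m) {η : ParticleSeq s m} (hη : IsFinite η)
    {δ : ℝ} (hδ : 0 < δ) (h : ∀ x : Spacetime s, ‖x‖ < δ → bracket χ (transSeq x η) = 0)
    (x : Spacetime s) : bracket χ (transSeq x η) = 0 := by
  set e₀ : Spacetime s := EuclideanSpace.single 0 1 with he₀
  have hn : ‖e₀‖ = 1 := by simp [he₀]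
  have hp0 : ∀ p : EuclideanSpace ℝ (Fin s), mink (shellPoint m p) e₀ = energy m p := fun p => by
    rw [he₀, mink_single_zero]; rfl
  -- Continuation in the time direction extends the vanishing from the ball to the full cylinder of
  -- radius `δ/2` around the time axis.
  have h1 : ∀ b : Spacetime s, ‖b‖ < δ / 2 → ∀ t : ℝ,
      bracket χ (transSeq (b + t • e₀) η) = 0 := by
    intro b hb t
    have := bracket_transSeq_smul_eq_zero (e := e₀) (fun p => (hp0 p).symm ▸ energy_nonneg m p) χ
      (hη.transSeq b) (half_pos hδ) (fun t ht => ?_) t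
    · rwa [transSeq_transSeq, add_comm (t • e₀) b] at this
    · rw [transSeq_transSeq]
      refine h _ ((norm_add_le _ _).trans_lt ?_)
      rw [norm_smul, hn, Real.norm_eq_abs]
      linarith
  -- Adding `2‖x‖` units of time makes `e₁` nonnegative on the mass shell, as `|p·x| ≤ 2 ω ‖x‖`. The
  -- line `t ↦ t e₁ - 2‖x‖ e₀` lies in the cylinder for small `t` and reaches `x` at `t = 1`.
  set e₁ : Spacetime s := x + (2 * ‖x‖) • e₀ with he₁
  have hp1 : ∀ p : EuclideanSpace ℝ (Fin s), 0 ≤ mink (shellPoint m p) e₁ := fun p => by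
    rw [he₁, mink_add_right, mink_smul_right, hp0]
    have := abs_le.1 (abs_mink_shellPoint_le m p x)
    linarith [this.1]
  have hδ' : 0 < δ / 2 / (‖e₁‖ + 1) := by positivity
  have h2 := bracket_transSeq_smul_eq_zero hp1 χ (hη.transSeq (-(2 * ‖x‖) • e₀)) hδ'
    (fun t ht => ?_) 1
  · rw [transSeq_transSeq, he₁] at h2
    have hx : (1 : ℝ) • (x + (2 * ‖x‖) • e₀) + -(2 * ‖x‖) • e₀ = x := by
      rw [one_smul, neg_smul, add_neg_cancel_right]
    rwa [hx] at h2
  · rw [transSeq_transSeq]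
    refine h1 _ ?_ _
    rw [norm_smul, Real.norm_eq_abs]
    rw [lt_div_iff₀ (by positivity)] at ht
    nlinarith [abs_nonneg t]

end spectrum

end ScalarFermion

end

noncomputable section

namespace ScalarFermion

/-! ### Density in the one-particle space -/

section oneParticle

variable {s : ℕ} {m : ℝ}

lemma energy_pos (hm : 0 < m) (p : EuclideanSpace ℝ (Fin s)) : 0 < energy m p :=
  Real.sqrt_pos.2 (by positivity)

lemma energy_neg (m : ℝ) (p : EuclideanSpace ℝ (Fin s)) : energy m (-p) = energy m p := by
  rw [energy, energy, norm_neg]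

lemma measurable_ofReal_energy_inv (m : ℝ) :
    Measurable fun p : EuclideanSpace ℝ (Fin s) => ENNReal.ofReal (energy m p)⁻¹ :=
  (continuous_energy m).measurable.inv.ennreal_ofReal

lemma toReal_energy_inv (m : ℝ) (p : EuclideanSpace ℝ (Fin s)) :
    (ENNReal.ofReal (energy m p)⁻¹).toReal = (energy m p)⁻¹ :=
  ENNReal.toReal_ofReal (inv_nonneg.2 (energy_nonneg m p))

lemma integral_shellMeasure (F : Spacetime s → ℂ) :
    ∫ p, F p ∂(shellMeasure s m) =
      ∫ p : EuclideanSpace ℝ (Fin s), ((energy m p)⁻¹ : ℝ) • F (shellPoint m p) := by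
  rw [shellMeasure, (measurableEmbedding_shellPoint m).integral_map,
    integral_withDensity_eq_integral_toReal_smul (measurable_ofReal_energy_inv m)
      (Filter.Eventually.of_forall fun _ => ENNReal.ofReal_lt_top)]
  simp only [toReal_energy_inv]

lemma integrable_shellMeasure_iff {F : Spacetime s → ℂ} :
    Integrable F (shellMeasure s m) ↔ Integrable fun p : EuclideanSpace ℝ (Fin s) =>
      ((energy m p)⁻¹ : ℝ) • F (shellPoint m p) := by
  rw [shellMeasure, (measurableEmbedding_shellPoint m).integrable_map_iff,
    integrable_withDensity_iff_integrable_smul' (measurable_ofReal_energy_inv m)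
      (Filter.Eventually.of_forall fun _ => ENNReal.ofReal_lt_top)]
  simp only [toReal_energy_inv, Function.comp_apply]

lemma ae_shellMeasure_of_ae {P : Spacetime s → Prop}
    (h : ∀ᵐ p : EuclideanSpace ℝ (Fin s), P (shellPoint m p)) :
    ∀ᵐ p ∂(shellMeasure s m), P p := by
  rw [shellMeasure, (measurableEmbedding_shellPoint m).ae_map_iff]
  exact (withDensity_absolutelyContinuous _ _).ae_le h

lemma ae_of_ae_shellMeasure (hm : 0 < m) {P : Spacetime s → Prop}
    (h : ∀ᵐ p ∂(shellMeasure s m), P p) :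
    ∀ᵐ p : EuclideanSpace ℝ (Fin s), P (shellPoint m p) := by
  rw [shellMeasure, (measurableEmbedding_shellPoint m).ae_map_iff,
    ae_withDensity_iff (measurable_ofReal_energy_inv m)] at h
  filter_upwards [h] with p hp
  exact hp (ENNReal.ofReal_pos.2 (inv_pos.2 (energy_pos hm p))).ne'

lemma integrable_mul_phase {V : Type*} [MeasurableSpace V] {ν : Measure V} {A : V → ℂ}
    (hA : Integrable A ν) {θ : V → ℝ} (hθ : Measurable θ) :
    Integrable (fun p => A p * exp (I * (θ p : ℂ))) ν :=
  hA.mul_bdd (c := 1) (by fun_prop) (Filter.Eventually.of_forall fun p => (norm_exp_I_mul _).le)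

/-- A superposition of waves of positive frequency with amplitude `A` and waves of negative
frequency with amplitude `B` vanishes only if `A = 0`. -/
lemma ae_eq_zero_of_superposition (hm : 0 < m) {A B : EuclideanSpace ℝ (Fin s) → ℂ}
    (hA : Integrable A) (hB : Integrable B)
    (h : ∀ (t : ℝ) (y : EuclideanSpace ℝ (Fin s)),
      (∫ p, A p * exp (I * ((energy m p * t - inner ℝ y p : ℝ) : ℂ))) +
        ∫ p, B p * exp (I * ((-(energy m p * t - inner ℝ y p) : ℝ) : ℂ)) = 0) :
    A =ᵐ[volume] 0 := by
  have hE : Measurable (energy m : EuclideanSpace ℝ (Fin s) → ℝ) := (continuous_energy m).measurable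
  -- At fixed time, after `p ↦ -p` in the second integral, the hypothesis says that the spatial
  -- Fourier transform of this function vanishes; `y = 2πw` matches the normalization of `𝓕`.
  have hc : ∀ t : ℝ, ∀ᵐ p : EuclideanSpace ℝ (Fin s),
      A p * exp (I * ((energy m p * t : ℝ) : ℂ)) +
        B (-p) * exp (I * ((-(energy m p * t) : ℝ) : ℂ)) = 0 := by
    intro t
    have i1 := integrable_mul_phase hA (θ := fun p => energy m p * t) (by fun_prop)
    have i2 := integrable_mul_phase hB.comp_neg (θ := fun p => -(energy m p * t)) (by fun_prop)
    refine ae_eq_zero_of_fourier_eq_zero (i1.add i2) fun w => ?_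
    rw [← h t ((2 * Real.pi) • w), Real.fourier_eq',
      ← integral_neg_eq_self (fun p => B p * exp (I * ((-(energy m p * t -
        inner ℝ ((2 * Real.pi) • w) p) : ℝ) : ℂ))),
      ← integral_add (integrable_mul_phase hA (θ := fun p => energy m p * t -
        inner ℝ ((2 * Real.pi) • w) p) (by fun_prop))
        (integrable_mul_phase hB (θ := fun p => -(energy m p * t -
          inner ℝ ((2 * Real.pi) • w) p)) (by fun_prop)).comp_neg]
    refine integral_congr_ae (Filter.Eventually.of_forall fun p => ?_)
    simp only [smul_eq_mul, energy_neg, inner_smul_left, inner_neg_right,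
      conj_trivial, real_inner_comm w p]
    rw [mul_add, mul_left_comm, mul_left_comm _ (B (-p)), ← Complex.exp_add, ← Complex.exp_add]
    push_cast
    ring_nf
  have h0 := hc 0
  -- Time `0` gives `B(-p) = -A(p)`, and a second time `t` then gives `A(p) sin(ω t) = 0`. As `ω` is
  -- unbounded, `t` must depend on `p` to ensure `0 < ω t < π`; the countable choice `1/(k+1)` keeps
  -- the exceptional set null.
  have h1 : ∀ᵐ p : EuclideanSpace ℝ (Fin s), ∀ k : ℕ, _ :=
    ae_all_iff.2 fun k : ℕ => hc ((k : ℝ) + 1)⁻¹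
  filter_upwards [h0, h1] with p hp0 hp1
  obtain ⟨k, hk⟩ := exists_nat_gt (energy m p)
  have hk1 : (0 : ℝ) < k + 1 := by positivity
  set θ : ℝ := energy m p * ((k : ℝ) + 1)⁻¹ with hθ
  have hθ0 : 0 < θ := mul_pos (energy_pos hm p) (inv_pos.2 hk1)
  have hθ1 : θ < Real.pi := by
    have : θ < 1 := by rw [hθ, ← div_eq_mul_inv, div_lt_one hk1]; linarith
    linarith [Real.pi_gt_three]
  have hs := Real.sin_pos_of_pos_of_lt_pi hθ0 hθ1
  have e0 : B (-p) = -A p := by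
    simp only [mul_zero, ofReal_zero, neg_zero, Complex.exp_zero, mul_one] at hp0
    linear_combination hp0
  have e1 := hp1 k
  rw [← hθ, e0] at e1
  have e2 : A p * (2 * I * (Real.sin θ : ℂ)) = 0 := by
    rw [← e1, Complex.ofReal_sin, mul_comm I, mul_comm I, Complex.exp_mul_I, Complex.exp_mul_I]
    push_cast
    rw [Complex.cos_neg, Complex.sin_neg]
    ring
  rcases mul_eq_zero.1 e2 with h | h
  · exact h
  · have hsin : ((Real.sin θ : ℝ) : ℂ) ≠ 0 := Complex.ofReal_ne_zero.2 hs.ne'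
    exact absurd h (mul_ne_zero (mul_ne_zero two_ne_zero I_ne_zero) hsin)

/-- Test functions with compact support in `O`. -/
def IsLocalTest (O : Set (Spacetime s)) (f : 𝓢(Spacetime s, ℂ)) : Prop :=
  HasCompactSupport f ∧ tsupport f ⊆ O

lemma hasCompactSupport_translate {f : 𝓢(Spacetime s, ℂ)} (hf : HasCompactSupport f)
    (x : Spacetime s) : HasCompactSupport (translate x f) :=
  hf.comp_homeomorph (Homeomorph.subRight x)

lemma tsupport_translate_subset (f : 𝓢(Spacetime s, ℂ)) (x : Spacetime s) :
    tsupport (translate x f) ⊆ {y | y - x ∈ tsupport f} :=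
  tsupport_comp_subset_preimage f (f := fun y => y - x) (by fun_prop)

lemma IsLocalTest.exists_translate {O : Set (Spacetime s)} (hO : IsOpen O)
    {f : 𝓢(Spacetime s, ℂ)} (hf : IsLocalTest O f) :
    ∃ δ > 0, ∀ x : Spacetime s, ‖x‖ < δ → IsLocalTest O (translate x f) := by
  obtain ⟨δ, hδ, h⟩ := IsCompact.exists_thickening_subset_open hf.1 hO hf.2
  refine ⟨δ, hδ, fun x hx => ⟨hasCompactSupport_translate hf.1 x, fun y hy => h ?_⟩⟩
  refine Metric.mem_thickening_iff.2 ⟨y - x, tsupport_translate_subset f x hy, ?_⟩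
  simpa [dist_eq_norm] using hx

lemma exists_bump {ρ : ℝ} (hρ : 0 < ρ) : ∃ (b : Spacetime s → ℝ) (g : 𝓢(Spacetime s, ℂ)),
    (∀ x, g x = (b x : ℂ)) ∧ HasCompactSupport g ∧ Integrable b ∧ 0 < ∫ x, b x ∧ (∀ x, 0 ≤ b x) ∧
      ∀ x, ρ ≤ ‖x‖ → b x = 0 := by
  obtain ⟨b, hb⟩ : ∃ b : ContDiffBump (0 : Spacetime s), b.rOut = ρ :=
    ⟨⟨ρ / 2, ρ, half_pos hρ, half_lt_self hρ⟩, rfl⟩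
  have hbs : HasCompactSupport fun x => ((b x : ℝ) : ℂ) :=
    b.hasCompactSupport.comp_left (g := fun t : ℝ => (t : ℂ)) Complex.ofReal_zero
  have hbd : ContDiff ℝ (⊤ : ℕ∞) fun x => ((b x : ℝ) : ℂ) :=
    Complex.ofRealCLM.contDiff.comp b.contDiff
  exact ⟨b, hbs.toSchwartzMap hbd, fun x => rfl, hbs, b.integrable, b.integral_pos,
    fun x => b.nonneg, fun x hx => b.zero_of_le_dist (by rwa [hb, dist_zero_right])⟩

/-- On the support of `b` the phase is at most `1/2`, so the exponential differs from `1` by at most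
`1/2`. The integral therefore differs from `∫ b` by at most half of it. -/
lemma minkFourier_ne_zero_of_bump {b : Spacetime s → ℝ} {g : 𝓢(Spacetime s, ℂ)}
    (hg : ∀ x, g x = (b x : ℂ)) (hbi : Integrable b) (hb0 : 0 < ∫ x, b x) (hb : ∀ x, 0 ≤ b x)
    {ρ : ℝ} (hρ : ∀ x, ρ ≤ ‖x‖ → b x = 0) {p : EuclideanSpace ℝ (Fin s)}
    (hp : 2 * energy m p * ρ ≤ 2⁻¹) : minkFourier g (shellPoint m p) ≠ 0 := by
  intro h
  have hgi : Integrable fun x => ((b x : ℝ) : ℂ) := hbi.ofReal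
  have hθ : Measurable fun x : Spacetime s => mink (shellPoint m p) x :=
    (continuous_mink.comp (continuous_const.prodMk continuous_id)).measurable
  have e1 : ∫ x, ((b x : ℝ) : ℂ) * (exp (I * (mink (shellPoint m p) x : ℂ)) - 1) =
      -((∫ x, b x : ℝ) : ℂ) := by
    simp only [minkFourier, hg] at h
    simp only [mul_sub, mul_one]
    rw [integral_sub (integrable_mul_phase hgi hθ) hgi, integral_complex_ofReal, h, zero_sub]
  have e2 : ‖∫ x, ((b x : ℝ) : ℂ) * (exp (I * (mink (shellPoint m p) x : ℂ)) - 1)‖ ≤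
      ∫ x, b x * 2⁻¹ := by
    refine norm_integral_le_of_norm_le (hbi.mul_const _) (Filter.Eventually.of_forall fun x => ?_)
    rw [norm_mul, Complex.norm_real, Real.norm_of_nonneg (hb x)]
    rcases le_or_gt ρ ‖x‖ with hx | hx
    · rw [hρ x hx, zero_mul, zero_mul]
    · refine mul_le_mul_of_nonneg_left ?_ (hb x)
      refine Real.norm_exp_I_mul_ofReal_sub_one_le.trans ?_
      refine (abs_mink_shellPoint_le m p x).trans (le_trans ?_ hp)
      exact mul_le_mul_of_nonneg_left hx.le (mul_nonneg zero_le_two (energy_nonneg m p))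
  rw [e1, norm_neg, Complex.norm_real, Real.norm_of_nonneg hb0.le, integral_mul_const] at e2
  linarith

/-- There are local test functions whose Fourier transform has no zeros on a given bounded part
of the mass shell. -/
lemma exists_isLocalTest_minkFourier_ne_zero {O : Set (Spacetime s)} (hO : IsOpen O)
    (hne : O.Nonempty) (m E : ℝ) : ∃ f : 𝓢(Spacetime s, ℂ), IsLocalTest O f ∧
      ∀ p : EuclideanSpace ℝ (Fin s), energy m p ≤ E → minkFourier f (shellPoint m p) ≠ 0 := by
  obtain ⟨x₀, hx₀⟩ := hne
  obtain ⟨r, hr, hrO⟩ := Metric.isOpen_iff.1 hO x₀ hx₀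
  obtain ⟨ρ, hρ0, hρr, hρE⟩ : ∃ ρ : ℝ, 0 < ρ ∧ ρ < r ∧ 2 * |E| * ρ ≤ 2⁻¹ := by
    -- The first bound keeps the support in `O`, the second keeps the phases of momenta with energy
    -- up to `E` below `1/2`; the summand `1` covers `E = 0`.
    refine ⟨min (r / 2) (4 * (|E| + 1))⁻¹, lt_min (half_pos hr) (by positivity),
      (min_le_left _ _).trans_lt (half_lt_self hr), ?_⟩
    have h : min (r / 2) (4 * (|E| + 1))⁻¹ ≤ (4 * (|E| + 1))⁻¹ := min_le_right _ _
    have h2 : (4 * (|E| + 1)) * (4 * (|E| + 1))⁻¹ = 1 := mul_inv_cancel₀ (by positivity)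
    have h3 : 0 ≤ (4 * (|E| + 1))⁻¹ := by positivity
    nlinarith [mul_le_mul_of_nonneg_left h (abs_nonneg E)]
  obtain ⟨b, g, hg, hgs, hbi, hb0, hb, hbρ⟩ := exists_bump (s := s) hρ0
  have hts : tsupport g ⊆ Metric.closedBall 0 ρ :=
    closure_minimal (fun x hx => by
      rw [mem_closedBall_zero_iff]
      by_contra hlt
      exact hx (by rw [hg, hbρ x (not_le.1 hlt).le, Complex.ofReal_zero])) Metric.isClosed_closedBall
  refine ⟨translate x₀ g, ⟨hasCompactSupport_translate hgs x₀, fun y hy => hrO ?_⟩,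
    fun p hp => ?_⟩
  · have := hts (tsupport_translate_subset g x₀ hy)
    rw [mem_closedBall_zero_iff] at this
    rw [Metric.mem_ball, dist_eq_norm]
    exact this.trans_lt hρr
  · rw [minkFourier_translate]
    refine mul_ne_zero (Complex.exp_ne_zero _)
      (minkFourier_ne_zero_of_bump hg hbi hb0 hb hbρ (le_trans ?_ hρE))
    exact mul_le_mul_of_nonneg_right
      (mul_le_mul_of_nonneg_left (hp.trans (le_abs_self E)) zero_le_two) hρ0.le

lemma inner_transOne_eq (x : Spacetime s) (G g : OneParticle s m) :
    inner ℂ G (transOne x g) = ∫ p : EuclideanSpace ℝ (Fin s),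
      (((energy m p)⁻¹ : ℝ) • inner ℂ (G (shellPoint m p)) (g (shellPoint m p))) *
        exp (I * (mink (shellPoint m p) x : ℂ)) := by
  rw [transOne, inner_phaseL_right, integral_shellMeasure]
  simp only [smul_mul_assoc]

/-- Already the positive frequency parts of the local test functions, together with their
translates, suffice to separate the vectors of the one-particle space. -/
lemma eq_zero_of_inner_transOne_add (hm : 0 < m) {O : Set (Spacetime s)} (hO : IsOpen O)
    (hne : O.Nonempty) {G K : OneParticle s m}
    (h : ∀ f : 𝓢(Spacetime s, ℂ), IsLocalTest O f → ∀ x : Spacetime s,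
      inner ℂ G (transOne x (fPlus hm f)) + inner ℂ K (transOne (-x) (fMinus hm f)) = 0) :
    G = 0 := by
  have key : ∀ f : 𝓢(Spacetime s, ℂ), IsLocalTest O f →
      ∀ᵐ p : EuclideanSpace ℝ (Fin s),
        inner ℂ (G (shellPoint m p)) (fPlus hm f (shellPoint m p)) = (0 : ℂ) := by
    intro f hf
    have iA := integrable_shellMeasure_iff.1 (L2.integrable_inner (𝕜 := ℂ) G (fPlus hm f))
    have iB := integrable_shellMeasure_iff.1 (L2.integrable_inner (𝕜 := ℂ) K (fMinus hm f))
    have hA := ae_eq_zero_of_superposition hm iA iB fun t y => by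
      have e := h f hf (WithLp.toLp 2 (Fin.cons t y.ofLp))
      rw [inner_transOne_eq, inner_transOne_eq] at e
      rw [← e]
      simp only [mink_neg_right, mink_shellPoint_eq, Fin.cons_zero, Fin.cons_succ]
    filter_upwards [hA] with p hp
    simpa [(energy_pos hm p).ne'] using hp
  -- No single function need be free of zeros on the whole shell, but every `p` has energy below
  -- some `k`, and countably many test functions suffice.
  choose F hF hF0 using fun k : ℕ => exists_isLocalTest_minkFourier_ne_zero hO hne m (k : ℝ)
  refine (Lp.eq_zero_iff_ae_eq_zero).2 (ae_shellMeasure_of_ae ?_)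
  filter_upwards [ae_all_iff.2 fun k => key (F k) (hF k),
    ae_all_iff.2 fun k => ae_of_ae_shellMeasure hm (coeFn_fPlus hm (F k))] with p h1 h2
  obtain ⟨k, hk⟩ := exists_nat_gt (energy m p)
  have h3 := h1 k
  rw [h2 k, RCLike.inner_apply] at h3
  rcases mul_eq_zero.1 h3 with h4 | h4
  · exact absurd h4 (hF0 k p hk.le)
  · simpa using h4

end oneParticle

end ScalarFermion

end

noncomputable section

namespace ScalarFermion

/-! ### The Reeh-Schlieder property -/

lemma dense_span_of_orthogonal {E : Type*} [NormedAddCommGroup E] [InnerProductSpace ℂ E]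
    [CompleteSpace E] {S : Set E} (h : ∀ v, (∀ u ∈ S, inner ℂ v u = 0) → v = 0) :
    Dense (Submodule.span ℂ S : Set E) := by
  rw [Submodule.dense_iff_topologicalClosure_eq_top, Submodule.topologicalClosure_eq_top_iff,
    Submodule.eq_bot_iff]
  exact fun v hv => h v fun u hu =>
    (Submodule.mem_orthogonal' _ _).1 hv u (Submodule.subset_span hu)

/-- The cutoff `N` does not depend on `C`. The pairing is thus one fixed finite sum for all smearing
functions, which makes it a bounded functional of them. -/
lemma exists_bracket_raise_eq_sum {G : ℕ → Type*} [∀ n, NormedAddCommGroup (G n)]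
    [∀ n, InnerProductSpace ℂ (G n)] [∀ n, CompleteSpace (G n)] {χ η : ∀ n, G n} (h : IsFinite χ ∨ IsFinite η) :
    ∃ N, ∀ C : ∀ n, G n →L[ℂ] G (n + 1),
      bracket χ (raise C η) = ∑ n ∈ Finset.range N, inner ℂ (χ (n + 1)) (C n (η n)) := by
  obtain ⟨N, hN⟩ : ∃ N, ∀ n, N < n → χ (n + 1) = 0 ∨ η n = 0 := by
    rcases h with ⟨N, hN⟩ | ⟨N, hN⟩
    · exact ⟨N, fun n hn => Or.inl (hN _ (by omega))⟩
    · exact ⟨N, fun n hn => Or.inr (hN _ hn)⟩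
  refine ⟨N + 1, fun C => ?_⟩
  rw [bracket, tsum_eq_sum (s := Finset.range (N + 1 + 1)), Finset.sum_range_succ']
  · simp
  · intro n hn
    cases n with
    | zero => simp
    | succ n =>
      rw [raise_succ]
      rcases hN n (by simp only [Finset.mem_range] at hn; omega) with h | h
      · rw [h, inner_zero_left]
      · rw [h, map_zero, inner_zero_right]

section ReehSchlieder

variable {s : ℕ} {m : ℝ} {W : Multiplier s} (hW : W.IsSymmetric) (hm : 0 < m)

/-- The pairing is a bounded linear functional of `g`, so the Riesz representation theorem applies.
-/
lemma exists_inner_eq_bracket_raise {χ η : ParticleSeq s m} (h : IsFinite χ ∨ IsFinite η) :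
    ∃ G : OneParticle s m, ∀ g, bracket χ (raise (cre hW g) η) = inner ℂ G g := by
  obtain ⟨N, hN⟩ := exists_bracket_raise_eq_sum h
  let L : OneParticle s m →L[ℂ] ℂ := ∑ n ∈ Finset.range N,
    (innerSL ℂ (χ (n + 1))).comp ((creL hW m n).flip (η n))
  refine ⟨(InnerProductSpace.toDual ℂ (OneParticle s m)).symm L, fun g => ?_⟩
  rw [InnerProductSpace.toDual_symm_apply, hN, sum_apply]
  rfl

lemma conj_inner_star (G h : OneParticle s m) :
    conj (inner ℂ G (star h)) = inner ℂ (star G) h := by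
  rw [inner_conj_symm, L2.inner_def, L2.inner_def]
  refine integral_congr_ae ?_
  filter_upwards [Lp.coeFn_star G, Lp.coeFn_star h] with p h1 h2
  rw [h1, h2, RCLike.inner_apply, RCLike.inner_apply, Pi.star_apply, Pi.star_apply, star_def,
    Complex.conj_conj, Complex.conj_conj, mul_comm]

/-- Annihilation operators are antilinear in their argument; with `star h` the pairing is linear in
`h`, and it is the conjugate of a creation pairing. -/
lemma exists_inner_eq_bracket_lower (χ : ParticleSeq s m) {η : ParticleSeq s m}
    (hη : IsFinite η) :
    ∃ K : OneParticle s m, ∀ h, bracket χ (lower (cre hW (star h)) η) = inner ℂ K h := by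
  obtain ⟨G, hG⟩ := exists_inner_eq_bracket_raise hW (Or.inl hη : IsFinite η ∨ IsFinite χ)
  refine ⟨star G, fun h => ?_⟩
  rw [← conj_inner_star, ← hG, bracket_raise_right, bracket_conj]

/-- The action of the smeared field on sequences. -/
def testSeq (f : 𝓢(Spacetime s, ℂ)) (χ : ParticleSeq s m) : ParticleSeq s m :=
  fieldSeq hW (fPlus hm f) (star (fMinus hm f)) χ

/-- Products of smeared fields applied to the vacuum. -/
def monomial : List 𝓢(Spacetime s, ℂ) → ParticleSeq s m
  | [] => ⇑(vacuum s m)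
  | f :: l => testSeq hW hm f (monomial l)

lemma isFinite_monomial (l : List 𝓢(Spacetime s, ℂ)) : IsFinite (monomial hW hm l) := by
  induction l with
  | nil => exact mem_finiteParticle_iff.1 (vacuum_mem s m)
  | cons f l ih => exact ih.fieldSeq hW _ _

lemma transSeq_testSeq (x : Spacetime s) (f : 𝓢(Spacetime s, ℂ)) (χ : ParticleSeq s m) :
    transSeq x (testSeq hW hm f χ) = testSeq hW hm (translate x f) (transSeq x χ) := by
  rw [testSeq, testSeq, transSeq_fieldSeq, fPlus_translate, fMinus_translate, star_transOne]

lemma transSeq_monomial (x : Spacetime s) (l : List 𝓢(Spacetime s, ℂ)) :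
    transSeq x (monomial hW hm l) = monomial hW hm (l.map (translate x)) := by
  induction l with
  | nil => exact transSeq_vacuum x
  | cons f l ih => rw [List.map_cons, monomial, monomial, transSeq_testSeq, ih]

/-- Orthogonality to all products of local fields applied to the vacuum. -/
def IsOrthogonal (O : Set (Spacetime s)) (χ : ParticleSeq s m) : Prop :=
  ∀ l : List 𝓢(Spacetime s, ℂ), (∀ f ∈ l, IsLocalTest O f) → bracket χ (monomial hW hm l) = 0

lemma exists_translate_list {O : Set (Spacetime s)} (hO : IsOpen O) {l : List 𝓢(Spacetime s, ℂ)}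
    (hl : ∀ f ∈ l, IsLocalTest O f) :
    ∃ δ > 0, ∀ x : Spacetime s, ‖x‖ < δ → ∀ f ∈ l, IsLocalTest O (translate x f) := by
  induction l with
  | nil => exact ⟨1, one_pos, fun _ _ f hf => absurd hf List.not_mem_nil⟩
  | cons g l ih =>
    obtain ⟨δ₁, h₁, H₁⟩ := ih fun f hf => hl f (List.mem_cons_of_mem g hf)
    obtain ⟨δ₂, h₂, H₂⟩ := (hl g List.mem_cons_self).exists_translate hO
    refine ⟨min δ₁ δ₂, lt_min h₁ h₂, fun x hx f hf => ?_⟩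
    rcases List.mem_cons.1 hf with rfl | hf
    · exact H₂ x (hx.trans_le (min_le_right _ _))
    · exact H₁ x (hx.trans_le (min_le_left _ _)) f hf

variable {hW hm} {O : Set (Spacetime s)} {χ : ParticleSeq s m}

/-- The leftmost field is decoupled from the others by two continuations. The first, for small `y`,
moves the whole product by an arbitrary `x` with the remaining fields displaced by `y` relative to
the first. The second, with the first field at `x` moved to the left side of the pairing, continues
in `y` up to `y = -x`, which brings the remaining fields back to their place. -/
lemma IsOrthogonal.bracket_translate (hχ : IsOrthogonal hW hm O χ) (hO : IsOpen O)
    {f : 𝓢(Spacetime s, ℂ)} (hf : IsLocalTest O f) {l : List 𝓢(Spacetime s, ℂ)}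
    (hl : ∀ f ∈ l, IsLocalTest O f) (x : Spacetime s) :
    bracket χ (testSeq hW hm (translate x f) (monomial hW hm l)) = 0 := by
  have hfin := isFinite_monomial hW hm l
  obtain ⟨δ₁, hδ₁, H₁⟩ := exists_translate_list hO hl
  obtain ⟨δ₂, hδ₂, H₂⟩ := hf.exists_translate hO
  have hδ : 0 < min δ₁ δ₂ / 2 := half_pos (lt_min hδ₁ hδ₂)
  have h1 : ∀ y : Spacetime s, ‖y‖ < min δ₁ δ₂ / 2 → ∀ x : Spacetime s,
      bracket χ (transSeq x (testSeq hW hm f (transSeq y (monomial hW hm l)))) = 0 := by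
    intro y hy
    refine bracket_transSeq_eq_zero χ ((hfin.transSeq y).fieldSeq hW _ _) hδ fun x hx => ?_
    rw [transSeq_testSeq, transSeq_transSeq, transSeq_monomial]
    refine hχ (translate x f :: l.map (translate (x + y))) fun g hg => ?_
    rcases List.mem_cons.1 hg with rfl | hg
    · exact H₂ x (by linarith [min_le_right δ₁ δ₂])
    · obtain ⟨g', hg', rfl⟩ := List.mem_map.1 hg
      refine H₁ (x + y) ((norm_add_le x y).trans_lt ?_) g' hg'
      linarith [min_le_left δ₁ δ₂]
  -- The adjoint field acts on the arbitrary sequence `χ`; this is legitimate in the pairing because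
  -- the other side is finite.
  have h2 := bracket_transSeq_eq_zero
    (fieldSeq hW (star (fMinus hm (translate x f))) (fPlus hm (translate x f)) χ)
    (hfin.transSeq x) hδ (fun y hy => ?_) (-x)
  · rw [transSeq_transSeq, neg_add_cancel, transSeq_zero] at h2
    exact (bracket_fieldSeq hW _ _ χ hfin).trans h2
  · have h3 := h1 y hy x
    rw [transSeq_testSeq, transSeq_transSeq] at h3
    rw [transSeq_transSeq, add_comm y x]
    exact (bracket_fieldSeq hW _ _ χ (hfin.transSeq _)).symm.trans h3

/-- Annihilation operators preserve orthogonality to the local fields applied to the vacuum. -/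
lemma IsOrthogonal.lower (hχ : IsOrthogonal hW hm O χ) (hO : IsOpen O) (hne : O.Nonempty)
    (g : OneParticle s m) : IsOrthogonal hW hm O (lower (cre hW g) χ) := by
  intro l hl
  have hfin := isFinite_monomial hW hm l
  obtain ⟨G, hG⟩ := exists_inner_eq_bracket_raise hW
    (Or.inr hfin : IsFinite χ ∨ IsFinite (monomial hW hm l))
  obtain ⟨K, hK⟩ := exists_inner_eq_bracket_lower hW χ hfin
  -- `G` and `K` represent the creation and annihilation parts of the pairing. Their sum vanishes
  -- for all translates of local test functions, and separation of frequencies leaves `G = 0`.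
  have hG0 : G = 0 := eq_zero_of_inner_transOne_add hm hO hne (K := K) fun f hf x => by
    rw [← fPlus_translate, ← fMinus_translate, ← hG, ← hK]
    exact (bracket_add_right χ hfin.raise hfin.lower).symm.trans (hχ.bracket_translate hO hf hl x)
  rw [← bracket_raise_right, hG, hG0, inner_zero_left]

/-- `(ℝ^d)⁰` is a single point of measure one, so the inner product is the conjugate of the value of
`Φ` there. -/
lemma eq_zero_of_inner_vacuumZero {Φ : nParticle s m 0} (h : inner ℂ Φ (vacuumZero s m) = 0) :
    Φ = 0 := by
  have h1 : (vacuumZero s m : Lp ℂ 2 (shellPi s m 0)) =ᵐ[shellPi s m 0] fun _ => 1 :=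
    MemLp.coeFn_toLp (memLp_const 1)
  rw [Submodule.coe_inner, L2.inner_def] at h
  have h2 : ∫ p, inner ℂ ((Φ : Lp ℂ 2 (shellPi s m 0)) p)
      ((vacuumZero s m : Lp ℂ 2 (shellPi s m 0)) p) ∂(shellPi s m 0) =
      conj ((Φ : Lp ℂ 2 (shellPi s m 0)) default) := by
    rw [integral_congr_ae (g := fun _ => conj ((Φ : Lp ℂ 2 (shellPi s m 0)) default))]
    · have h3 : (shellPi s m 0).real Set.univ = 1 := by
        rw [shellPi, Measure.pi_of_empty]; simp
      rw [integral_const, h3, one_smul]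
    · filter_upwards [h1] with p hp
      rw [hp, RCLike.inner_apply, one_mul, Subsingleton.elim p default]
  rw [h2, map_eq_zero] at h
  refine Subtype.ext ((Lp.eq_zero_iff_ae_eq_zero).2 (Filter.Eventually.of_forall fun p => ?_))
  rw [Subsingleton.elim p default, h, Pi.zero_apply]

/-- Induction over the particle number with `χ` variable: the `n`-th component of `a(g)χ` is
obtained from the `(n+1)`-st of `χ`, and `a(g)χ` is again orthogonal. Arbitrary sequences are needed
here, since `a(g)χ` may fail to be square summable even if `χ` is a Fock space vector. -/
lemma IsOrthogonal.eq_zero (hW0 : ∀ n p q, W.toFun n p q ≠ 0) (hO : IsOpen O) (hne : O.Nonempty)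
    (hχ : IsOrthogonal hW hm O χ) (n : ℕ) : χ n = 0 := by
  induction n generalizing χ with
  | zero =>
    refine eq_zero_of_inner_vacuumZero ?_
    exact (bracket_single χ 0 (vacuumZero s m)).symm.trans (hχ [] (by simp))
  | succ n ih => exact eq_zero_of_annL_eq_zero hW hW0 fun g => ih (hχ.lower hO hne g)

/-- All intermediate vectors have finite particle number, so that membership in the maximal domains
is automatic at each step. -/
lemma exists_isFieldMonomial (R : DeformationFunction)
    (Q : Matrix (Fin (s + 1)) (Fin (s + 1)) ℝ) {l : List 𝓢(Spacetime s, ℂ)}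
    (hl : ∀ f ∈ l, IsLocalTest O f) : ∃ Ψ : Fock s m, IsFieldMonomial hm R Q O Ψ ∧
      (⇑Ψ : ParticleSeq s m) = monomial (Multiplier.isSymmetric_deformation R Q) hm l := by
  induction l with
  | nil => exact ⟨vacuum s m, IsFieldMonomial.vacuum, rfl⟩
  | cons f l ih =>
    obtain ⟨Ψ, h1, h2⟩ := ih fun f hf => hl f (List.mem_cons_of_mem _ hf)
    have hΨ : Ψ ∈ finiteParticle s m := mem_finiteParticle_iff.2 (h2 ▸ isFinite_monomial _ _ l)
    have hdom : Ψ ∈ (deformedField hm R Q f).domain :=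
      finiteParticle_le_domain (Multiplier.isSymmetric_deformation R Q) _ _ hΨ
    refine ⟨_, IsFieldMonomial.apply f (hl f List.mem_cons_self).2 Ψ h1 hdom, ?_⟩
    refine (coe_smeared (Multiplier.isSymmetric_deformation R Q) _ _ ⟨Ψ, hdom⟩).trans ?_
    rw [h2]
    rfl

lemma deformation_ne_zero (R : DeformationFunction) (Q : Matrix (Fin (s + 1)) (Fin (s + 1)) ℝ)
    (n : ℕ) (p : Spacetime s) (q : Fin n → Spacetime s) :
    (Multiplier.deformation R Q).toFun n p q ≠ 0 := by
  change ∏ k : Fin n, R (mink (act Q p) (q k)) ≠ 0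
  exact Finset.prod_ne_zero_iff.2 fun k _ => norm_ne_zero_iff.1 (by rw [R.norm_eq_one]; simp)

-- Orthogonality is used only for test functions with compact support in `O`, where small
-- translations do not leave `O`; their monomials are already total.
variable (hm) in
theorem dense_span_isFieldMonomial (R : DeformationFunction)
    (Q : Matrix (Fin (s + 1)) (Fin (s + 1)) ℝ) (hO : IsOpen O) (hne : O.Nonempty) :
    Dense (Submodule.span ℂ {Ψ : Fock s m | IsFieldMonomial hm R Q O Ψ} : Set (Fock s m)) := by
  refine dense_span_of_orthogonal fun Ψ hΨ => lp.ext (funext fun n => ?_)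
  refine IsOrthogonal.eq_zero (hW := Multiplier.isSymmetric_deformation R Q) (hm := hm)
    (deformation_ne_zero R Q) hO hne (fun l hl => ?_) n
  obtain ⟨Φ, h1, h2⟩ := exists_isFieldMonomial (m := m) (hm := hm) R Q hl
  rw [← h2, ← inner_eq_bracket]
  exact hΨ Φ h1

end ReehSchlieder

end ScalarFermion

end

/-! ### The proposition -/

open ScalarFermion in
theorem mainTheorem3 (s : ℕ) (hs : 1 ≤ s) (m : ℝ) (hm : 0 < m) (R : DeformationFunction)
    (Q : Matrix (Fin (s + 1)) (Fin (s + 1)) ℝ) (hQ : IsAdmissible Q) :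
    -- a) domain properties and the action on the vacuum
    (Dense (finiteParticle s m : Set (Fock s m)) ∧
      ∀ f : 𝓢(Spacetime s, ℂ),
        finiteParticle s m ≤ (deformedField hm R Q f).domain ∧
        (∀ Ψ : (deformedField hm R Q f).domain, (Ψ : Fock s m) ∈ finiteParticle s m →
          deformedField hm R Q f Ψ ∈ finiteParticle s m) ∧
        ∃ (h : vacuum s m ∈ (deformedField hm R Q f).domain)
          (h' : vacuum s m ∈ (field hm f).domain),
          deformedField hm R Q f ⟨vacuum s m, h⟩ = field hm f ⟨vacuum s m, h'⟩) ∧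
    -- b) hermiticity and essential selfadjointness
    (∀ f : 𝓢(Spacetime s, ℂ), ∀ Ψ ∈ finiteParticle s m,
      ∃ (h : Ψ ∈ (deformedField hm R Q f).adjoint.domain)
        (h' : Ψ ∈ (deformedField hm R Q (conjTest f)).domain),
        (deformedField hm R Q f).adjoint ⟨Ψ, h⟩ = deformedField hm R Q (conjTest f) ⟨Ψ, h'⟩) ∧
    (∀ f : 𝓢(Spacetime s, ℂ), (∀ x, (f x).im = 0) →
      IsEssentiallySelfAdjointOn (deformedField hm R Q f) (finiteParticle s m)) ∧
    -- c) the Klein-Gordon equation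
    (∀ f : 𝓢(Spacetime s, ℂ), deformedField hm R Q (kleinGordon m f) = 0) ∧
    -- d) the Reeh-Schlieder property
    (∀ O : Set (Spacetime s), IsOpen O → O.Nonempty →
      Dense (Submodule.span ℂ {Ψ : Fock s m | IsFieldMonomial hm R Q O Ψ} : Set (Fock s m))) := by
  have hW := Multiplier.isSymmetric_deformation R Q
  refine ⟨⟨dense_finiteParticle s m, fun f => ⟨finiteParticle_le_domain hW _ _,
    fun Ψ hΨ => smeared_mem_finiteParticle hW _ _ Ψ hΨ, ?_⟩⟩, fun f Ψ hΨ => ?_, fun f hf => ?_,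
    fun f => ?_, fun O hO hne => dense_span_isFieldMonomial hm R Q hO hne⟩
  · exact ⟨finiteParticle_le_domain hW _ _ (vacuum_mem s m),
      finiteParticle_le_domain (Multiplier.isSymmetric_one s) _ _ (vacuum_mem s m),
      -- On zero particles the deformation factor is an empty product, hence `1`.
      smeared_vacuum hW (Multiplier.isSymmetric_one s) (fun p q =>
        Fintype.prod_empty fun k => R (mink (act Q p) (q k))) _ _ _ _⟩
  · rw [deformedField_eq, deformedField_eq, fPlus_conjTest, star_fMinus_conjTest]
    exact smeared_adjoint hW _ _ hΨ
  · have hc : conjTest f = f := by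
      ext x
      exact Complex.conj_eq_iff_im.2 (hf x)
    -- For real `f` the vector `conj f⁻` equals `f⁺`, so the field has the form `a*(g) + a(g)`.
    rw [deformedField_eq, ← fPlus_conjTest, hc]
    exact smeared_isEssentiallySelfAdjointOn hW _
  · have h0 : star (0 : OneParticle s m) = 0 := by
      refine Lp.ext ?_
      filter_upwards [Lp.coeFn_star (0 : OneParticle s m), Lp.coeFn_zero ℂ 2 (shellMeasure s m)]
        with p h1 h2
      rw [h1, Pi.star_apply, h2, Pi.zero_apply, star_zero]
    rw [deformedField_eq, fPlus_kleinGordon, fMinus_kleinGordon, h0]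
    exact smeared_zero hW
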